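/- Let $\mathsf D$ be a real Lie group of dimension $2d$ whose Lie algebra $\mathfrak d$ has a basis $T_1,\dots,T_d,\tilde T^1,\dots,\tilde T^d$ (a \emph{polarization}) with $$[T_m,T_n]=f_{mn}{}^kT_k+H_{mnk}\tilde T^k,\quad [T_m,\tilde T^n]=f_{km}{}^n\tilde T^k-Q^{kn}{}_mT_k,\quad [\tilde T^m,\tilde T^n]=Q^{mn}{}_k\tilde T^k+R^{mnk}T_k$$ (summation over repeated indices). Let $Z_m,\tilde Z^m$ be the corresponding left-invariant vector fields, $\Theta^m,\tilde\Theta_m$ the dual left-invariant 1-forms, and $$K=Z_m\otimes\Theta^m-\tilde Z^m\otimes\tilde\Theta_m,\qquad \eta=\Theta^m\otimes\tilde\Theta_m+\tilde\Theta_m\otimes\Theta^m,\qquad \omega(X,Y)=\eta(KX,Y).$$ The polarization is a \emph{Manin triple} if $H=R=0$; then $\mathsf D$ is a Drinfel'd double, and $\mathsf G,\tilde{\mathsf G}$ denote the connected Lie subgroups of $\mathsf D$ with Lie algebras $\mathfrak g=\langle T_m\rangle$, $\tilde{\mathfrak g}=\langle\tilde T^m\rangle$. Conventions. An almost para-Hermitian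 structure is a pair of a smooth $(1,1)$-tensor $K$ with $K^2=1$ and $\pm1$-eigenbundles $L_\pm$ of equal rank, and a metric $\eta$ of signature $(d,d)$ with $\eta(KX,KY)=-\eta(X,Y)$; it is para-Hermitian if $L_\pm$ are involutive, and para-Kähler if moreover $\mathrm d\omega=0$. The bracket of a connection $\nabla$ is given by $\eta([\![X,Y]\!]^\nabla,W)=\eta(\nabla_XY-\nabla_YX,W)+\eta(\nabla_WX,Y)$. The $\nabla^{\tt LC}$-bracket is that of the Levi-Civita connection of $\eta$. The D-bracket of $(K,\eta)$ is that of $\Pi_+\nabla^{\tt LC}\Pi_++\Pi_-\nabla^{\tt LC}\Pi_-$, where $\Pi_\pm=\frac12(1\pm K)$. An $\eta$-isotropic distribution is weakly integrable for a bracket if its sections are closed under it. $K$ is compatible with $K_0$ if $L_\pm$ are weakly integrable for the D-bracket of $(K_0,\eta)$. The $\nabla^{\tt LC}$-bracket plays the role of the D-bracket of the trivial para-Kähler structure, so compatibility with the latter means weak integrability of $L_\pm$ for the $\nabla^{\tt LC}$-bracket. $A_{[mnk]}$ is antisymmetrization with weight $\frac1{3!}$. (I) For every polarization, $(K,\eta)$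 is a left-invariant almost para-Hermitian structure on $\mathsf D$; $L_+$ and $L_-$ are spanned by the $Z_m$ and by the $\tilde Z^m$ and are Lagrangian for $\omega$; $L_+$ is involutive iff $H=0$, $L_-$ is involutive iff $R=0$; $\omega=\Theta^m\wedge\tilde\Theta_m$ and $$\mathrm d\omega=\tfrac12\big(H_{mnp}\Theta^m\wedge\Theta^n\wedge\Theta^p-R^{mnp}\tilde\Theta_m\wedge\tilde\Theta_n\wedge\tilde\Theta_p+f_{mn}{}^p\Theta^m\wedge\Theta^n\wedge\tilde\Theta_p-Q^{mn}{}_p\tilde\Theta_m\wedge\tilde\Theta_n\wedge\Theta^p\big).$$ (II) For every polarization, the Levi-Civita connection of $\eta$ exists. The D-bracket of $(K,\eta)$ satisfies $[\![Z_m,Z_n]\!]^{\tt D}=f_{mn}{}^kZ_k$ and $[\![\tilde Z^m,\tilde Z^n]\!]^{\tt D}=Q^{mn}{}_k\tilde Z^k$. The $\nabla^{\tt LC}$-bracket satisfies $$[\![Z_m,Z_n]\!]^{\nabla^{\tt LC}}=\tfrac32f_{mn}{}^kZ_k+\tfrac32H_{[mnk]}\tilde Z^k,\qquad [\![\tilde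 Z^m,\tilde Z^n]\!]^{\nabla^{\tt LC}}=\tfrac32Q^{mn}{}_k\tilde Z^k+\tfrac32R^{[mnk]}Z_k.$$ For this bracket $L_+$ is weakly integrable iff $H_{[mnk]}=0$ for all $m,n,k$, and $L_-$ iff $R^{[mnk]}=0$ for all $m,n,k$; if the duality pairing on $\mathfrak d$ is ad-invariant, this holds for $L_\pm$ iff $L_\pm$ is involutive. For every para-Kähler structure $(K_0,\eta)$ on $\mathsf D$ with the same metric, $K$ is compatible with $K_0$ iff $H_{[mnk]}=0=R^{[mnk]}$ for all $m,n,k$. (III) For a Manin triple, the pairing is ad-invariant and $(K,\eta)$ is para-Hermitian, with $$\mathrm d\omega=\tfrac12\big(f_{mn}{}^p\tilde\Theta_p\wedge\Theta^m\wedge\Theta^n-Q^{mn}{}_p\Theta^p\wedge\tilde\Theta_m\wedge\tilde\Theta_n\big).$$ The left translates $\gamma\mathsf G$ and $\gamma\tilde{\mathsf G}$, $\gamma\in\mathsf D$, are integral submanifolds of $L_+$ and $L_-$ and are exactly their leaves. $(K,\eta)$ is para-Kähler iff $f=Q=0$, iff $\mathsf G$ and $\tilde{\mathsf G}$ are abelian,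 and, if $\mathsf D$ is connected, iff $\mathsf D$ is abelian. The D-brackets of the frame are $f_{mn}{}^kZ_k$ and $Q^{mn}{}_k\tilde Z^k$, and the $\nabla^{\tt LC}$-brackets are $\tfrac32$ times these. Hence $L_\pm$ are weakly integrable for the $\nabla^{\tt LC}$-bracket, i.e. $(K,\eta)$ is compatible with the trivial para-Kähler structure, and $K$ is compatible with every para-Kähler structure $(K_0,\eta)$ on $\mathsf D$. -/

import Mathlib

open scoped Manifold ContDiff
open Bundle VectorField

set_option linter.unusedSectionVars false

noncomputable section

namespace ParaHermitian

/-! ### Tensor fields and distributions on a smooth manifold -/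

section Manifold

variable {E : Type*} [NormedAddCommGroup E] [NormedSpace ℝ E]
  {M : Type*} [TopologicalSpace M] [ChartedSpace E M]

variable (E M) in
/-- Vector fields on `M` (no regularity required). -/
abbrev VField : Type _ := Π x : M, TangentSpace 𝓘(ℝ, E) x

variable (E M) in
/-- Fields of endomorphisms of the tangent spaces. -/
abbrev EndField : Type _ :=
  Π x : M, TangentSpace 𝓘(ℝ, E) x →L[ℝ] TangentSpace 𝓘(ℝ, E) x

variable (E M) in
/-- Fields of bilinear forms on the tangent spaces. -/
abbrev BilinField : Type _ :=
  Π x : M, TangentSpace 𝓘(ℝ, E) x →L[ℝ] TangentSpace 𝓘(ℝ, E) x →L[ℝ] ℝ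

variable (E M) in
/-- Fields of subspaces of the tangent spaces. -/
abbrev Distribution : Type _ := Π x : M, Submodule ℝ (TangentSpace 𝓘(ℝ, E) x)

variable [IsManifold 𝓘(ℝ, E) ∞ M]

/-- `X` is a smooth section of the tangent bundle. -/
def IsSmoothVF (X : VField E M) : Prop :=
  ContMDiff 𝓘(ℝ, E) 𝓘(ℝ, E).tangent ∞ (fun x => (⟨x, X x⟩ : TangentBundle 𝓘(ℝ, E) M))

/-- `K` is a smooth section of `Hom(TM, TM)`. -/
def IsSmoothEnd (K : EndField E M) : Prop :=
  ContMDiff 𝓘(ℝ, E) (𝓘(ℝ, E).prod 𝓘(ℝ, E →L[ℝ] E)) ∞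
    (fun x => TotalSpace.mk' (E →L[ℝ] E)
      (E := fun x : M => TangentSpace 𝓘(ℝ, E) x →L[ℝ] TangentSpace 𝓘(ℝ, E) x) x (K x))

/-- `η` is a smooth section of `Hom(TM, Hom(TM, ℝ))`. -/
def IsSmoothBilin (η : BilinField E M) : Prop :=
  ContMDiff 𝓘(ℝ, E) (𝓘(ℝ, E).prod 𝓘(ℝ, E →L[ℝ] E →L[ℝ] ℝ)) ∞
    (fun x => TotalSpace.mk' (E →L[ℝ] E →L[ℝ] ℝ)
      (E := fun x : M => TangentSpace 𝓘(ℝ, E) x →L[ℝ] TangentSpace 𝓘(ℝ, E) x →L[ℝ] ℝ) x (η x))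

/-- The derivative `X(φ)` of a function along a vector field. -/
def dirDeriv (X : VField E M) (φ : M → ℝ) (x : M) : ℝ :=
  mfderiv 𝓘(ℝ, E) 𝓘(ℝ, ℝ) φ x (X x)

/-- `X` is a smooth section of the distribution `L`. -/
def IsSectionOf (L : Distribution E M) (X : VField E M) : Prop :=
  IsSmoothVF X ∧ ∀ x, X x ∈ L x

/-- Frobenius integrability: the sections of `L` are closed under the Lie bracket. -/
def IsInvolutive (L : Distribution E M) : Prop :=
  ∀ X Y : VField E M, IsSectionOf L X → IsSectionOf L Y →
    ∀ x, mlieBracket 𝓘(ℝ, E) X Y x ∈ L x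

/-- `q` is the end point of a smooth curve that starts in `p` and is everywhere tangent to `L`. -/
def TangentStep (L : Distribution E M) (p q : M) : Prop :=
  ∃ c : ℝ → M, ContMDiff 𝓘(ℝ, ℝ) 𝓘(ℝ, E) ∞ c ∧ c 0 = p ∧ c 1 = q ∧
    ∀ t : ℝ, mfderiv 𝓘(ℝ, ℝ) 𝓘(ℝ, E) c t (1 : ℝ) ∈ L (c t)

/-- The leaf of the (involutive) distribution `L` through `p`: the set of all points that are
reached from `p` by piecewise smooth curves tangent to `L`. -/
def leaf (L : Distribution E M) (p : M) : Set M :=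
  {q | Relation.ReflTransGen (TangentStep L) p q}

/-- The wedge product of two covectors. -/
def wedge₂ {V : Type*} (α β : V → ℝ) (u v : V) : ℝ := α u * β v - α v * β u

/-- The wedge product of three covectors, with the normalisation
`(α ∧ β ∧ γ)(u, v, w) = det`, so that `wedge₂` and `wedge₃` are normalised alike. -/
def wedge₃ {V : Type*} (α β γ : V → ℝ) (u v w : V) : ℝ :=
  Matrix.det !![α u, α v, α w; β u, β v, β w; γ u, γ v, γ w]

/-- The exterior derivative of a 2-form, evaluated on three vector fields. -/
def extDeriv₂ (om : BilinField E M) (X Y Z : VField E M) (x : M) : ℝ :=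
  dirDeriv X (fun y => om y (Y y) (Z y)) x
    - dirDeriv Y (fun y => om y (X y) (Z y)) x
    + dirDeriv Z (fun y => om y (X y) (Y y)) x
    - om x (mlieBracket 𝓘(ℝ, E) X Y x) (Z x)
    + om x (mlieBracket 𝓘(ℝ, E) X Z x) (Y x)
    - om x (mlieBracket 𝓘(ℝ, E) Y Z x) (X x)

/-- The 2-form `ω` is closed. -/
def IsClosedForm₂ (om : BilinField E M) : Prop :=
  ∀ X Y Z : VField E M, IsSmoothVF X → IsSmoothVF Y → IsSmoothVF Z →
    ∀ x, extDeriv₂ om X Y Z x = 0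

/-- `L` is Lagrangian for `ω`: at each point it equals its own `ω`-orthogonal. -/
def IsLagrangian (om : BilinField E M) (L : Distribution E M) : Prop :=
  ∀ x u, u ∈ L x ↔ ∀ v ∈ L x, om x u v = 0

/-! ### Para-Hermitian structures -/

/-- The `+1`-eigenbundle of `K`. -/
def Lplus (K : EndField E M) : Distribution E M :=
  fun x => Module.End.eigenspace (K x).toLinearMap (1 : ℝ)

/-- The `-1`-eigenbundle of `K`. -/
def Lminus (K : EndField E M) : Distribution E M :=
  fun x => Module.End.eigenspace (K x).toLinearMap (-1 : ℝ)

/-- The projection `(1 + K) / 2` onto the `+1`-eigenbundle. -/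
def projPlus (K : EndField E M) : EndField E M :=
  fun x => (1 / 2 : ℝ) • (ContinuousLinearMap.id ℝ (TangentSpace 𝓘(ℝ, E) x) + K x)

/-- The projection `(1 - K) / 2` onto the `-1`-eigenbundle. -/
def projMinus (K : EndField E M) : EndField E M :=
  fun x => (1 / 2 : ℝ) • (ContinuousLinearMap.id ℝ (TangentSpace 𝓘(ℝ, E) x) - K x)

/-- The bilinear form `η` has neutral signature `(d, d)` at each point. -/
def HasNeutralSignature (η : BilinField E M) : Prop :=
  ∀ x, ∃ P N : Submodule ℝ (TangentSpace 𝓘(ℝ, E) x),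
    IsCompl P N ∧ Module.finrank ℝ P = Module.finrank ℝ N ∧
    (∀ u ∈ P, u ≠ 0 → 0 < η x u u) ∧ (∀ u ∈ N, u ≠ 0 → η x u u < 0)

/-- `(K, η)` is an almost para-Hermitian structure: `K` is an almost para-complex structure and `η`
a metric of neutral signature with `η(KX, KY) = -η(X, Y)`. -/
structure IsAlmostParaHermitian
    (K : EndField E M) (η : BilinField E M) : Prop where
  smooth_end : IsSmoothEnd K
  smooth_metric : IsSmoothBilin η
  sq_eq_one : ∀ x u, K x (K x u) = u
  rank_eq : ∀ x, Module.finrank ℝ (Lplus K x) = Module.finrank ℝ (Lminus K x)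
  symm : ∀ x u v, η x u v = η x v u
  nondegenerate : ∀ x u, (∀ v, η x u v = 0) → u = 0
  signature : HasNeutralSignature η
  compat : ∀ x u v, η x (K x u) (K x v) = -η x u v

/-- An almost para-Hermitian structure with Frobenius integrable eigenbundles. -/
structure IsParaHermitian
    (K : EndField E M) (η : BilinField E M) : Prop
    extends IsAlmostParaHermitian K η where
  involutive_plus : IsInvolutive (Lplus K)
  involutive_minus : IsInvolutive (Lminus K)

/-- The fundamental 2-form `ω(X, Y) = η(KX, Y)`. -/
def fundamentalForm (K : EndField E M) (η : BilinField E M) : BilinField E M :=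
  fun x => (η x).comp (K x)

/-- A para-Hermitian structure with closed fundamental 2-form. -/
structure IsParaKahler
    (K : EndField E M) (η : BilinField E M) : Prop
    extends IsParaHermitian K η where
  closed : IsClosedForm₂ (fundamentalForm K η)

/-! ### Connections, brackets and weak integrability -/

/-- `nab` is the Levi-Civita connection of `η`: it is torsion-free and preserves `η`.
In Mathlib's convention `nab Y x (X x)` is the value of `∇_X Y` at `x`. -/
structure IsLeviCivita (η : BilinField E M)
    (nab : CovariantDerivative 𝓘(ℝ, E) E (TangentSpace 𝓘(ℝ, E) : M → Type _)) : Prop where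
  torsion_free : ∀ X Y : VField E M, IsSmoothVF X → IsSmoothVF Y → ∀ x,
    nab Y x (X x) - nab X x (Y x) = mlieBracket 𝓘(ℝ, E) X Y x
  metric : ∀ X Y Z : VField E M, IsSmoothVF X → IsSmoothVF Y → IsSmoothVF Z → ∀ x,
    dirDeriv X (fun y => η y (Y y) (Z y)) x =
      η x (nab Y x (X x)) (Z x) + η x (Y x) (nab Z x (X x))

/-- The bracket associated with a connection `nab` on an (almost) para-Hermitian manifold,
`η(⟦X, Y⟧, Z) = η(∇_X Y - ∇_Y X, Z) + η(∇_Z X, Y)`; see `connBracket_spec`. -/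
def connBracket (η : BilinField E M)
    (nab : VField E M → EndField E M) (X Y : VField E M) : VField E M :=
  fun x => nab Y x (X x) - nab X x (Y x)
    + (η x).inverse ((η x (Y x)).comp (nab X x))

/-- `∇^can_X Y = Π₊ ∇_X (Π₊ Y) + Π₋ ∇_X (Π₋ Y)`, where `∇` is the Levi-Civita connection. -/
def canonicalConnection (K : EndField E M) (nab : VField E M → EndField E M) :
    VField E M → EndField E M :=
  fun Y x => (projPlus K x).comp (nab (fun y => projPlus K y (Y y)) x)
    + (projMinus K x).comp (nab (fun y => projMinus K y (Y y)) x)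

/-- The D-bracket associated with `(K, η)`: the bracket of the canonical connection. Here `nab` is
the Levi-Civita connection of `η`. -/
def dBracket (K : EndField E M) (η : BilinField E M) (nab : VField E M → EndField E M) :
    VField E M → VField E M → VField E M :=
  connBracket η (canonicalConnection K nab)

/-- An `η`-isotropic distribution whose sections are closed under the bracket `br`. -/
def IsWeaklyIntegrable (η : BilinField E M) (br : VField E M → VField E M → VField E M)
    (L : Distribution E M) : Prop :=
  (∀ x, ∀ u ∈ L x, ∀ v ∈ L x, η x u v = 0) ∧
  ∀ X Y : VField E M, IsSectionOf L X → IsSectionOf L Y → ∀ x, br X Y x ∈ L x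

/-- Both eigenbundles of `K` are weakly integrable for the bracket `br`. -/
def EigenbundlesWeaklyIntegrable (K : EndField E M) (η : BilinField E M)
    (br : VField E M → VField E M → VField E M) : Prop :=
  IsWeaklyIntegrable η br (Lplus K) ∧ IsWeaklyIntegrable η br (Lminus K)

/-- `K'` is compatible with `K` (for the same metric `η` with Levi-Civita connection `nab`):
the eigenbundles of `K'` are weakly integrable for the D-bracket of `(K, η)`. -/
def IsCompatibleWith (K' K : EndField E M) (η : BilinField E M)
    (nab : VField E M → EndField E M) : Prop :=
  EigenbundlesWeaklyIntegrable K' η (dBracket K η nab)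

/-- The inverse of an injective map from a finite-dimensional space to its dual. -/
theorem inverse_dual_spec {V : Type*} [NormedAddCommGroup V] [NormedSpace ℝ V]
    [FiniteDimensional ℝ V] (B : V →L[ℝ] V →L[ℝ] ℝ) (hB : Function.Injective B)
    (φ : V →L[ℝ] ℝ) : B (B.inverse φ) = φ := by
  have hdim : Module.finrank ℝ V = Module.finrank ℝ (V →L[ℝ] ℝ) := by
    rw [← LinearEquiv.finrank_eq (LinearMap.toContinuousLinearMap (𝕜 := ℝ) (E := V) (F' := ℝ)),
      Module.finrank_linearMap, Module.finrank_self, mul_one]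
  let e : V ≃L[ℝ] (V →L[ℝ] ℝ) :=
    (LinearEquiv.ofInjectiveOfFinrankEq B.toLinearMap hB hdim).toContinuousLinearEquiv
  have he : (e : V →L[ℝ] (V →L[ℝ] ℝ)) = B := by
    ext u v
    rfl
  rw [← he, ContinuousLinearMap.inverse_equiv]
  exact e.apply_symm_apply φ

/-- The defining identity of the bracket associated with a connection. -/
theorem connBracket_spec [FiniteDimensional ℝ E] (η : BilinField E M)
    (symm : ∀ x u v, η x u v = η x v u) (nondeg : ∀ x u, (∀ v, η x u v = 0) → u = 0)
    (nab : VField E M → EndField E M) (X Y : VField E M) (x : M)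
    (z : TangentSpace 𝓘(ℝ, E) x) :
    η x (connBracket η nab X Y x) z =
      η x (nab Y x (X x) - nab X x (Y x)) z + η x (nab X x z) (Y x) := by
  have hinj : Function.Injective (η x) := by
    intro u v h
    refine sub_eq_zero.mp (nondeg x _ fun w => ?_)
    rw [map_sub, h, sub_self]
    rfl
  have key : η x ((η x).inverse ((η x (Y x)).comp (nab X x))) = (η x (Y x)).comp (nab X x) :=
    inverse_dual_spec (V := E) (η x) hinj _
  have h2 := congrArg (fun φ => φ z) key
  have h1 : η x (connBracket η nab X Y x) = η x (nab Y x (X x) - nab X x (Y x)) +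
      η x ((η x).inverse ((η x (Y x)).comp (nab X x))) := map_add (η x) _ _
  rw [h1]
  refine (congrArg (fun r => η x (nab Y x (X x) - nab X x (Y x)) z + r) h2).trans ?_
  exact congrArg (fun r => η x (nab Y x (X x) - nab X x (Y x)) z + r) (symm x (Y x) _)

end Manifold

/-! ### Lie groups -/

section LieGroup

variable {E : Type*} [NormedAddCommGroup E] [NormedSpace ℝ E]
  {D : Type*} [TopologicalSpace D] [ChartedSpace E D] [Group D]

/-- `K` commutes with the differentials of all left translations. -/
def IsLeftInvariantEnd (K : EndField E D) : Prop :=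
  ∀ (g x : D) (u : TangentSpace 𝓘(ℝ, E) x),
    K (g * x) (mfderiv 𝓘(ℝ, E) 𝓘(ℝ, E) (g * ·) x u) =
      mfderiv 𝓘(ℝ, E) 𝓘(ℝ, E) (g * ·) x (K x u)

/-- All left translations preserve the bilinear form `η`. -/
def IsLeftInvariantBilin (η : BilinField E D) : Prop :=
  ∀ (g x : D) (u v : TangentSpace 𝓘(ℝ, E) x),
    η (g * x) (mfderiv 𝓘(ℝ, E) 𝓘(ℝ, E) (g * ·) x u) (mfderiv 𝓘(ℝ, E) 𝓘(ℝ, E) (g * ·) x v) =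
      η x u v

/-- The homomorphism `ι : G → D` exhibits `G` as an (immersed) Lie subgroup of `D` whose Lie algebra
is the subspace `s` of the Lie algebra of `D`. -/
structure IsLieSubgroup {F : Type*} [NormedAddCommGroup F] [NormedSpace ℝ F]
    {G : Type*} [TopologicalSpace G] [ChartedSpace F G] [Group G]
    (ι : G →* D) (s : Submodule ℝ (GroupLieAlgebra 𝓘(ℝ, E) D)) : Prop where
  smooth : ContMDiff 𝓘(ℝ, F) 𝓘(ℝ, E) ∞ ι
  injective : Function.Injective ι
  immersion : ∀ h : G, Function.Injective (mfderiv 𝓘(ℝ, F) 𝓘(ℝ, E) ι h)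
  lieAlgebra : ∀ u : GroupLieAlgebra 𝓘(ℝ, E) D, u ∈ s ↔ ∃ w, mfderiv 𝓘(ℝ, F) 𝓘(ℝ, E) ι 1 w = u

variable (E D) in
/-- A polarization of the Lie algebra of `D`: a basis `T_m = basis (inl m)`,
`T̃^m = basis (inr m)` with structure constants
`[T_m, T_n] = f_{mn}^k T_k + H_{mnk} T̃^k`, `[T_m, T̃^n] = f_{km}^n T̃^k - Q^{kn}_m T_k` and
`[T̃^m, T̃^n] = Q^{mn}_k T̃^k + R^{mnk} T_k`. The array entries are `f m n k = f_{mn}^k`,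
`Q m n k = Q^{mn}_k`, `H m n k = H_{mnk}` and `R m n k = R^{mnk}`. -/
structure Polarization (d : ℕ) where
  basis : Module.Basis (Fin d ⊕ Fin d) ℝ (GroupLieAlgebra 𝓘(ℝ, E) D)
  f : Fin d → Fin d → Fin d → ℝ
  Q : Fin d → Fin d → Fin d → ℝ
  H : Fin d → Fin d → Fin d → ℝ
  R : Fin d → Fin d → Fin d → ℝ
  lie_left : ∀ m n, ⁅basis (Sum.inl m), basis (Sum.inl n)⁆ =
    ∑ k, f m n k • basis (Sum.inl k) + ∑ k, H m n k • basis (Sum.inr k)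
  lie_mixed : ∀ m n, ⁅basis (Sum.inl m), basis (Sum.inr n)⁆ =
    ∑ k, f k m n • basis (Sum.inr k) - ∑ k, Q k n m • basis (Sum.inl k)
  lie_right : ∀ m n, ⁅basis (Sum.inr m), basis (Sum.inr n)⁆ =
    ∑ k, Q m n k • basis (Sum.inr k) + ∑ k, R m n k • basis (Sum.inl k)

namespace Polarization

variable {d : ℕ} (P : Polarization E D d)

/-- A Manin triple: both halves of the polarization are Lie subalgebras. -/
def IsManinTriple : Prop := P.H = 0 ∧ P.R = 0

/-- The subspace spanned by the `T_m`. -/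
def gSub : Submodule ℝ (GroupLieAlgebra 𝓘(ℝ, E) D) :=
  Submodule.span ℝ (Set.range fun m => P.basis (Sum.inl m))

/-- The subspace spanned by the `T̃^m`. -/
def gSub' : Submodule ℝ (GroupLieAlgebra 𝓘(ℝ, E) D) :=
  Submodule.span ℝ (Set.range fun m => P.basis (Sum.inr m))

/-- The left-invariant vector field `Z_m`. -/
def Z (m : Fin d) : VField E D := mulInvariantVectorField (P.basis (Sum.inl m))

/-- The left-invariant vector field `Z̃^m`. -/
def Z' (m : Fin d) : VField E D := mulInvariantVectorField (P.basis (Sum.inr m))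

/-- The left-invariant 1-forms dual to the frame `Z_m`, `Z̃^m`: the components of the Maurer-Cartan
form `γ⁻¹ dγ` in the basis of the Lie algebra. -/
def coframe (A : Fin d ⊕ Fin d) (x : D) :
    TangentSpace 𝓘(ℝ, E) x →L[ℝ] ℝ :=
  haveI : FiniteDimensional ℝ (GroupLieAlgebra 𝓘(ℝ, E) D) := P.basis.finiteDimensional_of_finite
  haveI : T2Space (GroupLieAlgebra 𝓘(ℝ, E) D) := inferInstanceAs (T2Space E)
  (LinearMap.toContinuousLinearMap (P.basis.coord A)).comp
    (mfderiv 𝓘(ℝ, E) 𝓘(ℝ, E) (x⁻¹ * ·) x)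

/-- The left-invariant 1-form `Θ^m`. -/
def Θ (m : Fin d) (x : D) : TangentSpace 𝓘(ℝ, E) x →L[ℝ] ℝ := P.coframe (Sum.inl m) x

/-- The left-invariant 1-form `Θ̃_m`. -/
def Θ' (m : Fin d) (x : D) : TangentSpace 𝓘(ℝ, E) x →L[ℝ] ℝ := P.coframe (Sum.inr m) x

/-- `K = Z_m ⊗ Θ^m - Z̃^m ⊗ Θ̃_m`. -/
def K : EndField E D :=
  fun x => ∑ m, ((P.Θ m x).smulRight (P.Z m x) - (P.Θ' m x).smulRight (P.Z' m x))

/-- `η = Θ^m ⊗ Θ̃_m + Θ̃_m ⊗ Θ^m`. -/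
def η : BilinField E D :=
  fun x => ∑ m, ((P.Θ m x).smulRight (P.Θ' m x) + (P.Θ' m x).smulRight (P.Θ m x))

/-- The fundamental 2-form `ω(X, Y) = η(KX, Y)`. -/
def Ω : BilinField E D := fundamentalForm P.K P.η

/-- The duality pairing on the Lie algebra is ad-invariant. -/
def IsAdInvariant : Prop :=
  ∀ X Y W : GroupLieAlgebra 𝓘(ℝ, E) D, P.η 1 ⁅X, Y⁆ W = P.η 1 X ⁅Y, W⁆

end Polarization

/-- The antisymmetrization `A_{[mnk]}` with weight `1/6`. -/
def antisymm {d : ℕ} (A : Fin d → Fin d → Fin d → ℝ) (m n k : Fin d) : ℝ :=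
  (1 / 6) * (A m n k + A n k m + A k m n - A n m k - A m k n - A k n m)

end LieGroup

end ParaHermitian

end

/-!
A Lie group `D` is handled through its left trivialization: the Maurer-Cartan form `mcForm`
identifies every tangent space with the model space `E`, that is with the Lie algebra, and turns a
vector field `X` into a function `leftTriv X : D → E`. Smoothness can be read off from this
function (`isSmoothVF_iff`), `K` and `η` become the constants `K₀` and `η₀`, and the Lie bracket
of `X` and `Y` becomes `X(Y) - Y(X) + [X, Y]` with the bracket `lieB` of the Lie algebra
(`leftTriv_mlieBracket`). Exchanging the two halves of a polarization (`Polarization.swap`) keeps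
`η`, changes the sign of `K` and exchanges `f` with `Q` and `H` with `R`; hence only statements
about `L₊` need a proof.

The exterior derivative of a left-invariant 2-form is its Chevalley-Eilenberg differential
(`extDeriv₂_leftBilin`), a trilinear form on the Lie algebra, and the formula for `dω` is compared
on the basis. For the connection the basic fact is the Koszul formula `IsLeviCivita.koszul`. It
gives the existence of the Levi-Civita connection `∇` and, for fields with constant mutual
products, its bracket as half the cyclic sum of `η([X, Y], W)`
(`IsLeviCivita.two_mul_connBracket`). The cyclic sum antisymmetrizes `H`, which is where
`H_{[mnk]}` comes from. Torsion-freeness alone shows that the D-bracket of sections of `L₊` is the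
projection of their Lie bracket (`IsLeviCivita.dBracket_eq`). If `(K', η)` is para-Kähler with
fundamental form `ω'`, the Koszul formula together with `dω' = 0` and involutivity shows that `∇`
preserves the eigenbundles of `K'` (`IsLeviCivita.nab_eigen`); so the canonical connection is `∇`
itself, and compatibility with `K'` does not depend on `K'`.

For a Manin triple `dω` consists of the `f` and `Q` terms only, so that para-Kähler means
`f = Q = 0`, i.e. that both halves are abelian Lie algebras. That a connected Lie subgroup is
abelian if and only if its Lie algebra is (`IsLieSubgroup.comm_iff`) is proved without the
exponential map. A left-invariant and a right-invariant field commute, because in a chart they are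
the two partial derivatives of the multiplication and second derivatives are symmetric
(`mlieBracket_leftVF_rightVF_one`); so the derivative of the adjoint action is the bracket. Maps
into a Lie group are compared through their logarithmic derivatives (`eq_of_logDer_eq`).

The leaves of `L₊` are the left cosets of `G` (`IsLieSubgroup.leaf_eq`). A coset lies in a leaf
because nearby points of `G` are joined by segments in charts and `G` is connected. Conversely, by
the inverse function theorem a neighbourhood of `1` in `D` factors as `G'` times `G`
(`IsLieSubgroup.exists_local_factorization`). Along a curve tangent to `L₊` the logarithmic
derivative of the `G'`-factor lies in both halves of the Lie algebra, hence vanishes, and the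
curve stays in a coset of `G`.
-/

noncomputable section

namespace ParaHermitian

/-! ### Model derivatives and the left trivialization -/

section ModelDerivative

variable {E : Type*} [NormedAddCommGroup E] [NormedSpace ℝ E]
  {F : Type*} [NormedAddCommGroup F] [NormedSpace ℝ F]
  {W : Type*} [NormedAddCommGroup W] [NormedSpace ℝ W]
  {M : Type*} [TopologicalSpace M] [ChartedSpace E M]
  {N : Type*} [TopologicalSpace N] [ChartedSpace F N]
  {O : Type*} [TopologicalSpace O] [ChartedSpace W O]

variable (E F) in
/-- The differential of a map between manifolds as a linear map between the model spaces, with which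
all tangent spaces are identified by definition. -/
def mder (f : M → N) (x : M) : E →L[ℝ] F := mfderiv 𝓘(ℝ, E) 𝓘(ℝ, F) f x

theorem mder_comp {g : N → O} {f : M → N} (x : M) (hg : MDifferentiableAt 𝓘(ℝ, F) 𝓘(ℝ, W) g (f x))
    (hf : MDifferentiableAt 𝓘(ℝ, E) 𝓘(ℝ, F) f x) :
    mder E W (fun z => g (f z)) x = (mder F W g (f x)).comp (mder E F f x) :=
  mfderiv_comp x hg hf

theorem mder_comp_apply {g : N → O} {f : M → N} (x : M)
    (hg : MDifferentiableAt 𝓘(ℝ, F) 𝓘(ℝ, W) g (f x))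
    (hf : MDifferentiableAt 𝓘(ℝ, E) 𝓘(ℝ, F) f x) (v : E) :
    mder E W (fun z => g (f z)) x v = mder F W g (f x) (mder E F f x v) := by
  rw [mder_comp x hg hf]; rfl

theorem mder_id (x : M) : mder E E (fun z : M => z) x = ContinuousLinearMap.id ℝ E :=
  mfderiv_id

theorem mder_const (c : N) (x : M) : mder E F (fun _ : M => c) x = 0 :=
  mfderiv_const

theorem _root_.Filter.EventuallyEq.mder_eq {f g : M → N} {x : M} (h : f =ᶠ[nhds x] g) :
    mder E F f x = mder E F g x :=
  h.mfderiv_eq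

theorem mder_eq_fderiv (f : E → F) (x : E) : mder E F f x = fderiv ℝ f x :=
  mfderiv_eq_fderiv

theorem _root_.HasMFDerivAt.mder_eq {f : M → N} {x : M} {f' : E →L[ℝ] F}
    (h : HasMFDerivAt 𝓘(ℝ, E) 𝓘(ℝ, F) f x f') : mder E F f x = f' :=
  h.mfderiv

theorem _root_.MDifferentiableAt.hasMFDerivAt_mder {f : M → N} {x : M}
    (h : MDifferentiableAt 𝓘(ℝ, E) 𝓘(ℝ, F) f x) :
    HasMFDerivAt 𝓘(ℝ, E) 𝓘(ℝ, F) f x (mder E F f x) :=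
  h.hasMFDerivAt

theorem mder_add {f g : M → F} {x : M} (hf : MDifferentiableAt 𝓘(ℝ, E) 𝓘(ℝ, F) f x)
    (hg : MDifferentiableAt 𝓘(ℝ, E) 𝓘(ℝ, F) g x) :
    mder E F (fun z => f z + g z) x = mder E F f x + mder E F g x :=
  (hf.hasMFDerivAt.add hg.hasMFDerivAt).mfderiv

theorem mder_smul {a : M → ℝ} {g : M → F} {x : M} (ha : MDifferentiableAt 𝓘(ℝ, E) 𝓘(ℝ, ℝ) a x)
    (hg : MDifferentiableAt 𝓘(ℝ, E) 𝓘(ℝ, F) g x) (v : E) :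
    mder E F (fun z => a z • g z) x v = a x • mder E F g x v + mder E ℝ a x v • g x := by
  have h := mvfderiv_smul ha hg
  exact congrArg (fun φ : E →L[ℝ] F => φ v) h

/-- The product rule for a bounded bilinear map. -/
theorem mder_bilin {G : Type*} [NormedAddCommGroup G] [NormedSpace ℝ G]
    (B : F →L[ℝ] W →L[ℝ] G) {f : M → F} {g : M → W} {x : M}
    (hf : MDifferentiableAt 𝓘(ℝ, E) 𝓘(ℝ, F) f x)
    (hg : MDifferentiableAt 𝓘(ℝ, E) 𝓘(ℝ, W) g x) (v : E) :
    mder E G (fun z => B (f z) (g z)) x v =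
      B (mder E F f x v) (g x) + B (f x) (mder E W g x v) := by
  have h1 : HasFDerivAt (fun p : F × W => B p.1 p.2) (B.isBoundedBilinearMap.deriv (f x, g x))
      (f x, g x) := B.isBoundedBilinearMap.hasFDerivAt _
  have h2 := HasMFDerivAt.comp (g := fun p : F × W => B p.1 p.2) (f := fun z => (f z, g z)) x
    h1.hasMFDerivAt (f' := (mder E F f x).prod (mder E W g x))
    ⟨hf.hasMFDerivAt_mder.1.prodMk hg.hasMFDerivAt_mder.1,
      hf.hasMFDerivAt_mder.2.prodMk hg.hasMFDerivAt_mder.2⟩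
  have h3 : mder E G (fun z => B (f z) (g z)) x = _ := h2.mder_eq
  rw [h3, add_comm]
  rfl

theorem mder_clm (L : F →L[ℝ] W) {f : M → F} {x : M}
    (hf : MDifferentiableAt 𝓘(ℝ, E) 𝓘(ℝ, F) f x) (v : E) :
    mder E W (fun z => L (f z)) x v = L (mder E F f x v) := by
  rw [mder_comp_apply (g := L) x L.mdifferentiableAt hf, mder_eq_fderiv, L.fderiv]

end ModelDerivative

section LeftTrivialization

variable {E : Type*} [NormedAddCommGroup E] [NormedSpace ℝ E]
  {D : Type*} [TopologicalSpace D] [ChartedSpace E D] [Group D]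

variable (E) in
/-- The Maurer-Cartan form `dL_{x⁻¹}`, with the Lie algebra identified with the model space `E`. -/
def mcForm (x : D) : E →L[ℝ] E := mder E E (x⁻¹ * ·) x

variable (E) in
/-- The differential `dL_x` of the left translation by `x`, from the Lie algebra, identified with
the model space `E`, to the tangent space at `x`. -/
def leftTr (x : D) : E →L[ℝ] E := mder E E (x * ·) (1 : D)

variable [LieGroup 𝓘(ℝ, E) ∞ D]

theorem mdifferentiableAt_mul_left' {a x : D} :
    MDifferentiableAt 𝓘(ℝ, E) 𝓘(ℝ, E) (a * ·) x :=
  (contMDiff_mul_left (I := 𝓘(ℝ, E)) (n := ∞)).mdifferentiableAt (by simp)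

theorem mdifferentiableAt_mul_right' {a x : D} :
    MDifferentiableAt 𝓘(ℝ, E) 𝓘(ℝ, E) (· * a) x :=
  (contMDiff_mul_right (I := 𝓘(ℝ, E)) (n := ∞)).mdifferentiableAt (by simp)

theorem mcForm_leftTr (x : D) (v : E) : mcForm E x (leftTr E x v) = v := by
  have h := mder_comp_apply (E := E) (F := E) (W := E) (g := fun z : D => x⁻¹ * z)
    (f := fun z : D => x * z) 1 mdifferentiableAt_mul_left' mdifferentiableAt_mul_left' v
  simp only [inv_mul_cancel_left, mder_id, mul_one] at h
  exact h.symm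

theorem leftTr_mcForm (x : D) (u : E) : leftTr E x (mcForm E x u) = u := by
  have h := mder_comp_apply (E := E) (F := E) (W := E) (g := fun z : D => x * z)
    (f := fun z : D => x⁻¹ * z) x mdifferentiableAt_mul_left' mdifferentiableAt_mul_left' u
  simp only [mul_inv_cancel_left, mder_id, inv_mul_cancel] at h
  exact h.symm

theorem leftTr_mul (a x : D) (v : E) :
    leftTr E (a * x) v = mder E E (a * ·) x (leftTr E x v) := by
  have h := mder_comp_apply (E := E) (F := E) (W := E) (g := fun z : D => a * z)
    (f := fun z : D => x * z) 1 mdifferentiableAt_mul_left' mdifferentiableAt_mul_left' v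
  simp only [← mul_assoc, mul_one] at h
  exact h

/-- The Maurer-Cartan form is left-invariant. -/
theorem mcForm_mul_left (a x : D) (u : E) :
    mcForm E (a * x) (mder E E (a * ·) x u) = mcForm E x u := by
  conv_lhs => rw [← leftTr_mcForm x u]
  rw [← leftTr_mul, mcForm_leftTr]

theorem leftTr_one (v : E) : leftTr E (1 : D) v = v := by
  simp [leftTr, mder_id]

theorem mcForm_one (u : E) : mcForm E (1 : D) u = u := by
  simp [mcForm, mder_id]

theorem leftTr_eq_iff (x : D) (v u : E) : leftTr E x v = u ↔ v = mcForm E x u :=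
  ⟨fun h => by rw [← h, mcForm_leftTr], fun h => by rw [h, leftTr_mcForm]⟩

theorem mcForm_injective (x : D) : Function.Injective (mcForm E x) := fun u v h => by
  rw [← leftTr_mcForm x u, h, leftTr_mcForm]

variable (E) in
/-- The tangent bundle trivialization at `x₀`, on the fibre over `x`. -/
def trivAt (x₀ x : D) : E →L[ℝ] E :=
  (trivializationAt E (TangentSpace 𝓘(ℝ, E)) x₀).continuousLinearMapAt ℝ x

variable (E) in
/-- The inverse of `trivAt E x₀ x`, for `x` in the domain of the chart at `x₀`. -/
def trivSymmAt (x₀ x : D) : E →L[ℝ] E :=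
  (trivializationAt E (TangentSpace 𝓘(ℝ, E)) x₀).symmL ℝ x

theorem trivAt_self (x : D) : trivAt E x x = ContinuousLinearMap.id ℝ E := by
  ext v
  simp only [trivAt]
  rw [TangentBundle.continuousLinearMapAt_trivializationAt_eq_core (by simp)]
  exact (tangentBundleCore 𝓘(ℝ, E) D).coordChange_self (achart E x) x (by simp) v

theorem trivSymmAt_self (x : D) : trivSymmAt E x x = ContinuousLinearMap.id ℝ E := by
  ext v
  simp only [trivSymmAt]
  rw [TangentBundle.symmL_trivializationAt_eq_core (by simp)]
  exact (tangentBundleCore 𝓘(ℝ, E) D).coordChange_self (achart E x) x (by simp) v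

theorem trivSymmAt_trivAt {x₀ x : D} (hx : x ∈ (chartAt E x₀).source) (u : E) :
    trivSymmAt E x₀ x (trivAt E x₀ x u) = u :=
  (trivializationAt E (TangentSpace 𝓘(ℝ, E)) x₀).symmL_continuousLinearMapAt hx u

/-- The Maurer-Cartan form is smooth: it is the differential at `y = x` of `y ↦ x⁻¹ * y`, which
depends smoothly on the parameter `x`. Since `x⁻¹ * x = 1` does not move, only the source has to be
trivialized. -/
theorem contMDiffAt_mcForm_trivSymmAt (x₀ : D) :
    ContMDiffAt 𝓘(ℝ, E) 𝓘(ℝ, E →L[ℝ] E) ∞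
      (fun x : D => (mcForm E x).comp (trivSymmAt E x₀ x)) x₀ := by
  have h := ContMDiffAt.mfderiv (I := 𝓘(ℝ, E)) (I' := 𝓘(ℝ, E)) (J := 𝓘(ℝ, E)) (m := ∞) (n := ∞)
    (x₀ := x₀) (fun x y : D => x⁻¹ * y) id
    (by
      have : ContMDiff (𝓘(ℝ, E).prod 𝓘(ℝ, E)) 𝓘(ℝ, E) ∞ (fun p : D × D => p.1⁻¹ * p.2) :=
        (contMDiff_fst.inv).mul contMDiff_snd
      exact this.contMDiffAt) contMDiffAt_id (by simp)
  refine h.congr_of_eventuallyEq (Filter.Eventually.of_forall fun x => ?_)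
  have h2 : trivAt E (x₀⁻¹ * x₀) (x⁻¹ * x) = ContinuousLinearMap.id ℝ E := by
    rw [inv_mul_cancel, inv_mul_cancel, trivAt_self]
  change _ = (trivAt E (x₀⁻¹ * x₀) (x⁻¹ * x)).comp ((mcForm E x).comp (trivSymmAt E x₀ x))
  rw [h2]; rfl

/-- The left trivialization is smooth: `leftTr E x` is the differential at the fixed point `1` of `y
↦ x * y`, so only the target has to be trivialized. -/
theorem contMDiffAt_trivAt_leftTr (x₀ : D) :
    ContMDiffAt 𝓘(ℝ, E) 𝓘(ℝ, E →L[ℝ] E) ∞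
      (fun x : D => (trivAt E x₀ x).comp (leftTr E x)) x₀ := by
  have h := ContMDiffAt.mfderiv (I := 𝓘(ℝ, E)) (I' := 𝓘(ℝ, E)) (J := 𝓘(ℝ, E)) (m := ∞) (n := ∞)
    (x₀ := x₀) (fun x y : D => x * y) (fun _ => 1)
    (by
      have : ContMDiff (𝓘(ℝ, E).prod 𝓘(ℝ, E)) 𝓘(ℝ, E) ∞ (fun p : D × D => p.1 * p.2) :=
        (contMDiff_fst).mul contMDiff_snd
      exact this.contMDiffAt) contMDiffAt_const (by simp)
  refine h.congr_of_eventuallyEq (Filter.Eventually.of_forall fun x => ?_)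
  change _ = (trivAt E (x₀ * 1) (x * 1)).comp ((leftTr E x).comp (trivSymmAt E 1 (1 : D)))
  rw [mul_one, mul_one, trivSymmAt_self]; rfl

/-- A vector field in the left trivialization of the tangent bundle. -/
def leftTriv (X : D → E) (x : D) : E := mcForm E x (X x)

/-- The fibre coordinate of the bundle trivialization, as the continuous linear map `trivAt`. -/
theorem trivializationAt_snd {x₀ x : D} (hx : x ∈ (chartAt E x₀).source)
    (u : E) :
    (trivializationAt E (TangentSpace 𝓘(ℝ, E)) x₀ ⟨x, u⟩).2 = trivAt E x₀ x u := by
  exact (congrFun ((trivializationAt E (TangentSpace 𝓘(ℝ, E)) x₀).coe_linearMapAt_of_mem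
    (R := ℝ) hx) u).symm

theorem chartAt_source_mem_nhds (x₀ : D) : (chartAt E x₀).source ∈ nhds x₀ :=
  (chartAt E x₀).open_source.mem_nhds (mem_chart_source E x₀)

theorem leftTriv_eventuallyEq (X : D → E) (x₀ : D) :
    leftTriv X =ᶠ[nhds x₀] fun x => (mcForm E x).comp (trivSymmAt E x₀ x)
      (trivializationAt E (TangentSpace 𝓘(ℝ, E)) x₀ ⟨x, X x⟩).2 := by
  filter_upwards [chartAt_source_mem_nhds (E := E) x₀] with x hx
  change mcForm E x (X x) = mcForm E x (trivSymmAt E x₀ x _)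
  rw [trivializationAt_snd (E := E) hx, trivSymmAt_trivAt hx]

theorem trivializationAt_eventuallyEq (X : D → E) (x₀ : D) :
    (fun x => (trivializationAt E (TangentSpace 𝓘(ℝ, E)) x₀ ⟨x, X x⟩).2) =ᶠ[nhds x₀] fun x =>
      (trivAt E x₀ x).comp (leftTr E x) (leftTriv X x) := by
  filter_upwards [chartAt_source_mem_nhds (E := E) x₀] with x hx
  rw [trivializationAt_snd (E := E) hx]
  change _ = trivAt E x₀ x (leftTr E x (mcForm E x (X x)))
  rw [leftTr_mcForm]

/-- Smoothness of a vector field on a Lie group can be read off from its left trivialization. -/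
theorem isSmoothVF_iff (X : VField E D) :
    IsSmoothVF X ↔ ContMDiff 𝓘(ℝ, E) 𝓘(ℝ, E) ∞ (leftTriv X) := by
  refine forall_congr' fun x₀ => ?_
  rw [contMDiffAt_section]
  constructor
  · intro h
    exact ((contMDiffAt_mcForm_trivSymmAt x₀).clm_apply h).congr_of_eventuallyEq
      (leftTriv_eventuallyEq X x₀)
  · intro h
    exact ((contMDiffAt_trivAt_leftTr x₀).clm_apply h).congr_of_eventuallyEq
      (trivializationAt_eventuallyEq X x₀)

theorem mdifferentiableAt_leftTriv {X : VField E D} {x₀ : D}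
    (h : MDifferentiableAt 𝓘(ℝ, E) 𝓘(ℝ, E).tangent
      (fun x => (⟨x, X x⟩ : TangentBundle 𝓘(ℝ, E) D)) x₀) :
    MDifferentiableAt 𝓘(ℝ, E) 𝓘(ℝ, E) (leftTriv X) x₀ := by
  rw [mdifferentiableAt_section] at h
  exact (((contMDiffAt_mcForm_trivSymmAt x₀).mdifferentiableAt (by simp)).clm_apply
    h).congr_of_eventuallyEq (leftTriv_eventuallyEq X x₀)

/-- The field of endomorphisms that is `A` in the left trivialization. -/
def leftEnd (A : E →L[ℝ] E) : EndField E D := fun x => (leftTr E x).comp (A.comp (mcForm E x))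

/-- The field of bilinear forms that is `B` in the left trivialization. -/
def leftBilin (B : E →L[ℝ] E →L[ℝ] ℝ) : BilinField E D :=
  fun x => (((ContinuousLinearMap.compL ℝ E E ℝ).flip (mcForm E x)).comp
    (B.comp (mcForm E x)) : E →L[ℝ] E →L[ℝ] ℝ)

theorem leftBilin_apply (B : E →L[ℝ] E →L[ℝ] ℝ) (x : D) (u v : E) :
    leftBilin B x u v = B (mcForm E x u) (mcForm E x v) := rfl

theorem leftEnd_apply (A : E →L[ℝ] E) (x : D) (u : E) :
    leftEnd A x u = leftTr E x (A (mcForm E x u)) := rfl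

theorem isSmoothEnd_leftEnd (A : E →L[ℝ] E) :
    IsSmoothEnd (leftEnd (D := D) A) := by
  intro x₀
  rw [contMDiffAt_hom_bundle]
  refine ⟨contMDiffAt_id, ?_⟩
  have h := (contMDiffAt_trivAt_leftTr (E := E) x₀).clm_comp
    ((contMDiffAt_const (c := A)).clm_comp (contMDiffAt_mcForm_trivSymmAt x₀))
  exact h

theorem isSmoothBilin_leftBilin (B : E →L[ℝ] E →L[ℝ] ℝ) :
    IsSmoothBilin (leftBilin (D := D) B) := by
  intro x₀
  rw [contMDiffAt_hom_bundle]
  refine ⟨contMDiffAt_id, ?_⟩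
  have h := contMDiffAt_mcForm_trivSymmAt (E := E) x₀
  have h2 : ContMDiffAt 𝓘(ℝ, E) 𝓘(ℝ, E →L[ℝ] E →L[ℝ] ℝ) ∞
      (fun x : D => ((ContinuousLinearMap.compL ℝ E E ℝ).flip
        ((mcForm E x).comp (trivSymmAt E x₀ x))).comp
          (B.comp ((mcForm E x).comp (trivSymmAt E x₀ x)))) x₀ :=
    ((((ContinuousLinearMap.compL ℝ E E ℝ).flip.contMDiff.contMDiffAt).comp x₀ h)).clm_comp
      (contMDiffAt_const.clm_comp h)
  refine h2.congr_of_eventuallyEq ?_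
  filter_upwards [chartAt_source_mem_nhds (E := E) x₀] with x hx
  ext v w
  refine (inCoordinates_apply_eq₂ (𝕜 := ℝ) (F₁ := E) (F₂ := E) (F₃ := ℝ)
    (E₁ := (TangentSpace 𝓘(ℝ, E) : D → Type _)) (E₂ := (TangentSpace 𝓘(ℝ, E) : D → Type _))
    (E₃ := fun _ : D => ℝ) hx hx (Set.mem_univ _)).trans ?_
  refine (LinearMap.congr_fun (Trivial.linearMapAt_trivialization ℝ D ℝ x) _).trans ?_
  have h3 (z : E) : (trivializationAt E (TangentSpace 𝓘(ℝ, E)) x₀).symm x z = trivSymmAt E x₀ x z :=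
    ((trivializationAt E (TangentSpace 𝓘(ℝ, E)) x₀).symmL_apply hx z).symm
  rw [h3, h3]
  rfl

end LeftTrivialization

/-! ### The Lie bracket of vector fields in the left trivialization -/

section LeftBracket

variable {E : Type*} [NormedAddCommGroup E] [NormedSpace ℝ E]
  {D : Type*} [TopologicalSpace D] [ChartedSpace E D] [Group D] [LieGroup 𝓘(ℝ, E) ∞ D]

/-- The left-invariant vector field with value `v` at the identity. -/
def leftVF (v : E) : VField E D := fun x => leftTr E x v

theorem leftTriv_leftVF (v : E) : leftTriv (leftVF v : D → E) = fun _ => v := by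
  ext x
  exact mcForm_leftTr x v

theorem isSmoothVF_leftVF (v : E) : IsSmoothVF (leftVF v : VField E D) := by
  rw [isSmoothVF_iff, leftTriv_leftVF]
  exact contMDiff_const

theorem IsSmoothVF.mdifferentiableAt {X : VField E D} (h : IsSmoothVF X) (x : D) :
    MDifferentiableAt 𝓘(ℝ, E) 𝓘(ℝ, E).tangent
      (fun x => (⟨x, X x⟩ : TangentBundle 𝓘(ℝ, E) D)) x :=
  ContMDiff.mdifferentiableAt h (by simp)

theorem IsSmoothVF.mdifferentiableAt_leftTriv {X : VField E D} (h : IsSmoothVF X) (x : D) :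
    MDifferentiableAt 𝓘(ℝ, E) 𝓘(ℝ, E) (leftTriv X) x :=
  ((isSmoothVF_iff X).1 h).mdifferentiableAt (by simp)

theorem leftTriv_add (X Y : VField E D) :
    leftTriv (X + Y : VField E D) = fun x => leftTriv X x + leftTriv Y x := by
  ext x; exact map_add (mcForm E x) (X x : E) (Y x)

theorem leftTriv_smul (a : D → ℝ) (X : VField E D) :
    leftTriv (a • X : VField E D) = fun x => a x • leftTriv X x := by
  ext x; exact map_smul (mcForm E x) (a x) (X x : E)

variable [FiniteDimensional ℝ E]

/-- The smoothness class that Mathlib asks for in the Lie algebra structure of a Lie group. -/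
instance instLieGroupThree : LieGroup 𝓘(ℝ, E) (minSmoothness ℝ 3) D := by
  rw [minSmoothness_of_isRCLikeNormedField]
  exact LieGroup.of_le (n := ∞) (WithTop.coe_le_coe.2 le_top)

variable (E) (D) in
/-- The Lie bracket of the Lie algebra of `D`, as a bounded bilinear map on the model space. -/
def lieB : E →L[ℝ] E →L[ℝ] E :=
  haveI : CompleteSpace E := FiniteDimensional.complete ℝ E
  LinearMap.toContinuousLinearMap
    ((LinearMap.toContinuousLinearMap (𝕜 := ℝ) (E := E) (F' := E)).toLinearMap.comp
      (LinearMap.mk₂ ℝ (fun u v : E => Bracket.bracket (L := GroupLieAlgebra 𝓘(ℝ, E) D)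
        (M := GroupLieAlgebra 𝓘(ℝ, E) D) u v)
        (fun (a b c : GroupLieAlgebra 𝓘(ℝ, E) D) => add_lie a b c)
        (fun (a : ℝ) (b c : GroupLieAlgebra 𝓘(ℝ, E) D) => smul_lie a b c)
        (fun (a b c : GroupLieAlgebra 𝓘(ℝ, E) D) => lie_add a b c)
        (fun (a : ℝ) (b c : GroupLieAlgebra 𝓘(ℝ, E) D) => lie_smul a b c)))

variable (D) in
theorem lieB_swap (u v : E) : lieB E D u v = - lieB E D v u := by
  have : CompleteSpace E := FiniteDimensional.complete ℝ E
  exact (lie_skew (L := GroupLieAlgebra 𝓘(ℝ, E) D) u v).symm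

theorem leftTriv_mlieBracket_leftVF (u v : E) (x : D) :
    leftTriv (mlieBracket 𝓘(ℝ, E) (leftVF u : VField E D) (leftVF v)) x = lieB E D u v := by
  have : CompleteSpace E := FiniteDimensional.complete ℝ E
  have h := congrFun (mulInvariantVector_mlieBracket (I := 𝓘(ℝ, E)) (G := D) u v) x
  have h2 : mlieBracket 𝓘(ℝ, E) (leftVF u : VField E D) (leftVF v) x = leftTr E x (lieB E D u v) :=
    h.symm
  refine (congrArg (mcForm E x) h2).trans (mcForm_leftTr x _)

/-- In the left trivialization the Lie bracket minus its derivative terms is linear over functions,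
so that it depends only on the values of the fields at the point. -/
theorem tensorialAt_mlieBracket_right (X : VField E D) (x : D) :
    TensorialAt 𝓘(ℝ, E) E (fun Y : VField E D => leftTriv (mlieBracket 𝓘(ℝ, E) X Y) x
      - mder E E (leftTriv Y) x (X x) + mder E E (leftTriv X) x (Y x)) x := by
  have : CompleteSpace E := FiniteDimensional.complete ℝ E
  constructor
  · intro f Y hf hY
    have h1 : leftTriv (mlieBracket 𝓘(ℝ, E) X (f • Y)) x =
        mder E ℝ f x (X x) • leftTriv Y x + f x • leftTriv (mlieBracket 𝓘(ℝ, E) X Y) x := by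
      refine (congrArg (mcForm E x) (mlieBracket_smul_right (V := X) hf hY)).trans ?_
      exact (map_add (mcForm E x) _ _).trans
        (congrArg₂ (· + ·) (map_smul (mcForm E x) _ _) (map_smul (mcForm E x) _ _))
    have h2 := mder_smul (E := E) (F := E) hf (mdifferentiableAt_leftTriv hY) (X x)
    have h3 : mder E E (leftTriv X) x ((f • Y : VField E D) x) =
      f x • mder E E (leftTriv X) x (Y x) := map_smul (mder E E (leftTriv X) x) (f x) (Y x)
    rw [h1, h3, leftTriv_smul, h2]
    module
  · intro Y Z hY hZ
    have h1 : leftTriv (mlieBracket 𝓘(ℝ, E) X (Y + Z)) x = leftTriv (mlieBracket 𝓘(ℝ, E) X Y) x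
        + leftTriv (mlieBracket 𝓘(ℝ, E) X Z) x := by
      refine (congrArg (mcForm E x) (mlieBracket_add_right (V := X) hY hZ)).trans ?_
      exact map_add (mcForm E x) _ _
    have h2 := congrArg (fun φ : E →L[ℝ] E => φ (X x)) (mder_add (E := E) (F := E)
      (mdifferentiableAt_leftTriv hY) (mdifferentiableAt_leftTriv hZ))
    have h4 : (mder E E (leftTriv Y) x + mder E E (leftTriv Z) x) (X x) =
      mder E E (leftTriv Y) x (X x) + mder E E (leftTriv Z) x (X x) := rfl
    have h3 : mder E E (leftTriv X) x ((Y + Z : VField E D) x) =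
      mder E E (leftTriv X) x (Y x) + mder E E (leftTriv X) x (Z x) :=
        map_add (mder E E (leftTriv X) x) (Y x : E) (Z x)
    beta_reduce at h2 ⊢
    rw [h1, h3, leftTriv_add, h2, h4]
    abel

theorem tensorialAt_mlieBracket_left (Y : VField E D) (x : D) :
    TensorialAt 𝓘(ℝ, E) E (fun X : VField E D => leftTriv (mlieBracket 𝓘(ℝ, E) X Y) x
      - mder E E (leftTriv Y) x (X x) + mder E E (leftTriv X) x (Y x)) x := by
  have h (X : VField E D) : leftTriv (mlieBracket 𝓘(ℝ, E) X Y) x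
      - mder E E (leftTriv Y) x (X x) + mder E E (leftTriv X) x (Y x) =
      - (leftTriv (mlieBracket 𝓘(ℝ, E) Y X) x
      - mder E E (leftTriv X) x (Y x) + mder E E (leftTriv Y) x (X x)) := by
    have : leftTriv (mlieBracket 𝓘(ℝ, E) X Y) x = - leftTriv (mlieBracket 𝓘(ℝ, E) Y X) x :=
      (congrArg (mcForm E x) mlieBracket_swap_apply).trans (map_neg (mcForm E x) _)
    rw [this]
    abel
  have h' := tensorialAt_mlieBracket_right Y x
  constructor
  · intro f X hf hX
    rw [h, h, smul_neg, ← h'.smul hf hX]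
  · intro X Z hX hZ
    rw [h, h, h, ← neg_add, ← h'.add hX hZ]

/-- The Lie bracket of vector fields in the left trivialization. The difference of the bracket and
the derivative terms is tensorial in both fields, which may hence be replaced by left-invariant
ones. -/
theorem leftTriv_mlieBracket {X Y : VField E D} (hX : IsSmoothVF X) (hY : IsSmoothVF Y) (x : D) :
    leftTriv (mlieBracket 𝓘(ℝ, E) X Y) x = mder E E (leftTriv Y) x (X x)
      - mder E E (leftTriv X) x (Y x) + lieB E D (leftTriv X x) (leftTriv Y x) := by
  have key := TensorialAt.pointwise₂ (I := 𝓘(ℝ, E)) (F := E) (F' := E)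
    (Φ := fun X Y : VField E D => leftTriv (mlieBracket 𝓘(ℝ, E) X Y) x
      - mder E E (leftTriv Y) x (X x) + mder E E (leftTriv X) x (Y x)) (x := x)
    (σ := X) (σ' := leftVF (leftTriv X x)) (τ := Y) (τ' := leftVF (leftTriv Y x))
    (fun Y _ => tensorialAt_mlieBracket_left Y x) (fun X _ => tensorialAt_mlieBracket_right X x)
    (hX.mdifferentiableAt x) ((isSmoothVF_leftVF _).mdifferentiableAt x)
    (hY.mdifferentiableAt x) ((isSmoothVF_leftVF _).mdifferentiableAt x)
    (leftTr_mcForm (E := E) x _).symm (leftTr_mcForm (E := E) x _).symm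
  beta_reduce at key
  rw [leftTriv_mlieBracket_leftVF, leftTriv_leftVF, leftTriv_leftVF, mder_const, mder_const] at key
  change _ = lieB E D _ _ - (0 : E) + (0 : E) at key
  rw [sub_zero, add_zero] at key
  rw [← key]
  abel

end LeftBracket

/-! ### Linear algebra of a polarization -/

section Eigenbundles

variable {E : Type*} [NormedAddCommGroup E] [NormedSpace ℝ E]
  {M : Type*} [TopologicalSpace M] [ChartedSpace E M]

theorem mem_Lplus_iff (K : EndField E M) (x : M) (u : TangentSpace 𝓘(ℝ, E) x) :
    u ∈ Lplus K x ↔ K x u = u := by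
  rw [Lplus, Module.End.mem_eigenspace_iff, one_smul]; rfl

theorem mem_Lminus_iff (K : EndField E M) (x : M) (u : TangentSpace 𝓘(ℝ, E) x) :
    u ∈ Lminus K x ↔ K x u = -u := by
  rw [Lminus, Module.End.mem_eigenspace_iff, neg_one_smul]; rfl

end Eigenbundles

namespace Polarization

variable {E : Type*} [NormedAddCommGroup E] [NormedSpace ℝ E]
  {D : Type*} [TopologicalSpace D] [ChartedSpace E D] [Group D]
  {d : ℕ} (P : Polarization E D d)

/-- The basis of the polarization as a basis of the model space. -/
def b : Module.Basis (Fin d ⊕ Fin d) ℝ E := P.basis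

/-- The polarization with the roles of the two halves exchanged. It has the same pairing and the
opposite `K`, so that every statement about `L₋` is the statement about `L₊` for `P.swap`. -/
def swap : Polarization E D d where
  basis := P.basis.reindex (Equiv.sumComm _ _)
  f := P.Q
  Q := P.f
  H := P.R
  R := P.H
  lie_left m n := by simpa using P.lie_right m n
  lie_right m n := by simpa using P.lie_left m n
  lie_mixed m n := by
    have h := P.lie_mixed n m
    have h2 : ⁅P.basis (Sum.inr m), P.basis (Sum.inl n)⁆ =
        -⁅P.basis (Sum.inl n), P.basis (Sum.inr m)⁆ :=
      mlieBracket_swap_apply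
    simp [h2, h]

theorem b_swap (A : Fin d ⊕ Fin d) : P.swap.b A = P.b A.swap := by
  have : P.swap.b = P.b.reindex (Equiv.sumComm _ _) := rfl
  rw [this, Module.Basis.reindex_apply]; rfl

theorem b_swap_repr (v : E) (A : Fin d ⊕ Fin d) : P.swap.b.repr v A = P.b.repr v A.swap := by
  have : P.swap.b = P.b.reindex (Equiv.sumComm _ _) := rfl
  rw [this, Module.Basis.repr_reindex_apply]; rfl

theorem finiteDimensional (P : Polarization E D d) : FiniteDimensional ℝ E :=
  P.b.finiteDimensional_of_finite

variable [FiniteDimensional ℝ E]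

/-- The dual basis. -/
def co (A : Fin d ⊕ Fin d) : E →L[ℝ] ℝ := LinearMap.toContinuousLinearMap (P.b.coord A)

theorem co_apply (A : Fin d ⊕ Fin d) (v : E) : P.co A v = P.b.repr v A := rfl

theorem co_b (A B : Fin d ⊕ Fin d) : P.co A (P.b B) = if B = A then 1 else 0 := by
  rw [co_apply, P.b.repr_self, Finsupp.single_apply]

/-- The endomorphism of the Lie algebra with eigenspaces the two halves. -/
def K₀ : E →L[ℝ] E :=
  ∑ m, ((P.co (Sum.inl m)).smulRight (P.b (Sum.inl m))
    - (P.co (Sum.inr m)).smulRight (P.b (Sum.inr m)))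

/-- The duality pairing on the Lie algebra. -/
def η₀ : E →L[ℝ] E →L[ℝ] ℝ :=
  ∑ m, ((P.co (Sum.inl m)).smulRight (P.co (Sum.inr m))
    + (P.co (Sum.inr m)).smulRight (P.co (Sum.inl m)))

theorem K₀_apply (v : E) : P.K₀ v = ∑ m, (P.co (Sum.inl m) v • P.b (Sum.inl m)
    - P.co (Sum.inr m) v • P.b (Sum.inr m)) := by
  simp [K₀, sum_apply]

theorem η₀_apply (u v : E) : P.η₀ u v = ∑ m, (P.co (Sum.inl m) u * P.co (Sum.inr m) v
    + P.co (Sum.inr m) u * P.co (Sum.inl m) v) := by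
  simp [η₀, sum_apply]

theorem η₀_symm (u v : E) : P.η₀ u v = P.η₀ v u := by
  simp only [η₀_apply]
  exact Finset.sum_congr rfl fun m _ => by ring

@[simp] theorem K₀_inl (m : Fin d) : P.K₀ (P.b (Sum.inl m)) = P.b (Sum.inl m) := by
  simp [K₀_apply, co_b]

@[simp] theorem K₀_inr (m : Fin d) : P.K₀ (P.b (Sum.inr m)) = - P.b (Sum.inr m) := by
  simp [K₀_apply, co_b]

@[simp] theorem η₀_inl_left (m : Fin d) (v : E) :
    P.η₀ (P.b (Sum.inl m)) v = P.co (Sum.inr m) v := by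
  simp [η₀_apply, co_b]

@[simp] theorem η₀_inr_left (m : Fin d) (v : E) :
    P.η₀ (P.b (Sum.inr m)) v = P.co (Sum.inl m) v := by
  simp [η₀_apply, co_b]

@[simp] theorem η₀_inl_right (m : Fin d) (v : E) :
    P.η₀ v (P.b (Sum.inl m)) = P.co (Sum.inr m) v := by
  rw [η₀_symm, η₀_inl_left]

@[simp] theorem η₀_inr_right (m : Fin d) (v : E) :
    P.η₀ v (P.b (Sum.inr m)) = P.co (Sum.inl m) v := by
  rw [η₀_symm, η₀_inr_left]

theorem co_inl_K₀ (m : Fin d) (v : E) : P.co (Sum.inl m) (P.K₀ v) = P.co (Sum.inl m) v := by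
  simp [K₀_apply, co_b]

theorem co_inr_K₀ (m : Fin d) (v : E) : P.co (Sum.inr m) (P.K₀ v) = - P.co (Sum.inr m) v := by
  simp [K₀_apply, co_b]

theorem ext_co {u v : E} (h : ∀ A, P.co A u = P.co A v) : u = v :=
  P.b.ext_elem h

theorem K₀_K₀ (v : E) : P.K₀ (P.K₀ v) = v := by
  refine P.ext_co fun A => ?_
  cases A <;> simp [co_inl_K₀, co_inr_K₀]

theorem η₀_K₀ (u v : E) : P.η₀ (P.K₀ u) (P.K₀ v) = - P.η₀ u v := by
  simp only [η₀_apply, co_inl_K₀, co_inr_K₀, ← Finset.sum_neg_distrib]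
  exact Finset.sum_congr rfl fun m _ => by ring

theorem η₀_nondeg {u : E} (h : ∀ A, P.η₀ u (P.b A) = 0) : u = 0 := by
  refine P.ext_co fun A => ?_
  cases A with
  | inl m => simpa using h (Sum.inr m)
  | inr m => simpa using h (Sum.inl m)

theorem mem_span_inl_iff (u : E) :
    u ∈ Submodule.span ℝ (Set.range fun m => P.b (Sum.inl m)) ↔ ∀ m, P.co (Sum.inr m) u = 0 := by
  constructor
  · intro h m
    induction h using Submodule.span_induction with
    | mem x hx => obtain ⟨n, rfl⟩ := hx; simp [co_b]
    | zero => simp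
    | add x y _ _ hx hy => simp [hx, hy]
    | smul a x _ hx => simp [hx]
  · intro h
    have h2 := P.b.sum_repr u
    rw [Fintype.sum_sum_type] at h2
    simp only [← co_apply, h, zero_smul, Finset.sum_const_zero, add_zero] at h2
    rw [← h2]
    exact Submodule.sum_mem _ fun m _ => Submodule.smul_mem _ _ (Submodule.subset_span ⟨m, rfl⟩)

theorem K₀_eq_iff (u : E) : P.K₀ u = u ↔ ∀ m, P.co (Sum.inr m) u = 0 := by
  constructor
  · intro h m
    have h2 := P.co_inr_K₀ m u
    rw [h] at h2
    linarith
  · intro h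
    refine P.ext_co fun A => ?_
    cases A with
    | inl m => exact P.co_inl_K₀ m u
    | inr m => rw [co_inr_K₀, h, neg_zero]

theorem co_swap (A : Fin d ⊕ Fin d) : P.swap.co A = P.co A.swap := by
  ext v; exact P.b_swap_repr v A

theorem K₀_swap : P.swap.K₀ = - P.K₀ := by
  ext v
  rw [K₀_apply, neg_apply, K₀_apply, ← Finset.sum_neg_distrib]
  refine Finset.sum_congr rfl fun m _ => ?_
  rw [co_swap, co_swap, b_swap, b_swap, neg_sub]
  rfl

theorem η₀_swap : P.swap.η₀ = P.η₀ := by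
  ext u v
  rw [η₀_apply, η₀_apply]
  refine Finset.sum_congr rfl fun m _ => ?_
  rw [co_swap, co_swap, add_comm]
  rfl

variable [LieGroup 𝓘(ℝ, E) ∞ D]

theorem K_eq : P.K = leftEnd P.K₀ := by
  funext x
  have h (u : E) : (P.K x : E →L[ℝ] E) u = leftEnd P.K₀ x u := by
    rw [leftEnd_apply, K₀_apply, map_sum]
    have : (P.K x : E →L[ℝ] E) u = ∑ m, (P.Θ m x u • (P.Z m x : E) - P.Θ' m x u • (P.Z' m x : E)) :=
      sum_apply _ _ _
    rw [this]
    refine Finset.sum_congr rfl fun m _ => ?_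
    rw [map_sub, map_smul, map_smul]
    rfl
  exact ContinuousLinearMap.ext h

theorem η_eq : P.η = leftBilin P.η₀ := by
  funext x
  have h (u v : E) : (P.η x : E →L[ℝ] E →L[ℝ] ℝ) u v = leftBilin P.η₀ x u v := by
    rw [leftBilin_apply, η₀_apply]
    have : (P.η x : E →L[ℝ] E →L[ℝ] ℝ) u = ∑ m, (P.Θ m x u • (P.Θ' m x : E →L[ℝ] ℝ)
      + P.Θ' m x u • (P.Θ m x : E →L[ℝ] ℝ)) := sum_apply _ _ _
    have h3 (s : Fin d → E →L[ℝ] ℝ) : (∑ m, s m) v = ∑ m, s m v := by simp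
    exact (congrArg (fun φ : E →L[ℝ] ℝ => φ v) this).trans (h3 _)
  exact ContinuousLinearMap.ext fun u => ContinuousLinearMap.ext fun v => h u v

theorem η_apply (x : D) (u v : E) : P.η x u v = P.η₀ (mcForm E x u) (mcForm E x v) := by
  rw [η_eq]; rfl

theorem K_apply (x : D) (u : E) : P.K x u = leftTr E x (P.K₀ (mcForm E x u)) := by
  rw [K_eq]; rfl

theorem η_swap : P.swap.η = P.η := by rw [η_eq, η_eq, η₀_swap]

theorem K_swap (x : D) (u : E) : P.swap.K x u = - P.K x u := by
  rw [K_apply, K_apply, K₀_swap]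
  exact map_neg (leftTr E x) (P.K₀ (mcForm E x u))

theorem mem_Lplus (x : D) (u : E) : u ∈ Lplus P.K x ↔ ∀ m, P.co (Sum.inr m) (mcForm E x u) = 0 := by
  rw [← K₀_eq_iff]
  refine (mem_Lplus_iff P.K x u).trans ?_
  rw [K_apply]
  exact leftTr_eq_iff (E := E) x _ _

theorem Lminus_eq : Lminus P.K = Lplus P.swap.K := by
  funext x
  refine Submodule.ext fun u => ?_
  refine (mem_Lminus_iff P.K x u).trans (Iff.trans ?_ (mem_Lplus_iff P.swap.K x u).symm)
  have h : P.swap.K x u = - P.K x u := P.K_swap x u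
  rw [h]
  exact neg_eq_iff_eq_neg.symm

end Polarization

/-! ### The left-invariant almost para-Hermitian structure -/

section LinearAlgebra

variable {V : Type*} [AddCommGroup V] [Module ℝ V]

/-- An involution that anticommutes with `A` exchanges the eigenspaces of `A` for `1` and `-1`. -/
theorem finrank_eigenspace_one_eq_neg_one (A J : V →ₗ[ℝ] V) (hJ : ∀ u, J (J u) = u)
    (hAJ : ∀ u, A (J u) = - J (A u)) :
    Module.finrank ℝ (Module.End.eigenspace A (1 : ℝ)) =
      Module.finrank ℝ (Module.End.eigenspace A (-1 : ℝ)) := by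
  let e : V ≃ₗ[ℝ] V := LinearEquiv.ofInvolutive J hJ
  have he : (Module.End.eigenspace A (1 : ℝ)).map (e : V →ₗ[ℝ] V) =
      Module.End.eigenspace A (-1 : ℝ) := by
    ext u
    simp only [Submodule.mem_map, Module.End.mem_eigenspace_iff, one_smul, neg_one_smul]
    constructor
    · rintro ⟨v, hv, rfl⟩
      change A (J v) = - J v
      rw [hAJ, hv]
    · intro hu
      refine ⟨J u, ?_, hJ u⟩
      rw [hAJ, hu, map_neg, neg_neg]
  rw [← he]
  exact (LinearEquiv.finrank_map_eq e _).symm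

theorem isCompl_eigenspace_of_involutive (J : V →ₗ[ℝ] V) (hJ : ∀ u, J (J u) = u) :
    IsCompl (Module.End.eigenspace J (1 : ℝ)) (Module.End.eigenspace J (-1 : ℝ)) := by
  constructor
  · rw [Submodule.disjoint_def]
    intro u h1 h2
    rw [Module.End.mem_eigenspace_iff] at h1 h2
    rw [h1, one_smul, neg_one_smul] at h2
    have h3 : (2 : ℝ) • u = 0 := by rw [two_smul]; exact (eq_neg_iff_add_eq_zero.1 h2)
    exact (smul_eq_zero.1 h3).resolve_left two_ne_zero
  · rw [codisjoint_iff, Submodule.eq_top_iff']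
    intro u
    refine Submodule.mem_sup.2 ⟨(1 / 2 : ℝ) • (u + J u), ?_, (1 / 2 : ℝ) • (u - J u), ?_, ?_⟩
    · rw [Module.End.mem_eigenspace_iff, map_smul, map_add, hJ, one_smul, add_comm]
    · rw [Module.End.mem_eigenspace_iff, map_smul, map_sub, hJ, neg_one_smul, ← smul_neg, neg_sub]
    · module

/-- Trilinear forms, without bundling. -/
structure IsTrilinear (t : V → V → V → ℝ) : Prop where
  add₁ : ∀ u u' v w, t (u + u') v w = t u v w + t u' v w
  smul₁ : ∀ (a : ℝ) u v w, t (a • u) v w = a * t u v w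
  add₂ : ∀ u v v' w, t u (v + v') w = t u v w + t u v' w
  smul₂ : ∀ (a : ℝ) u v w, t u (a • v) w = a * t u v w
  add₃ : ∀ u v w w', t u v (w + w') = t u v w + t u v w'
  smul₃ : ∀ (a : ℝ) u v w, t u v (a • w) = a * t u v w

theorem IsTrilinear.eq_on_span {t s : V → V → V → ℝ} (ht : IsTrilinear t) (hs : IsTrilinear s)
    {S : Set V} (h : ∀ u ∈ S, ∀ v ∈ S, ∀ w ∈ S, t u v w = s u v w) {u v w : V}
    (hu : u ∈ Submodule.span ℝ S) (hv : v ∈ Submodule.span ℝ S) (hw : w ∈ Submodule.span ℝ S) :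
    t u v w = s u v w := by
  have z₁ {t : V → V → V → ℝ} (ht : IsTrilinear t) (v w : V) : t 0 v w = 0 := by
    simpa using ht.smul₁ 0 0 v w
  have z₂ {t : V → V → V → ℝ} (ht : IsTrilinear t) (u w : V) : t u 0 w = 0 := by
    simpa using ht.smul₂ 0 u 0 w
  have z₃ {t : V → V → V → ℝ} (ht : IsTrilinear t) (u v : V) : t u v 0 = 0 := by
    simpa using ht.smul₃ 0 u v 0
  induction hu using Submodule.span_induction with
  | zero => rw [z₁ ht, z₁ hs]
  | add x y _ _ hx hy => rw [ht.add₁, hs.add₁, hx, hy]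
  | smul a x _ hx => rw [ht.smul₁, hs.smul₁, hx]
  | mem u hu =>
    induction hv using Submodule.span_induction with
    | zero => rw [z₂ ht, z₂ hs]
    | add x y _ _ hx hy => rw [ht.add₂, hs.add₂, hx, hy]
    | smul a x _ hx => rw [ht.smul₂, hs.smul₂, hx]
    | mem v hv =>
      induction hw using Submodule.span_induction with
      | zero => rw [z₃ ht, z₃ hs]
      | add x y _ _ hx hy => rw [ht.add₃, hs.add₃, hx, hy]
      | smul a x _ hx => rw [ht.smul₃, hs.smul₃, hx]
      | mem w hw => exact h u hu v hv w hw

theorem IsTrilinear.add {t s : V → V → V → ℝ} (ht : IsTrilinear t) (hs : IsTrilinear s) :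
    IsTrilinear fun u v w => t u v w + s u v w := by
  constructor <;> intros <;>
    simp only [ht.add₁, hs.add₁, ht.add₂, hs.add₂, ht.add₃, hs.add₃, ht.smul₁, hs.smul₁, ht.smul₂,
      hs.smul₂, ht.smul₃, hs.smul₃] <;> ring

theorem IsTrilinear.const_mul {t : V → V → V → ℝ} (ht : IsTrilinear t) (c : ℝ) :
    IsTrilinear fun u v w => c * t u v w := by
  constructor <;> intros <;>
    simp only [ht.add₁, ht.add₂, ht.add₃, ht.smul₁, ht.smul₂, ht.smul₃] <;> ring

theorem IsTrilinear.sub {t s : V → V → V → ℝ} (ht : IsTrilinear t) (hs : IsTrilinear s) :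
    IsTrilinear fun u v w => t u v w - s u v w := by
  simpa only [sub_eq_add_neg, neg_one_mul] using ht.add (hs.const_mul (-1))

theorem IsTrilinear.zero : IsTrilinear fun _ _ _ : V => (0 : ℝ) := by
  constructor <;> intros <;> simp

theorem IsTrilinear.sum {ι : Type*} {s : Finset ι} {t : ι → V → V → V → ℝ}
    (ht : ∀ i, IsTrilinear (t i)) : IsTrilinear fun u v w => ∑ i ∈ s, t i u v w := by
  classical
  induction s using Finset.induction_on with
  | empty => simpa using IsTrilinear.zero
  | insert i s hi h => simpa only [Finset.sum_insert hi] using (ht i).add h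

/-- Transposition of the last two arguments. -/
theorem IsTrilinear.swap₂₃ {t : V → V → V → ℝ} (ht : IsTrilinear t) :
    IsTrilinear fun u v w => t u w v :=
  ⟨fun u u' v w => ht.add₁ u u' w v, fun a u v w => ht.smul₁ a u w v,
    fun u v v' w => ht.add₃ u w v v', fun a u v w => ht.smul₃ a u w v,
    fun u v w w' => ht.add₂ u w w' v, fun a u v w => ht.smul₂ a u w v⟩

/-- Cyclic permutation of the arguments. -/
theorem IsTrilinear.rotate {t : V → V → V → ℝ} (ht : IsTrilinear t) :
    IsTrilinear fun u v w => t v w u :=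
  ⟨fun u u' v w => ht.add₃ v w u u', fun a u v w => ht.smul₃ a v w u,
    fun u v v' w => ht.add₁ v v' w u, fun a u v w => ht.smul₁ a v w u,
    fun u v w w' => ht.add₂ v w w' u, fun a u v w => ht.smul₂ a v w u⟩

end LinearAlgebra

section NormedLinearAlgebra

variable {E : Type*} [NormedAddCommGroup E] [NormedSpace ℝ E]

theorem isTrilinear_bilin_comp (B : E →L[ℝ] E →L[ℝ] ℝ) (A : E →L[ℝ] E →L[ℝ] E) :
    IsTrilinear fun u v w => B (A u v) w := by
  constructor <;> intros <;> simp

theorem isTrilinear_wedge₃ (α β γ : E →L[ℝ] ℝ) : IsTrilinear (wedge₃ α β γ) := by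
  constructor <;> intros <;> simp [wedge₃, Matrix.det_fin_three] <;> ring

end NormedLinearAlgebra

namespace Polarization

variable {E : Type*} [NormedAddCommGroup E] [NormedSpace ℝ E] [FiniteDimensional ℝ E]
  {D : Type*} [TopologicalSpace D] [ChartedSpace E D] [Group D] [LieGroup 𝓘(ℝ, E) ∞ D]
  {d : ℕ} (P : Polarization E D d)

/-- The defining relations of the polarization, for the bracket `lieB` on the model space. -/
theorem lieB_inl_inl (m n : Fin d) : lieB E D (P.b (Sum.inl m)) (P.b (Sum.inl n)) =
    ∑ k, P.f m n k • P.b (Sum.inl k) + ∑ k, P.H m n k • P.b (Sum.inr k) :=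
  P.lie_left m n

theorem lieB_inl_inr (m n : Fin d) : lieB E D (P.b (Sum.inl m)) (P.b (Sum.inr n)) =
    ∑ k, P.f k m n • P.b (Sum.inr k) - ∑ k, P.Q k n m • P.b (Sum.inl k) :=
  P.lie_mixed m n

theorem lieB_inr_inr (m n : Fin d) : lieB E D (P.b (Sum.inr m)) (P.b (Sum.inr n)) =
    ∑ k, P.Q m n k • P.b (Sum.inr k) + ∑ k, P.R m n k • P.b (Sum.inl k) :=
  P.lie_right m n

theorem lieB_inr_inl (m n : Fin d) : lieB E D (P.b (Sum.inr m)) (P.b (Sum.inl n)) =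
    ∑ k, P.Q k m n • P.b (Sum.inl k) - ∑ k, P.f k n m • P.b (Sum.inr k) := by
  rw [lieB_swap, lieB_inl_inr, neg_sub]

@[simp] theorem co_inl_lll (m n k : Fin d) :
    P.co (Sum.inl k) (lieB E D (P.b (Sum.inl m)) (P.b (Sum.inl n))) = P.f m n k := by
  simp [lieB_inl_inl, co_b]

@[simp] theorem co_inr_lll (m n k : Fin d) :
    P.co (Sum.inr k) (lieB E D (P.b (Sum.inl m)) (P.b (Sum.inl n))) = P.H m n k := by
  simp [lieB_inl_inl, co_b]

@[simp] theorem co_inl_llr (m n k : Fin d) :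
    P.co (Sum.inl k) (lieB E D (P.b (Sum.inl m)) (P.b (Sum.inr n))) = - P.Q k n m := by
  simp [lieB_inl_inr, co_b]

@[simp] theorem co_inr_llr (m n k : Fin d) :
    P.co (Sum.inr k) (lieB E D (P.b (Sum.inl m)) (P.b (Sum.inr n))) = P.f k m n := by
  simp [lieB_inl_inr, co_b]

@[simp] theorem co_inl_lrl (m n k : Fin d) :
    P.co (Sum.inl k) (lieB E D (P.b (Sum.inr m)) (P.b (Sum.inl n))) = P.Q k m n := by
  simp [lieB_inr_inl, co_b]

@[simp] theorem co_inr_lrl (m n k : Fin d) :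
    P.co (Sum.inr k) (lieB E D (P.b (Sum.inr m)) (P.b (Sum.inl n))) = - P.f k n m := by
  simp [lieB_inr_inl, co_b]

@[simp] theorem co_inl_lrr (m n k : Fin d) :
    P.co (Sum.inl k) (lieB E D (P.b (Sum.inr m)) (P.b (Sum.inr n))) = P.R m n k := by
  simp [lieB_inr_inr, co_b]

@[simp] theorem co_inr_lrr (m n k : Fin d) :
    P.co (Sum.inr k) (lieB E D (P.b (Sum.inr m)) (P.b (Sum.inr n))) = P.Q m n k := by
  simp [lieB_inr_inr, co_b]

theorem f_swap (m n k : Fin d) : P.f m n k = - P.f n m k := by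
  rw [← co_inl_lll, lieB_swap, map_neg, co_inl_lll]

theorem H_swap (m n k : Fin d) : P.H m n k = - P.H n m k := by
  rw [← co_inr_lll, lieB_swap, map_neg, co_inr_lll]

theorem Q_swap (m n k : Fin d) : P.Q m n k = - P.Q n m k := P.swap.f_swap m n k

theorem R_swap (m n k : Fin d) : P.R m n k = - P.R n m k := P.swap.H_swap m n k

/-- The involution of the Lie algebra exchanging `T_m` and `T̃^m`. It anticommutes with `K₀`, and
the pairing is positive definite on its `1`-eigenspace and negative definite on its `-1`-eigenspace.
-/
def J₀ : E →L[ℝ] E :=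
  ∑ m, ((P.co (Sum.inl m)).smulRight (P.b (Sum.inr m))
    + (P.co (Sum.inr m)).smulRight (P.b (Sum.inl m)))

theorem J₀_apply (v : E) : P.J₀ v = ∑ m, (P.co (Sum.inl m) v • P.b (Sum.inr m)
    + P.co (Sum.inr m) v • P.b (Sum.inl m)) := by
  simp [J₀, sum_apply]

theorem co_inl_J₀ (m : Fin d) (v : E) : P.co (Sum.inl m) (P.J₀ v) = P.co (Sum.inr m) v := by
  simp [J₀_apply, co_b]

theorem co_inr_J₀ (m : Fin d) (v : E) : P.co (Sum.inr m) (P.J₀ v) = P.co (Sum.inl m) v := by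
  simp [J₀_apply, co_b]

theorem J₀_J₀ (v : E) : P.J₀ (P.J₀ v) = v := by
  refine P.ext_co fun A => ?_
  cases A <;> simp [co_inl_J₀, co_inr_J₀]

theorem K₀_J₀ (v : E) : P.K₀ (P.J₀ v) = - P.J₀ (P.K₀ v) := by
  refine P.ext_co fun A => ?_
  cases A <;> simp [co_inl_J₀, co_inr_J₀, co_inl_K₀, co_inr_K₀]

theorem J₀_K₀ (v : E) : P.J₀ (P.K₀ v) = - P.K₀ (P.J₀ v) := by rw [K₀_J₀, neg_neg]

theorem η₀_self_pos {u : E} (hu : P.J₀ u = u) (hu0 : u ≠ 0) : 0 < P.η₀ u u := by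
  have h (m : Fin d) : P.co (Sum.inr m) u = P.co (Sum.inl m) u := by
    rw [← co_inl_J₀, hu]
  rw [η₀_apply]
  simp only [h]
  by_contra! hneg
  have h0 : ∀ m ∈ Finset.univ, P.co (Sum.inl m) u * P.co (Sum.inl m) u
      + P.co (Sum.inl m) u * P.co (Sum.inl m) u = 0 := by
    refine (Finset.sum_eq_zero_iff_of_nonneg fun m _ => ?_).1
      (le_antisymm hneg (Finset.sum_nonneg fun m _ => ?_)) <;>
    · have := mul_self_nonneg (P.co (Sum.inl m) u)
      linarith
  have h1 (m : Fin d) : P.co (Sum.inl m) u = 0 := by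
    have := h0 m (Finset.mem_univ m)
    exact mul_self_eq_zero.1 (by linarith)
  refine hu0 (P.ext_co fun A => ?_)
  cases A with
  | inl m => rw [h1, map_zero]
  | inr m => rw [h, h1, map_zero]

theorem η₀_self_neg {u : E} (hu : P.J₀ u = -u) (hu0 : u ≠ 0) : P.η₀ u u < 0 := by
  have h := P.η₀_self_pos (u := P.K₀ u) (by rw [J₀_K₀, hu, map_neg, neg_neg])
    (fun h => hu0 (by rw [← P.K₀_K₀ u, h, map_zero]))
  rw [η₀_K₀] at h
  linarith

theorem leftEnd_leftEnd (A B : E →L[ℝ] E) (x : D) (u : E) :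
    leftEnd A x (leftEnd B x u) = leftTr E x (A (B (mcForm E x u))) := by
  rw [leftEnd_apply, leftEnd_apply, mcForm_leftTr]

theorem η_symm (x : D) (u v : E) : P.η x u v = P.η x v u := by
  rw [η_apply, η_apply, η₀_symm]

theorem η_nondeg (x : D) (u : TangentSpace 𝓘(ℝ, E) x) (h : ∀ v, P.η x u v = 0) : u = 0 := by
  have h2 : mcForm E x u = 0 := by
    refine P.η₀_nondeg fun A => ?_
    have h1 := (P.η_apply x u (leftTr E x (P.b A))).symm.trans (h (leftTr E x (P.b A)))
    rwa [mcForm_leftTr] at h1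
  exact mcForm_injective (E := E) x (h2.trans (map_zero _).symm)

theorem K_K (x : D) (u : E) : P.K x (P.K x u) = u := by
  rw [K_eq, leftEnd_leftEnd, K₀_K₀, leftTr_mcForm]

theorem J_J (x : D) (u : E) : leftEnd P.J₀ x (leftEnd P.J₀ x u) = u := by
  rw [leftEnd_leftEnd, J₀_J₀, leftTr_mcForm]

theorem K_J (x : D) (u : E) : P.K x (leftEnd P.J₀ x u) = - leftEnd P.J₀ x (P.K x u) := by
  rw [K_eq, leftEnd_leftEnd, leftEnd_leftEnd, K₀_J₀]
  exact map_neg (leftTr E x) _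

theorem J_K (x : D) (u : E) : leftEnd P.J₀ x (P.K x u) = - P.K x (leftEnd P.J₀ x u) := by
  rw [K_J]; exact (neg_neg _).symm

theorem η_K (x : D) (u v : E) : P.η x (P.K x u) (P.K x v) = -P.η x u v := by
  rw [K_apply, K_apply, η_apply, η_apply, mcForm_leftTr, mcForm_leftTr, η₀_K₀]

theorem isAlmostParaHermitian : IsAlmostParaHermitian P.K P.η where
  smooth_end := by rw [K_eq]; exact isSmoothEnd_leftEnd _
  smooth_metric := by rw [η_eq]; exact isSmoothBilin_leftBilin _
  sq_eq_one := P.K_K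
  rank_eq x := finrank_eigenspace_one_eq_neg_one (V := E) (P.K x).toLinearMap
    (leftEnd P.J₀ x).toLinearMap (P.J_J x) (P.K_J x)
  symm := P.η_symm
  nondegenerate := P.η_nondeg
  signature x := by
    refine ⟨Module.End.eigenspace (leftEnd P.J₀ x).toLinearMap (1 : ℝ),
      Module.End.eigenspace (leftEnd P.J₀ x).toLinearMap (-1 : ℝ),
      isCompl_eigenspace_of_involutive (V := E) (leftEnd P.J₀ x).toLinearMap (P.J_J x),
      finrank_eigenspace_one_eq_neg_one (V := E) (leftEnd P.J₀ x).toLinearMap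
        (P.K x).toLinearMap (P.K_K x) (P.J_K x), ?_, ?_⟩
    · intro u hu hu0
      have h := (leftTr_eq_iff (E := E) x _ _).1 ((mem_Lplus_iff (leftEnd P.J₀) x u).1 hu)
      have h2 := P.η₀_self_pos h fun h3 =>
        hu0 (mcForm_injective (E := E) x (h3.trans (map_zero _).symm))
      exact h2.trans_eq (P.η_apply x u u).symm
    · intro u hu hu0
      have h := (leftTr_eq_iff (E := E) x _ _).1 ((mem_Lminus_iff (leftEnd P.J₀) x u).1 hu)
      have h2 := P.η₀_self_neg (h.trans (map_neg (mcForm E x) (u : E)))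
        fun h3 => hu0 (mcForm_injective (E := E) x (h3.trans (map_zero _).symm))
      exact (P.η_apply x u u).trans_lt h2
  compat := P.η_K

theorem K_mul_left (g x : D) (u : E) :
    P.K (g * x) (mder E E (g * ·) x u) = mder E E (g * ·) x (P.K x u) := by
  rw [K_apply, K_apply, mcForm_mul_left, leftTr_mul]

theorem η_mul_left (g x : D) (u v : E) :
    P.η (g * x) (mder E E (g * ·) x u) (mder E E (g * ·) x v) = P.η x u v := by
  rw [η_apply, η_apply, mcForm_mul_left, mcForm_mul_left]

theorem isLeftInvariantEnd : IsLeftInvariantEnd P.K := P.K_mul_left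

theorem isLeftInvariantBilin : IsLeftInvariantBilin P.η := P.η_mul_left

theorem Lplus_eq_span (x : D) :
    Lplus P.K x = Submodule.span ℝ (Set.range fun m => P.Z m x) := by
  have h : Submodule.map (leftTr E x).toLinearMap
      (Submodule.span ℝ (Set.range fun m => P.b (Sum.inl m))) =
      Submodule.span ℝ (Set.range fun m => (P.Z m x : E)) := by
    rw [Submodule.map_span, ← Set.range_comp]; rfl
  refine Submodule.ext fun u => (P.mem_Lplus x u).trans ?_
  rw [← mem_span_inl_iff]
  refine Iff.trans ?_ (show u ∈ Submodule.map (leftTr E x).toLinearMap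
      (Submodule.span ℝ (Set.range fun m => P.b (Sum.inl m))) ↔ _ from h ▸ Iff.rfl)
  constructor
  · exact fun hu => ⟨_, hu, leftTr_mcForm (E := E) x u⟩
  · rintro ⟨v, hv, rfl⟩
    exact (mcForm_leftTr x v).symm ▸ hv

theorem Lminus_eq_span (x : D) :
    Lminus P.K x = Submodule.span ℝ (Set.range fun m => P.Z' m x) := by
  rw [Lminus_eq, Lplus_eq_span]
  have h (m : Fin d) : P.swap.Z m x = P.Z' m x := congrArg (leftTr E x) (P.b_swap _)
  simp only [h]

theorem Ω_apply (x : D) (u v : E) : P.Ω x u v = P.η₀ (P.K₀ (mcForm E x u)) (mcForm E x v) := by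
  refine (P.η_apply x (P.K x u) v).trans ?_
  rw [K_apply, mcForm_leftTr]

theorem Ω_swap (x : D) (u v : E) : P.swap.Ω x u v = - P.Ω x u v := by
  rw [Ω_apply, Ω_apply, η₀_swap, K₀_swap]
  simp

theorem mem_Lplus_iff_Ω (x : D) (u : E) :
    u ∈ Lplus P.K x ↔ ∀ v : E, v ∈ Lplus P.K x → P.Ω x u v = 0 := by
  simp only [mem_Lplus, Ω_apply]
  constructor
  · intro h v hv
    rw [(P.K₀_eq_iff _).2 h, η₀_apply]
    simp [h, hv]
  · intro h m
    have := h (leftTr E x (P.b (Sum.inl m))) fun n => by rw [mcForm_leftTr]; simp [co_b]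
    rw [mcForm_leftTr] at this
    simpa [co_inr_K₀] using this

theorem isLagrangian_Lplus : IsLagrangian P.Ω (Lplus P.K) := P.mem_Lplus_iff_Ω

theorem isLagrangian_Lminus : IsLagrangian P.Ω (Lminus P.K) := by
  rw [Lminus_eq]
  intro x u
  refine (P.swap.mem_Lplus_iff_Ω x u).trans (forall₂_congr fun v _ => ?_)
  exact ((P.Ω_swap x u v).congr_left).trans neg_eq_zero

theorem Ω_eq_sum_wedge₂ (x : D) (u v : E) :
    P.Ω x u v = ∑ m, wedge₂ (P.Θ m x) (P.Θ' m x) u v := by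
  rw [Ω_apply, η₀_apply]
  refine Finset.sum_congr rfl fun m _ => ?_
  rw [co_inl_K₀, co_inr_K₀]
  simp only [wedge₂]
  refine (show _ = P.co (Sum.inl m) (mcForm E x u) * P.co (Sum.inr m) (mcForm E x v) -
    P.co (Sum.inl m) (mcForm E x v) * P.co (Sum.inr m) (mcForm E x u) from ?_)
  ring

end Polarization

/-! ### Involutivity and the exterior derivative of the fundamental form -/

section LeftInvariantForms

variable {E : Type*} [NormedAddCommGroup E] [NormedSpace ℝ E] [FiniteDimensional ℝ E]
  {D : Type*} [TopologicalSpace D] [ChartedSpace E D] [Group D] [LieGroup 𝓘(ℝ, E) ∞ D]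

theorem dirDeriv_leftBilin (B : E →L[ℝ] E →L[ℝ] ℝ) (X : VField E D) {Y Z : VField E D}
    (hY : IsSmoothVF Y) (hZ : IsSmoothVF Z) (x : D) :
    dirDeriv X (fun y => leftBilin B y (Y y) (Z y)) x =
      B (mder E E (leftTriv Y) x (X x)) (leftTriv Z x)
        + B (leftTriv Y x) (mder E E (leftTriv Z) x (X x)) :=
  mder_bilin B (hY.mdifferentiableAt_leftTriv x) (hZ.mdifferentiableAt_leftTriv x) (X x)

/-- The exterior derivative of a left-invariant 2-form is the Chevalley-Eilenberg differential. -/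
theorem extDeriv₂_leftBilin (B : E →L[ℝ] E →L[ℝ] ℝ) (hB : ∀ u v, B u v = - B v u)
    {X Y Z : VField E D} (hX : IsSmoothVF X) (hY : IsSmoothVF Y) (hZ : IsSmoothVF Z) (x : D) :
    extDeriv₂ (leftBilin B) X Y Z x =
      - B (lieB E D (leftTriv X x) (leftTriv Y x)) (leftTriv Z x)
        + B (lieB E D (leftTriv X x) (leftTriv Z x)) (leftTriv Y x)
        - B (lieB E D (leftTriv Y x) (leftTriv Z x)) (leftTriv X x) := by
  have h (X Y Z : VField E D) (hX : IsSmoothVF X) (hY : IsSmoothVF Y) :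
      leftBilin B x (mlieBracket 𝓘(ℝ, E) X Y x) (Z x) =
        B (mder E E (leftTriv Y) x (X x)) (leftTriv Z x)
        - B (mder E E (leftTriv X) x (Y x)) (leftTriv Z x)
        + B (lieB E D (leftTriv X x) (leftTriv Y x)) (leftTriv Z x) := by
    have h1 : leftBilin B x (mlieBracket 𝓘(ℝ, E) X Y x) (Z x) =
      B (leftTriv (mlieBracket 𝓘(ℝ, E) X Y) x) (leftTriv Z x) := rfl
    rw [h1, leftTriv_mlieBracket hX hY]
    simp
  rw [extDeriv₂, dirDeriv_leftBilin B X hY hZ, dirDeriv_leftBilin B Y hX hZ,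
    dirDeriv_leftBilin B Z hX hY, h X Y Z hX hY, h X Z Y hX hZ, h Y Z X hY hZ,
    hB (leftTriv Y x) (mder E E (leftTriv Z) x (X x)),
    hB (leftTriv X x) (mder E E (leftTriv Z) x (Y x)),
    hB (leftTriv X x) (mder E E (leftTriv Y) x (Z x))]
  ring

end LeftInvariantForms

namespace Polarization

variable {E : Type*} [NormedAddCommGroup E] [NormedSpace ℝ E] [FiniteDimensional ℝ E]
  {D : Type*} [TopologicalSpace D] [ChartedSpace E D] [Group D] [LieGroup 𝓘(ℝ, E) ∞ D]
  {d : ℕ} (P : Polarization E D d)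

theorem leftVF_mem_Lplus (m : Fin d) (x : D) : leftVF (P.b (Sum.inl m)) x ∈ Lplus P.K x := by
  refine (P.mem_Lplus x _).2 fun n => ?_
  have h : mcForm E x (leftVF (P.b (Sum.inl m)) x) = P.b (Sum.inl m) := mcForm_leftTr x _
  rw [h, co_b, if_neg (by simp)]

theorem isSectionOf_Z (m : Fin d) : IsSectionOf (Lplus P.K) (P.Z m) :=
  ⟨isSmoothVF_leftVF _, P.leftVF_mem_Lplus m⟩

/-- Two trilinear forms that agree on the `T_m` agree on their span. -/
theorem trilinear_eq_of_inl {t s : E → E → E → ℝ} (ht : IsTrilinear t) (hs : IsTrilinear s)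
    (h : ∀ m n k, t (P.b (Sum.inl m)) (P.b (Sum.inl n)) (P.b (Sum.inl k)) =
      s (P.b (Sum.inl m)) (P.b (Sum.inl n)) (P.b (Sum.inl k))) {u v w : E}
    (hu : ∀ m, P.co (Sum.inr m) u = 0) (hv : ∀ m, P.co (Sum.inr m) v = 0)
    (hw : ∀ m, P.co (Sum.inr m) w = 0) : t u v w = s u v w :=
  ht.eq_on_span hs (by rintro _ ⟨m, rfl⟩ _ ⟨n, rfl⟩ _ ⟨k, rfl⟩; exact h m n k)
    ((P.mem_span_inl_iff u).2 hu) ((P.mem_span_inl_iff v).2 hv) ((P.mem_span_inl_iff w).2 hw)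

theorem trilinear_eq_of_basis {t s : E → E → E → ℝ} (ht : IsTrilinear t) (hs : IsTrilinear s)
    (h : ∀ A B C, t (P.b A) (P.b B) (P.b C) = s (P.b A) (P.b B) (P.b C)) (u v w : E) :
    t u v w = s u v w :=
  ht.eq_on_span hs (S := Set.range P.b)
    (by rintro _ ⟨m, rfl⟩ _ ⟨n, rfl⟩ _ ⟨k, rfl⟩; exact h m n k)
    (P.b.mem_span u) (P.b.mem_span v) (P.b.mem_span w)

theorem co_inr_b_inl (m n : Fin d) : P.co (Sum.inr m) (P.b (Sum.inl n)) = 0 := by simp [co_b]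

/-- In the left trivialization the derivatives of a section of `L₊` stay in `L₊`. -/
theorem co_inr_mder {X : VField E D} (hX : IsSectionOf (Lplus P.K) X) (x : D) (v : E) (k : Fin d) :
    P.co (Sum.inr k) (mder E E (leftTriv X) x v) = 0 := by
  have hX' (y : D) : P.co (Sum.inr k) (leftTriv X y) = 0 := (P.mem_Lplus y _).1 (hX.2 y) k
  rw [← mder_clm _ (hX.1.mdifferentiableAt_leftTriv x)]
  simp only [hX', mder_const]
  rfl

theorem isInvolutive_Lplus_iff : IsInvolutive (Lplus P.K) ↔ P.H = 0 := by
  constructor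
  · intro h
    funext m n k
    have h1 : mlieBracket 𝓘(ℝ, E) (P.Z m) (P.Z n) 1 ∈ Lplus P.K 1 :=
      h _ _ (P.isSectionOf_Z m) (P.isSectionOf_Z n) 1
    have h2 := (P.mem_Lplus 1 _).1 h1 k
    have h3 := leftTriv_mlieBracket_leftVF (P.b (Sum.inl m)) (P.b (Sum.inl n)) (1 : D)
    have h4 : P.co (Sum.inr k) (leftTriv (mlieBracket 𝓘(ℝ, E) (leftVF (P.b (Sum.inl m)))
      (leftVF (P.b (Sum.inl n)))) (1 : D)) = 0 := h2
    rw [h3, co_inr_lll] at h4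
    exact h4
  · intro h X Y hX hY x
    refine (P.mem_Lplus x _).2 fun k => ?_
    have hX' (m) : P.co (Sum.inr m) (leftTriv X x) = 0 := (P.mem_Lplus x _).1 (hX.2 x) m
    have hY' (m) : P.co (Sum.inr m) (leftTriv Y x) = 0 := (P.mem_Lplus x _).1 (hY.2 x) m
    have h1 : P.co (Sum.inr k) (lieB E D (leftTriv X x) (leftTriv Y x)) = 0 := by
      have := P.trilinear_eq_of_inl (isTrilinear_bilin_comp P.η₀ (lieB E D)) IsTrilinear.zero
        (fun m n k => by simp [h]) hX' hY' (P.co_inr_b_inl · k)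
      simpa using this
    have h2 (a b c : E) (ha : P.co (Sum.inr k) a = 0) (hb : P.co (Sum.inr k) b = 0)
        (hc : P.co (Sum.inr k) c = 0) : P.co (Sum.inr k) (a - b + c) = 0 := by
      simp [ha, hb, hc]
    exact (congrArg (P.co (Sum.inr k)) (leftTriv_mlieBracket hX.1 hY.1 x)).trans
      (h2 _ _ _ (P.co_inr_mder hY x _ k) (P.co_inr_mder hX x _ k) h1)

theorem isInvolutive_Lminus_iff : IsInvolutive (Lminus P.K) ↔ P.R = 0 := by
  rw [Lminus_eq, isInvolutive_Lplus_iff]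
  rfl

theorem Ω_eq : P.Ω = leftBilin (P.η₀.comp P.K₀) := by
  funext x
  exact ContinuousLinearMap.ext fun u => ContinuousLinearMap.ext fun v => P.Ω_apply x u v

theorem Ω₀_skew (u v : E) : P.η₀ (P.K₀ u) v = - P.η₀ (P.K₀ v) u := by
  rw [P.η₀_symm (P.K₀ v), ← P.η₀_K₀, K₀_K₀]

/-- The Chevalley-Eilenberg differential of `ω` is trilinear. -/
theorem isTrilinear_extDeriv :
    IsTrilinear fun u v w : E => - P.η₀ (P.K₀ (lieB E D u v)) w + P.η₀ (P.K₀ (lieB E D u w)) v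
      - P.η₀ (P.K₀ (lieB E D v w)) u := by
  have h := isTrilinear_bilin_comp (P.η₀.comp P.K₀) (lieB E D)
  simpa using ((h.const_mul (-1)).add h.swap₂₃).sub h.rotate

/-- The contraction of a three-index array with wedge products of three families of covectors. -/
theorem sum_mul_wedge₃ {V : Type*} (A : Fin d → Fin d → Fin d → ℝ) (α β γ : Fin d → V → ℝ)
    (u v w : V) : ∑ m, ∑ n, ∑ p, A m n p * wedge₃ (α m) (β n) (γ p) u v w =
      ∑ m, ∑ n, ∑ p, A m n p * (α m u * (β n v * γ p w))
      - ∑ m, ∑ n, ∑ p, A m n p * (α m u * (β n w * γ p v))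
      - ∑ m, ∑ n, ∑ p, A m n p * (α m v * (β n u * γ p w))
      + ∑ m, ∑ n, ∑ p, A m n p * (α m v * (β n w * γ p u))
      + ∑ m, ∑ n, ∑ p, A m n p * (α m w * (β n u * γ p v))
      - ∑ m, ∑ n, ∑ p, A m n p * (α m w * (β n v * γ p u)) := by
  simp only [← Finset.sum_sub_distrib, ← Finset.sum_add_distrib, wedge₃, Matrix.det_fin_three]
  refine Finset.sum_congr rfl fun m _ => Finset.sum_congr rfl fun n _ =>
    Finset.sum_congr rfl fun p _ => ?_
  simp
  ring

theorem sum_delta₃ (A : Fin d → Fin d → Fin d → ℝ) (a b c : Fin d) :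
    ∑ m, ∑ n, ∑ p, A m n p * ((if a = m then 1 else 0) *
      ((if b = n then 1 else 0) * (if c = p then 1 else 0))) = A a b c := by
  simp

/-- Both sides are trilinear in the left trivialization, and on basis vectors the sums on the right
collapse to the single coefficients prescribed by the bracket relations. -/
theorem extDeriv₂_Ω {X Y W : VField E D} (hX : IsSmoothVF X) (hY : IsSmoothVF Y)
    (hW : IsSmoothVF W) (x : D) :
    extDeriv₂ P.Ω X Y W x = (1 / 2) * ∑ m, ∑ n, ∑ p,
      (P.H m n p * wedge₃ (P.Θ m x) (P.Θ n x) (P.Θ p x) (X x) (Y x) (W x)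
        - P.R m n p * wedge₃ (P.Θ' m x) (P.Θ' n x) (P.Θ' p x) (X x) (Y x) (W x)
        + P.f m n p * wedge₃ (P.Θ m x) (P.Θ n x) (P.Θ' p x) (X x) (Y x) (W x)
        - P.Q m n p * wedge₃ (P.Θ' m x) (P.Θ' n x) (P.Θ p x) (X x) (Y x) (W x)) := by
  rw [Ω_eq, extDeriv₂_leftBilin _ (P.Ω₀_skew) hX hY hW]
  have key := P.trilinear_eq_of_basis P.isTrilinear_extDeriv
    (s := fun u v w => (1 / 2) * ∑ m, ∑ n, ∑ p,
      (P.H m n p * wedge₃ (P.co (Sum.inl m)) (P.co (Sum.inl n)) (P.co (Sum.inl p)) u v w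
        - P.R m n p * wedge₃ (P.co (Sum.inr m)) (P.co (Sum.inr n)) (P.co (Sum.inr p)) u v w
        + P.f m n p * wedge₃ (P.co (Sum.inl m)) (P.co (Sum.inl n)) (P.co (Sum.inr p)) u v w
        - P.Q m n p * wedge₃ (P.co (Sum.inr m)) (P.co (Sum.inr n)) (P.co (Sum.inl p)) u v w))
    ?_ ?_ (leftTriv X x) (leftTriv Y x) (leftTriv W x)
  · exact key
  · refine IsTrilinear.const_mul (.sum fun m => .sum fun n => .sum fun p => ?_) _
    have ht (α β γ : E →L[ℝ] ℝ) (c : ℝ) := (isTrilinear_wedge₃ α β γ).const_mul c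
    exact (((ht _ _ _ _).sub (ht _ _ _ _)).add (ht _ _ _ _)).sub (ht _ _ _ _)
  · intro A B C
    simp only [Finset.sum_sub_distrib, Finset.sum_add_distrib, sum_mul_wedge₃, co_b]
    rcases A with a | a <;> rcases B with b | b <;> rcases C with c | c <;>
      simp only [Sum.inl.injEq, Sum.inr.injEq, reduceCtorEq, if_false, mul_zero, zero_mul,
        Finset.sum_const_zero, sum_delta₃, η₀_inl_right, η₀_inr_right, co_inl_K₀, co_inr_K₀,
        co_inl_lll, co_inr_lll, co_inl_llr, co_inr_llr, co_inl_lrl, co_inr_lrl, co_inl_lrr,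
        co_inr_lrr]
    -- one case for each way of choosing `T` or `T̃` in the three slots
    · linarith [P.H_swap a b c, P.H_swap a c b, P.H_swap b c a]
    · linarith [P.f_swap a b c]
    · linarith [P.f_swap a c b]
    · linarith [P.Q_swap b c a]
    · linarith [P.f_swap b c a]
    · linarith [P.Q_swap a c b]
    · linarith [P.Q_swap a b c]
    · linarith [P.R_swap a b c, P.R_swap a c b, P.R_swap b c a]

end Polarization

/-! ### The Koszul formula and the brackets of a connection -/

section Koszul

variable {E : Type*} [NormedAddCommGroup E] [NormedSpace ℝ E]
  {M : Type*} [TopologicalSpace M] [ChartedSpace E M] [IsManifold 𝓘(ℝ, E) ∞ M]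
  {η : BilinField E M}
  {nab : CovariantDerivative 𝓘(ℝ, E) E (TangentSpace 𝓘(ℝ, E) : M → Type _)}

/-- The Koszul formula. -/
theorem IsLeviCivita.koszul (h : IsLeviCivita η nab) (symm : ∀ x u v, η x u v = η x v u)
    {X Y Z : VField E M} (hX : IsSmoothVF X) (hY : IsSmoothVF Y) (hZ : IsSmoothVF Z) (x : M) :
    2 * η x (nab Y x (X x)) (Z x) =
      dirDeriv X (fun y => η y (Y y) (Z y)) x + dirDeriv Y (fun y => η y (X y) (Z y)) x
      - dirDeriv Z (fun y => η y (X y) (Y y)) x + η x (mlieBracket 𝓘(ℝ, E) X Y x) (Z x)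
      - η x (mlieBracket 𝓘(ℝ, E) X Z x) (Y x) - η x (mlieBracket 𝓘(ℝ, E) Y Z x) (X x) := by
  have t {X Y : VField E M} (hX : IsSmoothVF X) (hY : IsSmoothVF Y) (Z : VField E M) :
      η x (mlieBracket 𝓘(ℝ, E) X Y x) (Z x) =
        η x (nab Y x (X x)) (Z x) - η x (nab X x (Y x)) (Z x) := by
    rw [← h.torsion_free X Y hX hY x, map_sub, sub_apply]
  rw [h.metric X Y Z hX hY hZ, h.metric Y X Z hY hX hZ, h.metric Z X Y hZ hX hY, t hX hY Z,
    t hX hZ Y, t hY hZ X, symm x (Y x), symm x (X x) (nab Z x (Y x)), symm x (X x)]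
  ring

theorem dirDeriv_eq_zero (X : VField E M) {φ : M → ℝ} {c : ℝ} (h : ∀ y, φ y = c) (x : M) :
    dirDeriv X φ x = 0 := by
  obtain rfl : φ = fun _ => c := funext h
  rw [dirDeriv, mfderiv_const]
  rfl

theorem dirDeriv_neg (X : VField E M) (φ : M → ℝ) (x : M) :
    dirDeriv X (fun y => - φ y) x = - dirDeriv X φ x :=
  congrArg (fun φ : E →L[ℝ] ℝ => φ (X x)) (mfderiv_neg (I := 𝓘(ℝ, E)) (f := φ))

/-- For three vector fields with constant mutual scalar products, the bracket of the Levi-Civita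
connection is half the cyclic sum of the terms `η([X, Y], W)`. -/
theorem IsLeviCivita.two_mul_connBracket [FiniteDimensional ℝ E] (h : IsLeviCivita η nab)
    (symm : ∀ x u v, η x u v = η x v u) (nondeg : ∀ x u, (∀ v, η x u v = 0) → u = 0)
    {X Y W : VField E M} (hX : IsSmoothVF X) (hY : IsSmoothVF Y) (hW : IsSmoothVF W)
    {a b c : ℝ} (hXY : ∀ y, η y (X y) (Y y) = a) (hWY : ∀ y, η y (W y) (Y y) = b)
    (hWX : ∀ y, η y (W y) (X y) = c) (x : M) :
    2 * η x (connBracket η nab.toFun X Y x) (W x) =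
      η x (mlieBracket 𝓘(ℝ, E) X Y x) (W x) + η x (mlieBracket 𝓘(ℝ, E) Y W x) (X x)
      + η x (mlieBracket 𝓘(ℝ, E) W X x) (Y x) := by
  have h1 := connBracket_spec η symm nondeg nab.toFun X Y x (W x)
  have h2 := h.torsion_free X Y hX hY x
  have h3 := h.koszul symm hW hX hY x
  rw [dirDeriv_eq_zero W hXY, dirDeriv_eq_zero X hWY, dirDeriv_eq_zero Y hWX] at h3
  have h4 : η x (mlieBracket 𝓘(ℝ, E) W Y x) (X x) = - η x (mlieBracket 𝓘(ℝ, E) Y W x) (X x) := by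
    rw [mlieBracket_swap_apply, map_neg, neg_apply]
  change _ = η x (nab Y x (X x) - nab X x (Y x)) (W x) + η x (nab X x (W x)) (Y x) at h1
  rw [h2] at h1
  rw [h1]
  linarith

/-- The canonical connection does not change when the two eigenbundles are exchanged. -/
theorem canonicalConnection_neg (K : EndField E M) (nab : VField E M → EndField E M) :
    canonicalConnection (fun x => - K x) nab = canonicalConnection K nab := by
  have h1 : projPlus (fun x => - K x) = projMinus K := by
    funext x; simp only [projPlus, projMinus, sub_eq_add_neg]
  have h2 : projMinus (fun x => - K x) = projPlus K := by
    funext x; simp only [projPlus, projMinus, sub_neg_eq_add]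
  funext Y x
  simp only [canonicalConnection, h1, h2]
  exact add_comm _ _

theorem dBracket_neg (K : EndField E M) (η : BilinField E M) (nab : VField E M → EndField E M) :
    dBracket (fun x => - K x) η nab = dBracket K η nab := by
  rw [dBracket, dBracket, canonicalConnection_neg]

theorem projPlus_apply (K : EndField E M) (x : M) (u : TangentSpace 𝓘(ℝ, E) x) :
    projPlus K x u = (1 / 2 : ℝ) • (u + K x u) := rfl

theorem projMinus_apply (K : EndField E M) (x : M) (u : TangentSpace 𝓘(ℝ, E) x) :
    projMinus K x u = (1 / 2 : ℝ) • (u - K x u) := rfl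

/-- An eigenspace of an `η`-skew involution is isotropic. -/
theorem isotropic_of_compat {K : EndField E M} (compat : ∀ x u v, η x (K x u) (K x v) = -η x u v)
    {ε : ℝ} (hε : ε * ε = 1) {x : M} {u v : TangentSpace 𝓘(ℝ, E) x} (hu : K x u = ε • u)
    (hv : K x v = ε • v) : η x u v = 0 := by
  have h := compat x u v
  rw [hu, hv, map_smul, map_smul, smul_apply, smul_eq_mul, smul_eq_mul, ← mul_assoc, hε] at h
  linarith

/-- On sections of `L₊` the D-bracket is the projection of the Lie bracket to `L₊`. -/
theorem IsLeviCivita.dBracket_eq [FiniteDimensional ℝ E] (h : IsLeviCivita η nab)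
    {K : EndField E M} (hK : IsAlmostParaHermitian K η)
    {X Y : VField E M} (hX : IsSectionOf (Lplus K) X) (hY : IsSectionOf (Lplus K) Y) (x : M) :
    dBracket K η nab.toFun X Y x = projPlus K x (mlieBracket 𝓘(ℝ, E) X Y x) := by
  have hcan {X : VField E M} (hX : IsSectionOf (Lplus K) X) :
      canonicalConnection K nab.toFun X x = (projPlus K x).comp (nab X x) := by
    have hX' (y : M) : K y (X y) = X y := (mem_Lplus_iff K y _).1 (hX.2 y)
    have h1 : (fun y => projPlus K y (X y)) = X := by
      funext y
      rw [projPlus_apply, hX']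
      module
    have h2 : (fun y => projMinus K y (X y)) = 0 := by
      funext y
      rw [projMinus_apply, hX', sub_self, smul_zero]
      rfl
    rw [canonicalConnection, h1, h2]
    have h3 : nab.toFun 0 x = 0 := nab.isCovariantDerivativeOnUniv.zero
    rw [h3, ContinuousLinearMap.comp_zero, add_zero]
  refine sub_eq_zero.1 (hK.nondegenerate x _ fun z => ?_)
  have h1 := connBracket_spec η hK.symm hK.nondegenerate (canonicalConnection K nab.toFun) X Y x z
  rw [hcan hX, hcan hY] at h1
  have h2 : (projPlus K x).comp (nab Y x) (X x) - (projPlus K x).comp (nab X x) (Y x) =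
      projPlus K x (mlieBracket 𝓘(ℝ, E) X Y x) := by
    rw [← h.torsion_free X Y hX.1 hY.1 x, map_sub]; rfl
  have h3 : η x ((projPlus K x).comp (nab X x) z) (Y x) = 0 := by
    refine isotropic_of_compat hK.compat (one_mul 1) ?_
      (((mem_Lplus_iff K x _).1 (hY.2 x)).trans (one_smul ℝ _).symm)
    rw [one_smul]
    change K x (projPlus K x (nab X x z)) = projPlus K x (nab X x z)
    rw [projPlus_apply, map_smul, map_add, hK.sq_eq_one, add_comm]
  rw [h2, h3, add_zero] at h1
  rw [map_sub, sub_apply, sub_eq_zero]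
  exact h1

end Koszul

section ParaKahler

variable {E : Type*} [NormedAddCommGroup E] [NormedSpace ℝ E]
  {M : Type*} [TopologicalSpace M] [ChartedSpace E M] [IsManifold 𝓘(ℝ, E) ∞ M]
  {η : BilinField E M}
  {nab : CovariantDerivative 𝓘(ℝ, E) E (TangentSpace 𝓘(ℝ, E) : M → Type _)}
  {K : EndField E M}

theorem IsSmoothEnd.apply (hK : IsSmoothEnd K) {X : VField E M} (hX : IsSmoothVF X) :
    IsSmoothVF (fun x => K x (X x) : VField E M) :=
  ContMDiff.clm_bundle_apply (b := id) hK hX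

/-- A vector field in the `ε`-eigenbundle of `K`. -/
structure IsEigenField (K : EndField E M) (ε : ℝ) (X : VField E M) : Prop where
  smooth : IsSmoothVF X
  eq : ∀ x, K x (X x) = ε • X x

/-- The projection of a smooth vector field to the `ε`-eigenbundle, for `ε = ±1`. -/
theorem IsSmoothEnd.isEigenField (hK : IsSmoothEnd K) (sq : ∀ x u, K x (K x u) = u)
    {ε : ℝ} (hε : ε * ε = 1) {X : VField E M} (hX : IsSmoothVF X) :
    IsEigenField K ε (fun x => (1 / 2 : ℝ) • (X x + ε • K x (X x))) where
  smooth := ContMDiff.const_smul_section (ContMDiff.add_section hX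
    (ContMDiff.const_smul_section (hK.apply hX)))
  eq x := by
    rw [map_smul, map_add, map_smul, sq]
    rw [smul_comm ε, smul_add ε, smul_smul, hε, one_smul, add_comm]

theorem IsParaKahler.mlieBracket_eigen (hK : IsParaKahler K η) {ε : ℝ} (hε : ε = 1 ∨ ε = -1)
    {X Y : VField E M} (hX : IsEigenField K ε X) (hY : IsEigenField K ε Y) (x : M) :
    K x (mlieBracket 𝓘(ℝ, E) X Y x) = ε • mlieBracket 𝓘(ℝ, E) X Y x := by
  rcases hε with rfl | rfl
  · exact Module.End.mem_eigenspace_iff.1 (hK.involutive_plus X Y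
      ⟨hX.smooth, fun x => Module.End.mem_eigenspace_iff.2 (hX.eq x)⟩
      ⟨hY.smooth, fun x => Module.End.mem_eigenspace_iff.2 (hY.eq x)⟩ x)
  · exact Module.End.mem_eigenspace_iff.1 (hK.involutive_minus X Y
      ⟨hX.smooth, fun x => Module.End.mem_eigenspace_iff.2 (hX.eq x)⟩
      ⟨hY.smooth, fun x => Module.End.mem_eigenspace_iff.2 (hY.eq x)⟩ x)

theorem IsAlmostParaHermitian.skew (hK : IsAlmostParaHermitian K η) (x : M)
    (u v : TangentSpace 𝓘(ℝ, E) x) : η x (K x u) v = - η x u (K x v) := by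
  have h := hK.compat x u (K x v)
  rwa [hK.sq_eq_one] at h

/-- The Levi-Civita connection of a para-Kähler metric preserves the eigenbundles. For `V` in the
same eigenbundle as `Y` this is the Koszul formula together with involutivity, and for `V` in the
opposite eigenbundle the Koszul expression is `dω(V, Y, W)`. -/
theorem IsLeviCivita.nab_eigen_orthogonal (h : IsLeviCivita η nab) (hK : IsParaKahler K η)
    {ε δ : ℝ} (hε : ε = 1 ∨ ε = -1) (hδ : δ = ε ∨ δ = -ε) {V Y W : VField E M}
    (hV : IsEigenField K δ V) (hY : IsEigenField K ε Y) (hW : IsEigenField K ε W) (x : M) :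
    η x (nab Y x (V x)) (W x) = 0 := by
  have hε2 : ε * ε = 1 := by rcases hε with rfl | rfl <;> norm_num
  have iso {x : M} {u v : TangentSpace 𝓘(ℝ, E) x} (hu : K x u = ε • u) (hv : K x v = ε • v) :
    η x u v = 0 := isotropic_of_compat hK.compat hε2 hu hv
  have hYW (y : M) : η y (Y y) (W y) = 0 := iso (hY.eq y) (hW.eq y)
  have key := h.koszul hK.symm hV.smooth hY.smooth hW.smooth x
  rcases hδ with rfl | rfl
  · rw [dirDeriv_eq_zero V hYW, dirDeriv_eq_zero Y (fun y => iso (hV.eq y) (hW.eq y)),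
      dirDeriv_eq_zero W (fun y => iso (hV.eq y) (hY.eq y)),
      iso (hK.mlieBracket_eigen hε hV hY x) (hW.eq x),
      iso (hK.mlieBracket_eigen hε hV hW x) (hY.eq x),
      iso (hK.mlieBracket_eigen hε hY hW x) (hV.eq x)] at key
    linarith
  · have hd := hK.closed V Y W hV.smooth hY.smooth hW.smooth x
    have e1 (y : M) : fundamentalForm K η y (Y y) (W y) = 0 := by
      change η y (K y (Y y)) (W y) = 0
      rw [hY.eq, map_smul, smul_apply, hYW, smul_zero]
    have e2 (Z : VField E M) (y : M) :
        fundamentalForm K η y (V y) (Z y) = - (ε * η y (V y) (Z y)) := by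
      change η y (K y (V y)) (Z y) = _
      rw [hV.eq, map_smul, smul_apply, smul_eq_mul, neg_mul]
    have e3 (A : TangentSpace 𝓘(ℝ, E) x) {Z : VField E M} (hZ : IsEigenField K ε Z) :
        fundamentalForm K η x A (Z x) = - (ε * η x A (Z x)) := by
      change η x (K x A) (Z x) = _
      rw [hK.skew, hZ.eq, map_smul, smul_eq_mul]
    have e4 : fundamentalForm K η x (mlieBracket 𝓘(ℝ, E) Y W x) (V x) =
        ε * η x (mlieBracket 𝓘(ℝ, E) Y W x) (V x) := by
      change η x (K x _) (V x) = _
      rw [hK.mlieBracket_eigen hε hY hW, map_smul, smul_apply, smul_eq_mul]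
    have e5 (X Z : VField E M) :
        dirDeriv X (fun y => fundamentalForm K η y (V y) (Z y)) x =
          -ε * dirDeriv X (fun y => η y (V y) (Z y)) x := by
      rcases hε with rfl | rfl
      · have e6 : (fun y => fundamentalForm K η y (V y) (Z y)) =
            fun y => - η y (V y) (Z y) := funext fun y => by rw [e2, one_mul]
        rw [e6, dirDeriv_neg, neg_one_mul]
      · have e6 : (fun y => fundamentalForm K η y (V y) (Z y)) =
            fun y => η y (V y) (Z y) := funext fun y => by rw [e2]; ring
        rw [e6, neg_neg, one_mul]
    rw [extDeriv₂, dirDeriv_eq_zero V e1, e5, e5, e3 _ hW, e3 _ hY, e4] at hd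
    rw [dirDeriv_eq_zero V hYW] at key
    have : ε * (2 * η x (nab Y x (V x)) (W x)) = 0 := by
      rw [key]
      linarith
    rcases hε with rfl | rfl <;> linarith

end ParaKahler

/-! ### Para-Kähler structures and the Levi-Civita connection on a Lie group -/

section ParaKahlerGroup

variable {E : Type*} [NormedAddCommGroup E] [NormedSpace ℝ E] [FiniteDimensional ℝ E]
  {D : Type*} [TopologicalSpace D] [ChartedSpace E D] [Group D] [LieGroup 𝓘(ℝ, E) ∞ D]
  {η : BilinField E D}
  {nab : CovariantDerivative 𝓘(ℝ, E) E (TangentSpace 𝓘(ℝ, E) : D → Type _)}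
  {K : EndField E D}

theorem exists_isSmoothVF_eq (x : D) (v : TangentSpace 𝓘(ℝ, E) x) :
    ∃ V : VField E D, IsSmoothVF V ∧ V x = v :=
  ⟨leftVF (mcForm E x v), isSmoothVF_leftVF _, leftTr_mcForm (E := E) x v⟩

/-- The Levi-Civita connection of a para-Kähler metric preserves the eigenbundles: `∇ Y` is
orthogonal to the `ε`-eigenbundle, which is its own orthogonal complement. -/
theorem IsLeviCivita.nab_eigen (h : IsLeviCivita η nab) (hK : IsParaKahler K η)
    {ε : ℝ} (hε : ε = 1 ∨ ε = -1) {Y : VField E D} (hY : IsEigenField K ε Y) (x : D)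
    (v : TangentSpace 𝓘(ℝ, E) x) : K x (nab Y x v) = ε • nab Y x v := by
  have hε2 : ε * ε = 1 := by rcases hε with rfl | rfl <;> norm_num
  have hε2' : -ε * -ε = 1 := by rw [neg_mul_neg, hε2]
  have key (z : TangentSpace 𝓘(ℝ, E) x) : η x (nab Y x v - ε • K x (nab Y x v)) z = 0 := by
    obtain ⟨V, hV, rfl⟩ := exists_isSmoothVF_eq (E := E) x v
    obtain ⟨W, hW, rfl⟩ := exists_isSmoothVF_eq (E := E) x z
    have hW' := hK.smooth_end.isEigenField hK.sq_eq_one hε2 hW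
    have h1 := h.nab_eigen_orthogonal hK hε (Or.inl rfl)
      (hK.smooth_end.isEigenField hK.sq_eq_one hε2 hV) hY hW' x
    have h2 := h.nab_eigen_orthogonal hK hε (Or.inr rfl)
      (hK.smooth_end.isEigenField hK.sq_eq_one hε2' hV) hY hW' x
    have h3 : η x (nab Y x (V x)) ((1 / 2 : ℝ) • (W x + ε • K x (W x))) = 0 := by
      have h4 : V x = (1 / 2 : ℝ) • (V x + ε • K x (V x)) +
        (1 / 2 : ℝ) • (V x + -ε • K x (V x)) := by module
      rw [h4, map_add, map_add, add_apply]
      beta_reduce at h1 h2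
      rw [h1, h2, add_zero]
    rw [map_sub, map_smul, sub_apply, smul_apply, hK.skew]
    simp only [map_smul, map_add, smul_eq_mul] at h3 ⊢
    linarith
  have h5 := sub_eq_zero.1 (hK.nondegenerate x _ key)
  conv_rhs => rw [h5]
  rw [smul_smul, hε2, one_smul]

/-- For a para-Kähler structure the canonical connection is the Levi-Civita connection. -/
theorem IsLeviCivita.canonicalConnection_eq (h : IsLeviCivita η nab) (hK : IsParaKahler K η)
    {X : VField E D} (hX : IsSmoothVF X) (x : D) :
    canonicalConnection K nab.toFun X x = nab X x := by
  have hp := hK.smooth_end.isEigenField hK.sq_eq_one (one_mul 1) hX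
  have hm := hK.smooth_end.isEigenField hK.sq_eq_one (ε := -1) (by norm_num) hX
  set Xp : VField E D := fun x => (1 / 2 : ℝ) • (X x + (1 : ℝ) • K x (X x))
  set Xm : VField E D := fun x => (1 / 2 : ℝ) • (X x + (-1 : ℝ) • K x (X x))
  have hXp : (fun y => projPlus K y (X y)) = Xp := by
    funext y; rw [projPlus_apply]; simp only [Xp, one_smul]
  have hXm : (fun y => projMinus K y (X y)) = Xm := by
    funext y; rw [projMinus_apply]; simp only [Xm, neg_smul, one_smul, sub_eq_add_neg]
  have hsum : X = Xp + Xm := by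
    funext y
    change X y = (1 / 2 : ℝ) • (X y + (1 : ℝ) • K y (X y)) +
      (1 / 2 : ℝ) • (X y + (-1 : ℝ) • K y (X y))
    module
  have hadd : nab X x = nab Xp x + nab Xm x := by
    conv_lhs => rw [hsum]
    exact nab.isCovariantDerivativeOnUniv.add (hp.smooth.mdifferentiableAt x)
      (hm.smooth.mdifferentiableAt x)
  rw [canonicalConnection, hXp, hXm, hadd]
  refine ContinuousLinearMap.ext fun v => ?_
  have e1 := h.nab_eigen hK (Or.inl rfl) hp x v
  have e2 := h.nab_eigen hK (Or.inr rfl) hm x v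
  change projPlus K x (nab Xp x v) + projMinus K x (nab Xm x v) = nab Xp x v + nab Xm x v
  rw [projPlus_apply, projMinus_apply, e1, e2]
  module

theorem IsLeviCivita.dBracket_eq_connBracket (h : IsLeviCivita η nab) (hK : IsParaKahler K η)
    {X Y : VField E D} (hX : IsSmoothVF X) (hY : IsSmoothVF Y) :
    dBracket K η nab.toFun X Y = connBracket η nab.toFun X Y := by
  funext x
  rw [dBracket, connBracket, connBracket, h.canonicalConnection_eq hK hX,
    h.canonicalConnection_eq hK hY]

theorem isWeaklyIntegrable_congr {br br' : VField E D → VField E D → VField E D}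
    (h : ∀ X Y, IsSmoothVF X → IsSmoothVF Y → br X Y = br' X Y) (L : Distribution E D) :
    IsWeaklyIntegrable η br L ↔ IsWeaklyIntegrable η br' L :=
  and_congr_right fun _ => forall_congr' fun X => forall_congr' fun Y => forall_congr' fun hX =>
    forall_congr' fun hY => by rw [h X Y hX.1 hY.1]

/-- Compatibility with a para-Kähler structure is weak integrability for the bracket of the
Levi-Civita connection. -/
theorem IsLeviCivita.isCompatibleWith_iff (h : IsLeviCivita η nab) (hK : IsParaKahler K η)
    (K' : EndField E D) : IsCompatibleWith K' K η nab.toFun ↔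
      EigenbundlesWeaklyIntegrable K' η (connBracket η nab.toFun) :=
  and_congr (isWeaklyIntegrable_congr (fun _ _ hX hY => h.dBracket_eq_connBracket hK hX hY) _)
    (isWeaklyIntegrable_congr (fun _ _ hX hY => h.dBracket_eq_connBracket hK hX hY) _)

end ParaKahlerGroup

namespace Polarization

variable {E : Type*} [NormedAddCommGroup E] [NormedSpace ℝ E] [FiniteDimensional ℝ E]
  {D : Type*} [TopologicalSpace D] [ChartedSpace E D] [Group D] [LieGroup 𝓘(ℝ, E) ∞ D]
  {d : ℕ} (P : Polarization E D d)

/-- The vector dual to a trilinear form with respect to the duality pairing. -/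
theorem exists_bilin_of_isTrilinear {t : E → E → E → ℝ} (ht : IsTrilinear t) :
    ∃ Γ : E →L[ℝ] E →L[ℝ] E, ∀ u v w, P.η₀ (Γ u v) w = t u v w := by
  let φ : E →ₗ[ℝ] E →ₗ[ℝ] E := LinearMap.mk₂ ℝ
    (fun u v => ∑ m, (t u v (P.b (Sum.inr m)) • P.b (Sum.inl m)
      + t u v (P.b (Sum.inl m)) • P.b (Sum.inr m)))
    (fun u u' v => by
      simp only [ht.add₁, ← Finset.sum_add_distrib]
      exact Finset.sum_congr rfl fun m _ => by module)
    (fun a u v => by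
      simp only [ht.smul₁, Finset.smul_sum]
      exact Finset.sum_congr rfl fun m _ => by module)
    (fun u v v' => by
      simp only [ht.add₂, ← Finset.sum_add_distrib]
      exact Finset.sum_congr rfl fun m _ => by module)
    (fun a u v => by
      simp only [ht.smul₂, Finset.smul_sum]
      exact Finset.sum_congr rfl fun m _ => by module)
  refine ⟨LinearMap.toContinuousLinearMap
    ((LinearMap.toContinuousLinearMap (𝕜 := ℝ) (E := E) (F' := E)).toLinearMap.comp φ), ?_⟩
  intro u v w
  let ψ : E →ₗ[ℝ] ℝ :=
    { toFun := fun w => t u v w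
      map_add' := ht.add₃ u v
      map_smul' := fun a w => ht.smul₃ a u v w }
  have h : (P.η₀ (φ u v)).toLinearMap = ψ := by
    refine P.b.ext fun A => ?_
    change P.η₀ (∑ m, (t u v (P.b (Sum.inr m)) • P.b (Sum.inl m)
      + t u v (P.b (Sum.inl m)) • P.b (Sum.inr m))) (P.b A) = t u v (P.b A)
    rcases A with m | m <;> simp [co_b]
  exact LinearMap.congr_fun h w

/-- The Levi-Civita connection exists: in the left trivialization it is given by the Koszul formula
for left-invariant vector fields. -/
theorem exists_isLeviCivita : ∃ nab, IsLeviCivita P.η nab := by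
  have ht : IsTrilinear fun u v w : E => (1 / 2) * (P.η₀ (lieB E D u v) w
      - P.η₀ (lieB E D u w) v - P.η₀ (lieB E D v w) u) := by
    have h := isTrilinear_bilin_comp P.η₀ (lieB E D)
    exact ((h.sub h.swap₂₃).sub h.rotate).const_mul _
  obtain ⟨Γ, hΓ⟩ := P.exists_bilin_of_isTrilinear ht
  have torsion (u v : E) : Γ u v - Γ v u = lieB E D u v := by
    refine sub_eq_zero.1 (P.η₀_nondeg fun A => ?_)
    simp only [map_sub, sub_apply, hΓ]
    rw [lieB_swap D v u]
    simp only [map_neg, neg_apply]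
    ring
  have metric (u v w : E) : P.η₀ (Γ u v) w + P.η₀ v (Γ u w) = 0 := by
    rw [P.η₀_symm v, hΓ, hΓ, lieB_swap D w v]
    simp only [map_neg, neg_apply]
    ring
  -- `∇_u Y` in the left trivialization
  let A : VField E D → D → E → E := fun Y x u =>
    mder E E (leftTriv Y) x u + Γ (mcForm E x u) (leftTriv Y x)
  let cov : VField E D → EndField E D := fun Y x =>
    ((leftTr E x).comp (mder E E (leftTriv Y) x + (Γ.flip (leftTriv Y x)).comp (mcForm E x)) :
      E →L[ℝ] E)
  have hcov (Y : VField E D) (x : D) (u : E) : cov Y x u = leftTr E x (A Y x u) := rfl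
  let nab : CovariantDerivative 𝓘(ℝ, E) E (TangentSpace 𝓘(ℝ, E) : D → Type _) :=
    { toFun := cov
      isCovariantDerivativeOnUniv :=
        { add := by
            intro σ σ' x hσ hσ' _
            have h0 (u : E) : A (σ + σ') x u = A σ x u + A σ' x u := by
              have h1 : mder E E (leftTriv (σ + σ' : VField E D)) x u =
                  mder E E (leftTriv σ) x u + mder E E (leftTriv σ') x u := by
                rw [leftTriv_add, mder_add (mdifferentiableAt_leftTriv hσ)
                  (mdifferentiableAt_leftTriv hσ')]
                rfl
              have h2 : leftTriv (σ + σ' : VField E D) x = leftTriv σ x + leftTriv σ' x := by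
                rw [leftTriv_add]
              have h3 := (Γ (mcForm E x u)).map_add (leftTriv σ x) (leftTriv σ' x)
              exact (congrArg₂ (· + ·) h1 ((congrArg _ h2).trans h3)).trans
                (add_add_add_comm _ _ _ _)
            exact ContinuousLinearMap.ext fun u =>
              (congrArg (leftTr E x) (h0 u)).trans (map_add (leftTr E x) _ _)
          leibniz := by
            intro σ g x hσ hg _
            have h0 (u : E) : A (g • σ) x u = g x • A σ x u + mder E ℝ g x u • leftTriv σ x := by
              have h1 : mder E E (leftTriv (g • σ : VField E D)) x u =
                  g x • mder E E (leftTriv σ) x u + mder E ℝ g x u • leftTriv σ x := by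
                rw [leftTriv_smul, mder_smul hg (mdifferentiableAt_leftTriv hσ)]
              have h2 : leftTriv (g • σ : VField E D) x = g x • leftTriv σ x := by
                rw [leftTriv_smul]
              have h3 := (Γ (mcForm E x u)).map_smul (g x) (leftTriv σ x)
              refine (congrArg₂ (· + ·) h1 ((congrArg _ h2).trans h3)).trans ?_
              rw [smul_add]
              exact add_right_comm _ _ _
            refine ContinuousLinearMap.ext fun u => (congrArg (leftTr E x) (h0 u)).trans ?_
            refine (map_add (leftTr E x) _ _).trans (congrArg₂ (· + ·) (map_smul _ _ _) ?_)
            refine (map_smul (leftTr E x) _ _).trans ?_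
            exact congrArg (mder E ℝ g x u • ·) (leftTr_mcForm (E := E) x (σ x)) } }
  have hη (x : D) (Y : VField E D) (u v : E) :
      P.η x (nab Y x u) v = P.η₀ (A Y x u) (mcForm E x v) := by
    refine (P.η_apply x _ v).trans ?_
    exact congrArg (fun w => P.η₀ w (mcForm E x v)) (mcForm_leftTr x (A Y x u))
  refine ⟨nab, ⟨fun X Y hX hY x => ?_, fun X Y Z hX hY hZ x => ?_⟩⟩
  · refine mcForm_injective (E := E) x ?_
    have h1 (a b : E) : mcForm E x (leftTr E x a - leftTr E x b) = a - b := by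
      rw [← map_sub, mcForm_leftTr]
    refine (h1 (A Y x (X x)) (A X x (Y x))).trans
      (Eq.trans ?_ (leftTriv_mlieBracket hX hY x).symm)
    rw [← torsion]
    exact add_sub_add_comm _ _ _ _
  · have h1 := dirDeriv_leftBilin P.η₀ X hY hZ x
    rw [η_eq, h1, ← η_eq]
    refine Eq.trans ?_ (congrArg₂ (· + ·) (hη x Y (X x) (Z x)) ((P.η_symm x _ _).trans
      (hη x Z (X x) (Y x)))).symm
    have h2 := metric (leftTriv X x) (leftTriv Y x) (leftTriv Z x)
    have h3 (a b c d y z : E) (h : P.η₀ b z + P.η₀ y d = 0) :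
        P.η₀ a z + P.η₀ y c = P.η₀ (a + b) z + P.η₀ (c + d) y := by
      rw [P.η₀_symm (c + d)]
      simp only [map_add, add_apply]
      linarith
    exact h3 _ _ _ _ _ _ h2

end Polarization

/-! ### Brackets of the frame and weak integrability -/

namespace Polarization

variable {E : Type*} [NormedAddCommGroup E] [NormedSpace ℝ E] [FiniteDimensional ℝ E]
  {D : Type*} [TopologicalSpace D] [ChartedSpace E D] [Group D] [LieGroup 𝓘(ℝ, E) ∞ D]
  {d : ℕ} (P : Polarization E D d)
  {nab : CovariantDerivative 𝓘(ℝ, E) E (TangentSpace 𝓘(ℝ, E) : D → Type _)}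

theorem Z_swap (m : Fin d) : P.swap.Z m = P.Z' m := by
  funext x; exact congrArg (leftTr E x) (P.b_swap _)

theorem Z'_swap (m : Fin d) : P.swap.Z' m = P.Z m := by
  funext x; exact congrArg (leftTr E x) (P.b_swap _)

theorem K_swap_eq : P.swap.K = fun x => - P.K x := by
  funext x
  exact ContinuousLinearMap.ext fun u => P.K_swap x u

theorem isLeviCivita_swap (h : IsLeviCivita P.η nab) : IsLeviCivita P.swap.η nab := by
  rwa [η_swap]

theorem dBracket_swap (nab : VField E D → EndField E D) :
    dBracket P.swap.K P.swap.η nab = dBracket P.K P.η nab := by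
  rw [K_swap_eq, η_swap, dBracket_neg]

/-- Linear combinations of left-invariant fields with constant coefficients. -/
theorem sum_smul_leftVF {ι : Type*} (s : Finset ι) (c : ι → ℝ) (v : ι → E) (x : D) :
    ∑ i ∈ s, c i • (leftVF (v i) x : E) = leftTr E x (∑ i ∈ s, c i • v i) := by
  rw [map_sum]
  exact Finset.sum_congr rfl fun i _ => (map_smul (leftTr E x) _ _).symm

theorem dBracket_Z (h : IsLeviCivita P.η nab) (m n : Fin d) :
    dBracket P.K P.η nab.toFun (P.Z m) (P.Z n) = fun x => ∑ k, P.f m n k • P.Z k x := by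
  funext x
  rw [h.dBracket_eq P.isAlmostParaHermitian (P.isSectionOf_Z m) (P.isSectionOf_Z n)]
  refine Eq.trans ?_ (sum_smul_leftVF Finset.univ (P.f m n) (fun k => P.b (Sum.inl k)) x).symm
  refine mcForm_injective (E := E) x ((?_ : _ = (1 / 2 : ℝ) • (lieB E D (P.b (Sum.inl m))
    (P.b (Sum.inl n)) + P.K₀ (lieB E D (P.b (Sum.inl m)) (P.b (Sum.inl n))))).trans ?_)
  · have h1 := leftTriv_mlieBracket_leftVF (P.b (Sum.inl m)) (P.b (Sum.inl n)) x
    rw [← h1]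
    have h2 (u : E) : mcForm E x ((1 / 2 : ℝ) • (u + leftTr E x (P.K₀ (mcForm E x u)))) =
        (1 / 2 : ℝ) • (mcForm E x u + P.K₀ (mcForm E x u)) := by
      rw [map_smul, map_add, mcForm_leftTr]
    refine Eq.trans ?_ (h2 _)
    refine congrArg (mcForm E x) ?_
    rw [projPlus_apply, K_eq]
    rfl
  · rw [mcForm_leftTr, lieB_inl_inl]
    simp only [map_add, map_sum, map_smul, K₀_inl, K₀_inr, smul_neg, Finset.sum_neg_distrib]
    module

theorem dBracket_Z' (h : IsLeviCivita P.η nab) (m n : Fin d) :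
    dBracket P.K P.η nab.toFun (P.Z' m) (P.Z' n) = fun x => ∑ k, P.Q m n k • P.Z' k x := by
  have h1 := P.swap.dBracket_Z (P.isLeviCivita_swap h) m n
  simp only [Z_swap, dBracket_swap] at h1
  exact h1

/-- The antisymmetrization of an array that is antisymmetric in its first two indices. -/
theorem antisymm_eq {A : Fin d → Fin d → Fin d → ℝ} (hA : ∀ m n k, A m n k = - A n m k)
    (m n k : Fin d) : antisymm A m n k = (1 / 3) * (A m n k + A n k m + A k m n) := by
  rw [antisymm, hA n m k, hA m k n, hA k n m]
  ring

/-- The cyclic sum of `η₀ ⁅u, v⁆ w`. On basis vectors it is three times an entry of `f`, `Q` or of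
the antisymmetrization of `H`, `R`, up to sign; half of this gives the factor `3 / 2` in the bracket
of the Levi-Civita connection. -/
def cyc (u v w : E) : ℝ :=
  P.η₀ (lieB E D u v) w + P.η₀ (lieB E D v w) u + P.η₀ (lieB E D w u) v

theorem isTrilinear_cyc : IsTrilinear P.cyc := by
  have h := isTrilinear_bilin_comp P.η₀ (lieB E D)
  exact (h.add h.rotate).add h.rotate.rotate

theorem cyc_lll (m n k : Fin d) : P.cyc (P.b (Sum.inl m)) (P.b (Sum.inl n)) (P.b (Sum.inl k)) =
    3 * antisymm P.H m n k := by
  rw [antisymm_eq P.H_swap]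
  simp only [cyc, η₀_inl_right, co_inr_lll]
  ring

theorem cyc_llr (m n k : Fin d) : P.cyc (P.b (Sum.inl m)) (P.b (Sum.inl n)) (P.b (Sum.inr k)) =
    3 * P.f m n k := by
  simp only [cyc, η₀_inl_right, η₀_inr_right, co_inl_lll, co_inr_llr, co_inr_lrl]
  rw [P.f_swap n m k]
  ring

/-- The bracket of the Levi-Civita connection on left-invariant vector fields. -/
theorem two_mul_η₀_connBracket_leftVF (h : IsLeviCivita P.η nab) (u v w : E) (x : D) :
    2 * P.η₀ (leftTriv (connBracket P.η nab.toFun (leftVF u) (leftVF v)) x) w = P.cyc u v w := by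
  have hc (u v : E) (y : D) : P.η y (leftVF u y) (leftVF v y) = P.η₀ u v := by
    refine (P.η_apply y _ _).trans ?_
    exact congrArg₂ (fun a b => P.η₀ a b) (mcForm_leftTr y u) (mcForm_leftTr y v)
  have key := h.two_mul_connBracket P.η_symm P.η_nondeg (isSmoothVF_leftVF u) (isSmoothVF_leftVF v)
    (isSmoothVF_leftVF w) (hc u v) (hc w v) (hc w u) x
  have h1 (A : VField E D) (w : E) : P.η x (A x) (leftVF w x) = P.η₀ (leftTriv A x) w := by
    refine (P.η_apply x _ _).trans ?_
    exact congrArg (P.η₀ (leftTriv A x)) (mcForm_leftTr x w)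
  have h2 (u v w : E) : P.η x (mlieBracket 𝓘(ℝ, E) (leftVF u) (leftVF v) x) (leftVF w x) =
      P.η₀ (lieB E D u v) w := by
    refine (h1 _ w).trans ?_
    exact congrArg (fun a => P.η₀ a w) (leftTriv_mlieBracket_leftVF u v x)
  rw [h2, h2, h2] at key
  exact (congrArg (2 * ·) (h1 _ w)).symm.trans key

theorem connBracket_Z (h : IsLeviCivita P.η nab) (m n : Fin d) :
    connBracket P.η nab.toFun (P.Z m) (P.Z n) =
      fun x => ∑ k, ((3 / 2) * P.f m n k) • P.Z k x
        + ∑ k, ((3 / 2) * antisymm P.H m n k) • P.Z' k x := by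
  funext x
  refine Eq.trans ?_ (congrArg₂ (· + ·)
    (sum_smul_leftVF Finset.univ (fun k => (3 / 2) * P.f m n k) (fun k => P.b (Sum.inl k)) x)
    (sum_smul_leftVF Finset.univ (fun k => (3 / 2) * antisymm P.H m n k)
      (fun k => P.b (Sum.inr k)) x)).symm
  refine mcForm_injective (E := E) x (Eq.trans ?_
    ((map_add (mcForm E x) _ _).trans
      (congrArg₂ (· + ·) (mcForm_leftTr x _) (mcForm_leftTr x _))).symm)
  refine sub_eq_zero.1 (P.η₀_nondeg fun A => ?_)
  have h1 := P.two_mul_η₀_connBracket_leftVF h (P.b (Sum.inl m)) (P.b (Sum.inl n)) (P.b A) x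
  rw [map_sub, sub_apply]
  refine sub_eq_zero.2 (Eq.trans (b := (1 / 2) * P.cyc (P.b (Sum.inl m)) (P.b (Sum.inl n)) (P.b A))
    ?_ ?_)
  · rw [← h1, ← mul_assoc, one_div, inv_mul_cancel₀ two_ne_zero, one_mul]
    rfl
  · rcases A with k | k
    · rw [cyc_lll]
      simp [co_b]
      ring
    · rw [cyc_llr]
      simp [co_b]
      ring

theorem connBracket_Z' (h : IsLeviCivita P.η nab) (m n : Fin d) :
    connBracket P.η nab.toFun (P.Z' m) (P.Z' n) =
      fun x => ∑ k, ((3 / 2) * P.Q m n k) • P.Z' k x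
        + ∑ k, ((3 / 2) * antisymm P.R m n k) • P.Z k x := by
  have h1 := P.swap.connBracket_Z (P.isLeviCivita_swap h) m n
  simp only [Z_swap, Z'_swap, η_swap] at h1
  exact h1

theorem η₀_eq_zero_of_co_inr {u v : E} (hu : ∀ m, P.co (Sum.inr m) u = 0)
    (hv : ∀ m, P.co (Sum.inr m) v = 0) : P.η₀ u v = 0 := by
  rw [η₀_apply]
  simp [hu, hv]

theorem isotropic_Lplus {x : D} {u v : TangentSpace 𝓘(ℝ, E) x} (hu : u ∈ Lplus P.K x)
    (hv : v ∈ Lplus P.K x) : P.η x u v = 0 :=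
  (P.η_apply x u v).trans
    (P.η₀_eq_zero_of_co_inr ((P.mem_Lplus x u).1 hu) ((P.mem_Lplus x v).1 hv))

/-- On sections of `L₊` the form `η([X, Y], W)` is tensorial. -/
theorem η_mlieBracket_of_isSectionOf {X Y W : VField E D} (hX : IsSectionOf (Lplus P.K) X)
    (hY : IsSectionOf (Lplus P.K) Y) (hW : IsSectionOf (Lplus P.K) W) (x : D) :
    P.η x (mlieBracket 𝓘(ℝ, E) X Y x) (W x) =
      P.η₀ (lieB E D (leftTriv X x) (leftTriv Y x)) (leftTriv W x) := by
  refine (P.η_apply x _ _).trans ((congrArg (fun a => P.η₀ a (leftTriv W x))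
    (leftTriv_mlieBracket hX.1 hY.1 x)).trans ?_)
  have h2 (a b c : E) (ha : P.η₀ a (leftTriv W x) = 0) (hb : P.η₀ b (leftTriv W x) = 0) :
      P.η₀ (a - b + c) (leftTriv W x) = P.η₀ c (leftTriv W x) := by
    simp [ha, hb]
  exact h2 _ _ _
    (P.η₀_eq_zero_of_co_inr (P.co_inr_mder hY x _) ((P.mem_Lplus x _).1 (hW.2 x)))
    (P.η₀_eq_zero_of_co_inr (P.co_inr_mder hX x _) ((P.mem_Lplus x _).1 (hW.2 x)))

/-- For sections `X`, `Y`, `W` of the isotropic bundle `L₊` the scalar product of the bracket of `X`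
and `Y` with `W` is half the cyclic sum of `η([X, Y], W)`. This is a trilinear form on `L₊`, with
components `3 / 2` times the antisymmetrization of `H`. -/
theorem isWeaklyIntegrable_Lplus_iff (h : IsLeviCivita P.η nab) :
    IsWeaklyIntegrable P.η (connBracket P.η nab.toFun) (Lplus P.K) ↔ antisymm P.H = 0 := by
  constructor
  · rintro ⟨-, hI⟩
    funext m n k
    have h1 := (P.mem_Lplus 1 _).1 (hI _ _ (P.isSectionOf_Z m) (P.isSectionOf_Z n) 1) k
    have h2 := P.two_mul_η₀_connBracket_leftVF h (P.b (Sum.inl m)) (P.b (Sum.inl n))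
      (P.b (Sum.inl k)) 1
    rw [cyc_lll, η₀_inl_right] at h2
    have h3 : P.co (Sum.inr k) (leftTriv (connBracket P.η nab.toFun (leftVF (P.b (Sum.inl m)))
      (leftVF (P.b (Sum.inl n)))) (1 : D)) = 0 := h1
    rw [h3] at h2
    change antisymm P.H m n k = 0
    linarith
  · intro hH
    refine ⟨fun x u hu v hv => P.isotropic_Lplus hu hv, fun X Y hX hY x =>
      (P.mem_Lplus x _).2 fun k => ?_⟩
    have hW := P.isSectionOf_Z k
    have key := h.two_mul_connBracket P.η_symm P.η_nondeg hX.1 hY.1 hW.1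
      (fun y => P.isotropic_Lplus (hX.2 y) (hY.2 y)) (fun y => P.isotropic_Lplus (hW.2 y) (hY.2 y))
      (fun y => P.isotropic_Lplus (hW.2 y) (hX.2 y)) x
    rw [P.η_mlieBracket_of_isSectionOf hX hY hW, P.η_mlieBracket_of_isSectionOf hY hW hX,
      P.η_mlieBracket_of_isSectionOf hW hX hY] at key
    have h0 : P.cyc (leftTriv X x) (leftTriv Y x) (leftTriv (P.Z k) x) = 0 :=
      P.trilinear_eq_of_inl P.isTrilinear_cyc IsTrilinear.zero
        (fun m n k => by rw [cyc_lll, hH]; simp) ((P.mem_Lplus x _).1 (hX.2 x))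
        ((P.mem_Lplus x _).1 (hY.2 x)) ((P.mem_Lplus x _).1 (hW.2 x))
    have h1 : P.η x (connBracket P.η nab.toFun X Y x) (P.Z k x) = 0 := by
      have := key.trans h0
      linarith
    have h2 : P.η₀ (mcForm E x (connBracket P.η nab.toFun X Y x)) (mcForm E x (P.Z k x)) = 0 :=
      (P.η_apply x _ _).symm.trans h1
    have h3 : mcForm E x (P.Z k x) = P.b (Sum.inl k) := mcForm_leftTr x _
    rwa [h3, η₀_inl_right] at h2

theorem isWeaklyIntegrable_Lminus_iff (h : IsLeviCivita P.η nab) :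
    IsWeaklyIntegrable P.η (connBracket P.η nab.toFun) (Lminus P.K) ↔ antisymm P.R = 0 := by
  have h1 := P.swap.isWeaklyIntegrable_Lplus_iff (P.isLeviCivita_swap h)
  rwa [η_swap, ← Lminus_eq] at h1

theorem isAdInvariant_iff : P.IsAdInvariant ↔
    ∀ u v w : E, P.η₀ (lieB E D u v) w = P.η₀ u (lieB E D v w) := by
  have h (u v : E) : P.η 1 u v = P.η₀ u v := by
    refine (P.η_apply (1 : D) u v).trans ?_
    rw [mcForm_one, mcForm_one]
  refine forall_congr' fun u => forall_congr' fun v => forall_congr' fun w => ?_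
  exact Iff.of_eq (congrArg₂ (· = ·) (h (lieB E D u v) w) (h u (lieB E D v w)))

theorem isAdInvariant_swap : P.swap.IsAdInvariant ↔ P.IsAdInvariant := by
  rw [isAdInvariant_iff, isAdInvariant_iff, η₀_swap]

/-- For an ad-invariant pairing `H` is totally antisymmetric. -/
theorem antisymm_H_of_isAdInvariant (h : P.IsAdInvariant) : antisymm P.H = P.H := by
  have hcyc (m n k : Fin d) : P.H m n k = P.H n k m := by
    have := P.isAdInvariant_iff.1 h (P.b (Sum.inl m)) (P.b (Sum.inl n)) (P.b (Sum.inl k))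
    simpa using this
  funext m n k
  rw [antisymm_eq P.H_swap, ← hcyc n k m, ← hcyc m n k]
  ring

theorem antisymm_R_of_isAdInvariant (h : P.IsAdInvariant) : antisymm P.R = P.R :=
  P.swap.antisymm_H_of_isAdInvariant (P.isAdInvariant_swap.2 h)

theorem isCompatibleWith_iff (h : IsLeviCivita P.η nab) {K₀ : EndField E D}
    (hK : IsParaKahler K₀ P.η) :
    IsCompatibleWith P.K K₀ P.η nab.toFun ↔ antisymm P.H = 0 ∧ antisymm P.R = 0 :=
  (h.isCompatibleWith_iff hK P.K).trans
    (and_congr (P.isWeaklyIntegrable_Lplus_iff h) (P.isWeaklyIntegrable_Lminus_iff h))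

/-! ### Manin triple polarizations -/

theorem isAdInvariant_of_isManinTriple (h : P.IsManinTriple) : P.IsAdInvariant := by
  rw [isAdInvariant_iff]
  have ht := isTrilinear_bilin_comp P.η₀ (lieB E D)
  have key := P.trilinear_eq_of_basis ht ht.rotate ?_
  · intro u v w
    rw [P.η₀_symm u]
    exact key u v w
  · intro A B C
    rcases A with a | a <;> rcases B with b | b <;> rcases C with c | c <;>
      simp only [η₀_inl_right, η₀_inr_right, co_inl_lll, co_inr_lll, co_inl_llr, co_inr_llr,
        co_inl_lrl, co_inr_lrl, co_inl_lrr, co_inr_lrr, h.1, h.2, Pi.zero_apply]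
    · exact P.f_swap c a b
    · exact (P.Q_swap b c a).symm
    · exact (P.f_swap b c a).symm
    · exact P.Q_swap c a b

theorem isParaHermitian_of_isManinTriple (h : P.IsManinTriple) : IsParaHermitian P.K P.η :=
  { P.isAlmostParaHermitian with
    involutive_plus := P.isInvolutive_Lplus_iff.2 h.1
    involutive_minus := P.isInvolutive_Lminus_iff.2 h.2 }

theorem antisymm_zero : antisymm (0 : Fin d → Fin d → Fin d → ℝ) = 0 := by
  funext m n k; simp [antisymm]

/-- The wedge product is invariant under cyclic permutations. -/
theorem wedge₃_rotate {V : Type*} (α β γ : V → ℝ) (u v w : V) :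
    wedge₃ α β γ u v w = wedge₃ γ α β u v w := by
  simp only [wedge₃, Matrix.det_fin_three]
  simp
  ring

theorem extDeriv₂_Ω_of_isManinTriple (h : P.IsManinTriple) {X Y W : VField E D}
    (hX : IsSmoothVF X) (hY : IsSmoothVF Y) (hW : IsSmoothVF W) (x : D) :
    extDeriv₂ P.Ω X Y W x = (1 / 2) * ∑ m, ∑ n, ∑ p,
      (P.f m n p * wedge₃ (P.Θ' p x) (P.Θ m x) (P.Θ n x) (X x) (Y x) (W x)
        - P.Q m n p * wedge₃ (P.Θ p x) (P.Θ' m x) (P.Θ' n x) (X x) (Y x) (W x)) := by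
  rw [P.extDeriv₂_Ω hX hY hW]
  refine congrArg _ (Finset.sum_congr rfl fun m _ => Finset.sum_congr rfl fun n _ =>
    Finset.sum_congr rfl fun p _ => ?_)
  rw [h.1, h.2, wedge₃_rotate (P.Θ m x) (P.Θ n x) (P.Θ' p x),
    wedge₃_rotate (P.Θ' m x) (P.Θ' n x) (P.Θ p x)]
  simp

theorem connBracket_Z_of_isManinTriple (hM : P.IsManinTriple)
    (h : IsLeviCivita P.η nab) (m n : Fin d) :
    connBracket P.η nab.toFun (P.Z m) (P.Z n) = fun x => ∑ k, ((3 / 2) * P.f m n k) • P.Z k x := by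
  rw [P.connBracket_Z h, hM.1, antisymm_zero]
  simp

theorem connBracket_Z'_of_isManinTriple (hM : P.IsManinTriple)
    (h : IsLeviCivita P.η nab) (m n : Fin d) :
    connBracket P.η nab.toFun (P.Z' m) (P.Z' n) =
      fun x => ∑ k, ((3 / 2) * P.Q m n k) • P.Z' k x := by
  rw [P.connBracket_Z' h, hM.2, antisymm_zero]
  simp

theorem isParaKahler_iff (h : P.IsManinTriple) : IsParaKahler P.K P.η ↔ P.f = 0 ∧ P.Q = 0 := by
  constructor
  · intro hK
    have key (A B C) := hK.closed (leftVF (P.b A)) (leftVF (P.b B)) (leftVF (P.b C))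
      (isSmoothVF_leftVF _) (isSmoothVF_leftVF _) (isSmoothVF_leftVF _) 1
    have key2 (A B C) : - P.η₀ (P.K₀ (lieB E D (P.b A) (P.b B))) (P.b C)
        + P.η₀ (P.K₀ (lieB E D (P.b A) (P.b C))) (P.b B)
        - P.η₀ (P.K₀ (lieB E D (P.b B) (P.b C))) (P.b A) = 0 := by
      have h1 := extDeriv₂_leftBilin (P.η₀.comp P.K₀) P.Ω₀_skew (isSmoothVF_leftVF (D := D) (P.b A))
        (isSmoothVF_leftVF (P.b B)) (isSmoothVF_leftVF (P.b C)) 1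
      rw [leftTriv_leftVF, leftTriv_leftVF, leftTriv_leftVF, ← Ω_eq] at h1
      exact h1.symm.trans (key A B C)
    constructor
    · funext m n k
      have := key2 (Sum.inl m) (Sum.inl n) (Sum.inr k)
      simp only [η₀_inl_right, η₀_inr_right, co_inl_K₀, co_inr_K₀, co_inl_lll, co_inr_llr] at this
      change P.f m n k = 0
      linarith [P.f_swap m n k]
    · funext m n k
      have := key2 (Sum.inr m) (Sum.inr n) (Sum.inl k)
      simp only [η₀_inl_right, η₀_inr_right, co_inl_K₀, co_inr_K₀, co_inr_lrr, co_inl_lrl] at this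
      change P.Q m n k = 0
      linarith [P.Q_swap m n k]
  · rintro ⟨hf, hQ⟩
    exact { P.isParaHermitian_of_isManinTriple h with
      closed := fun X Y W hX hY hW x => by
        refine (P.extDeriv₂_Ω_of_isManinTriple h hX hY hW x).trans ?_
        simp [hf, hQ] }

end Polarization

/-! ### The adjoint action and its derivative -/

section Charts

variable {E : Type*} [NormedAddCommGroup E] [NormedSpace ℝ E]
  {M : Type*} [TopologicalSpace M] [ChartedSpace E M] [IsManifold 𝓘(ℝ, E) ∞ M]

theorem extChartAt_target_mem_nhds_of_mem {x : M} {z : E}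
    (hz : z ∈ (extChartAt 𝓘(ℝ, E) x).target) : (extChartAt 𝓘(ℝ, E) x).target ∈ nhds z :=
  (isOpen_extChartAt_target x).mem_nhds hz

theorem contMDiffAt_extChartAt_symm {x : M} {z : E} (hz : z ∈ (extChartAt 𝓘(ℝ, E) x).target) :
    ContMDiffAt 𝓘(ℝ, E) 𝓘(ℝ, E) ∞ (extChartAt 𝓘(ℝ, E) x).symm z :=
  (contMDiffOn_extChartAt_symm x).contMDiffAt (extChartAt_target_mem_nhds_of_mem hz)

theorem contMDiffAt_extChartAt_of_mem {x y : M} (hy : y ∈ (extChartAt 𝓘(ℝ, E) x).source) :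
    ContMDiffAt 𝓘(ℝ, E) 𝓘(ℝ, E) ∞ (extChartAt 𝓘(ℝ, E) x) y :=
  contMDiffAt_extChartAt' (by rwa [extChartAt_source] at hy)

theorem mder_extChartAt_symm_mder {x : M} {z : E} (hz : z ∈ (extChartAt 𝓘(ℝ, E) x).target) (v : E) :
    mder E E (extChartAt 𝓘(ℝ, E) x) ((extChartAt 𝓘(ℝ, E) x).symm z)
      (mder E E (extChartAt 𝓘(ℝ, E) x).symm z v) = v := by
  rw [← mder_comp_apply (g := extChartAt 𝓘(ℝ, E) x) z
    ((contMDiffAt_extChartAt_of_mem ((extChartAt 𝓘(ℝ, E) x).map_target hz)).mdifferentiableAt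
      (by simp)) ((contMDiffAt_extChartAt_symm hz).mdifferentiableAt (by simp))]
  have h : (fun w => extChartAt 𝓘(ℝ, E) x ((extChartAt 𝓘(ℝ, E) x).symm w)) =ᶠ[nhds z] fun w => w :=
    Filter.eventually_of_mem (extChartAt_target_mem_nhds_of_mem hz)
      fun w hw => (extChartAt 𝓘(ℝ, E) x).right_inv hw
  rw [h.mder_eq, mder_id]
  rfl

theorem mder_extChartAt_mder_symm {x y : M} (hy : y ∈ (extChartAt 𝓘(ℝ, E) x).source) (v : E) :
    mder E E (extChartAt 𝓘(ℝ, E) x).symm (extChartAt 𝓘(ℝ, E) x y)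
      (mder E E (extChartAt 𝓘(ℝ, E) x) y v) = v := by
  rw [← mder_comp_apply (g := (extChartAt 𝓘(ℝ, E) x).symm) y
    ((contMDiffAt_extChartAt_symm ((extChartAt 𝓘(ℝ, E) x).map_source hy)).mdifferentiableAt
      (by simp)) ((contMDiffAt_extChartAt_of_mem hy).mdifferentiableAt (by simp))]
  have h : (fun w => (extChartAt 𝓘(ℝ, E) x).symm (extChartAt 𝓘(ℝ, E) x w)) =ᶠ[nhds y] fun w => w :=
    Filter.eventually_of_mem ((isOpen_extChartAt_source x).mem_nhds hy)
      fun w hw => (extChartAt 𝓘(ℝ, E) x).left_inv hw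
  rw [h.mder_eq, mder_id]
  rfl

theorem mpullbackWithin_extChartAt_symm (V : VField E M) {x : M} {z : E}
    (hz : z ∈ (extChartAt 𝓘(ℝ, E) x).target) :
    (mpullbackWithin 𝓘(ℝ, E) 𝓘(ℝ, E) (extChartAt 𝓘(ℝ, E) x).symm V (Set.range 𝓘(ℝ, E)) z : E) =
      mder E E (extChartAt 𝓘(ℝ, E) x) ((extChartAt 𝓘(ℝ, E) x).symm z)
        (V ((extChartAt 𝓘(ℝ, E) x).symm z)) := by
  have hr : Set.range 𝓘(ℝ, E) = Set.univ := Set.range_id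
  rw [hr, mpullbackWithin_apply, mfderivWithin_univ]
  have h : (mder E E (extChartAt 𝓘(ℝ, E) x).symm z).inverse =
      mder E E (extChartAt 𝓘(ℝ, E) x) ((extChartAt 𝓘(ℝ, E) x).symm z) := by
    refine ContinuousLinearMap.inverse_eq ?_ ?_
    · ext v
      have h1 := mder_extChartAt_mder_symm ((extChartAt 𝓘(ℝ, E) x).map_target hz) v
      rwa [(extChartAt 𝓘(ℝ, E) x).right_inv hz] at h1
    · ext v
      exact mder_extChartAt_symm_mder hz v
  exact congrArg (fun φ : E →L[ℝ] E => φ (V ((extChartAt 𝓘(ℝ, E) x).symm z))) h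

end Charts

section Adjoint

variable {E : Type*} [NormedAddCommGroup E] [NormedSpace ℝ E]
  {D : Type*} [TopologicalSpace D] [ChartedSpace E D] [Group D] [LieGroup 𝓘(ℝ, E) ∞ D]

variable (E) in
/-- The adjoint action of `x⁻¹` on the Lie algebra. -/
def adInv (x : D) : E →L[ℝ] E := mder E E (fun y => x⁻¹ * y * x) (1 : D)

/-- The right-invariant vector field with value `v` at the identity. -/
def rightVF (v : E) : VField E D := fun x => mder E E (· * x) (1 : D) v

theorem mdifferentiableAt_conj {x y : D} :
    MDifferentiableAt 𝓘(ℝ, E) 𝓘(ℝ, E) (fun y => x⁻¹ * y * x) y :=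
  (mdifferentiableAt_mul_right' (E := E)).comp y mdifferentiableAt_mul_left'

/-- In the left trivialization right-invariant fields are given by the adjoint action. -/
theorem mcForm_mder_mul_right (x : D) (v : E) :
    mcForm E x (mder E E (· * x) (1 : D) v) = adInv E x v := by
  have h := mder_comp_apply (E := E) (F := E) (W := E) (g := fun z : D => x⁻¹ * z)
    (f := fun z : D => z * x) 1 mdifferentiableAt_mul_left' mdifferentiableAt_mul_right' v
  simp only [← mul_assoc, one_mul] at h
  exact h.symm

theorem leftTriv_rightVF (v : E) : leftTriv (rightVF v : D → E) = fun x => adInv E x v :=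
  funext fun x => mcForm_mder_mul_right x v

theorem adInv_one (v : E) : adInv E (1 : D) v = v := by
  simp [adInv, mder_id]

theorem adInv_mul (x k : D) (v : E) : adInv E (x * k) v = adInv E k (adInv E x v) := by
  have h := mder_comp_apply (E := E) (F := E) (W := E) (g := fun z : D => k⁻¹ * z * k)
    (f := fun z : D => x⁻¹ * z * x) 1 mdifferentiableAt_conj mdifferentiableAt_conj v
  simp only [mul_one, inv_mul_cancel] at h
  refine Eq.trans ?_ h
  simp only [adInv, mul_inv_rev, mul_assoc]

theorem adInv_inv_adInv (x : D) (v : E) : adInv E x⁻¹ (adInv E x v) = v := by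
  rw [← adInv_mul, mul_inv_cancel, adInv_one]

theorem adInv_injective (x : D) : Function.Injective (adInv E x) := fun u v h => by
  rw [← adInv_inv_adInv x u, h, adInv_inv_adInv]

/-- The adjoint action is smooth, as the differential at `1` of a family of maps that fix `1`. -/
theorem contMDiff_adInv : ContMDiff 𝓘(ℝ, E) 𝓘(ℝ, E →L[ℝ] E) ∞ (fun x : D => adInv E x) := by
  intro x₀
  have h := ContMDiffAt.mfderiv (I := 𝓘(ℝ, E)) (I' := 𝓘(ℝ, E)) (J := 𝓘(ℝ, E)) (m := ∞) (n := ∞)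
    (x₀ := x₀) (fun x y : D => x⁻¹ * y * x) (fun _ => 1)
    (by
      have : ContMDiff (𝓘(ℝ, E).prod 𝓘(ℝ, E)) 𝓘(ℝ, E) ∞ (fun p : D × D => p.1⁻¹ * p.2 * p.1) :=
        ((contMDiff_fst.inv).mul contMDiff_snd).mul contMDiff_fst
      exact this.contMDiffAt) contMDiffAt_const (by simp)
  refine h.congr_of_eventuallyEq (Filter.Eventually.of_forall fun x => ?_)
  change _ = (trivAt E (x₀⁻¹ * 1 * x₀) (x⁻¹ * 1 * x)).comp
    ((adInv E x).comp (trivSymmAt E 1 (1 : D)))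
  rw [mul_one, mul_one, inv_mul_cancel, inv_mul_cancel, trivSymmAt_self, trivAt_self]; rfl

theorem contMDiff_adInv_apply (v : E) :
    ContMDiff 𝓘(ℝ, E) 𝓘(ℝ, E) ∞ (fun x : D => adInv E x v) :=
  contMDiff_adInv.clm_apply contMDiff_const

theorem isSmoothVF_rightVF (v : E) : IsSmoothVF (rightVF v : VField E D) := by
  rw [isSmoothVF_iff, leftTriv_rightVF]
  exact contMDiff_adInv_apply v

/-- Left-invariant vector fields commute with right-invariant ones. In the chart at `1` the two
fields are the partial derivatives of the multiplication, and their bracket at `1` vanishes by the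
symmetry of its second derivative. -/
theorem mlieBracket_leftVF_rightVF_one (u v : E) :
    mlieBracket 𝓘(ℝ, E) (leftVF u : VField E D) (rightVF v) 1 = 0 := by
  set φ := extChartAt 𝓘(ℝ, E) (1 : D) with hφ
  set e : E := φ 1 with he
  have h1s : (1 : D) ∈ φ.source := mem_extChartAt_source 1
  have het : e ∈ φ.target := mem_extChartAt_target 1
  have hse : φ.symm e = 1 := φ.left_inv h1s
  set μ : E × E → E := fun p => φ (φ.symm p.1 * φ.symm p.2) with hμ
  have hμ_smooth : ContDiffAt ℝ ∞ μ (e, e) := by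
    rw [← contMDiffAt_iff_contDiffAt]
    have hsymm := contMDiffAt_extChartAt_symm het
    have h1 : ContMDiffAt 𝓘(ℝ, E × E) 𝓘(ℝ, E) ∞
        (fun p : E × E => φ.symm p.1 * φ.symm p.2) (e, e) :=
      ContMDiffAt.mul
        (ContMDiffAt.comp (e, e) (g := φ.symm) hsymm contDiff_fst.contMDiff.contMDiffAt)
        (ContMDiffAt.comp (e, e) (g := φ.symm) hsymm contDiff_snd.contMDiff.contMDiffAt)
    have h2 : ContMDiffAt 𝓘(ℝ, E) 𝓘(ℝ, E) ∞ φ (φ.symm e * φ.symm e) := by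
      rw [hse, mul_one]
      exact contMDiffAt_extChartAt_of_mem h1s
    exact ContMDiffAt.comp (e, e) (g := φ) h2 h1
  -- the representatives of the two fields in the chart
  set a : E := mder E E φ 1 u with ha
  set b : E := mder E E φ 1 v with hb
  -- derivatives of translations, read in the chart
  have hloc (τ : D → D) (x : D) (hx : τ 1 = x) (hxs : x ∈ φ.source)
      (hτ : MDifferentiableAt 𝓘(ℝ, E) 𝓘(ℝ, E) τ 1) (w : E) :
      fderiv ℝ (fun q => φ (τ (φ.symm q))) e (mder E E φ 1 w) = mder E E φ x (mder E E τ 1 w) := by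
    subst hx
    have hsymm : MDifferentiableAt 𝓘(ℝ, E) 𝓘(ℝ, E) φ.symm e :=
      (contMDiffAt_extChartAt_symm het).mdifferentiableAt (by simp)
    have hτ' : MDifferentiableAt 𝓘(ℝ, E) 𝓘(ℝ, E) τ (φ.symm e) := by rwa [hse]
    have hcomp : MDifferentiableAt 𝓘(ℝ, E) 𝓘(ℝ, E) (fun q => τ (φ.symm q)) e :=
      MDifferentiableAt.comp e hτ' hsymm
    have hφ' : MDifferentiableAt 𝓘(ℝ, E) 𝓘(ℝ, E) φ (τ (φ.symm e)) := by
      rw [hse]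
      exact (contMDiffAt_extChartAt_of_mem hxs).mdifferentiableAt (by simp)
    rw [← mder_eq_fderiv, mder_comp_apply (g := φ) e hφ' hcomp,
      mder_comp_apply (g := τ) e hτ' hsymm, mder_extChartAt_mder_symm h1s, hse]
  have hev : ∀ᶠ z in nhds e, z ∈ φ.target ∧ DifferentiableAt ℝ μ (z, e) ∧
      DifferentiableAt ℝ μ (e, z) := by
    have hd : ∀ᶠ p in nhds (e, e), DifferentiableAt ℝ μ p :=
      (hμ_smooth.of_le (m := 1) (by simp)).eventually (by simp) |>.mono
        fun p hp => hp.differentiableAt (by simp)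
    have c1 : ContinuousAt (fun z : E => (z, e)) e := by fun_prop
    have c2 : ContinuousAt (fun z : E => (e, z)) e := by fun_prop
    filter_upwards [extChartAt_target_mem_nhds_of_mem het, c1.eventually hd, c2.eventually hd]
      with z h1 h2 h3 using ⟨h1, h2, h3⟩
  set X := mpullbackWithin 𝓘(ℝ, E) 𝓘(ℝ, E) φ.symm (leftVF u : VField E D)
    (Set.range 𝓘(ℝ, E)) with hX
  set Y := mpullbackWithin 𝓘(ℝ, E) 𝓘(ℝ, E) φ.symm (rightVF v : VField E D)
    (Set.range 𝓘(ℝ, E)) with hY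
  -- the left-invariant field is the partial derivative of `μ` in the second argument
  have hXe : (X : E → E) =ᶠ[nhds e] fun z => fderiv ℝ μ (z, e) (0, a) := by
    filter_upwards [hev] with z hz
    have h1 : X z = mder E E φ (φ.symm z) (leftTr E (φ.symm z) u) :=
      mpullbackWithin_extChartAt_symm (leftVF u : VField E D) hz.1
    have h2 := hloc (fun y => φ.symm z * y) (φ.symm z) (mul_one _) (φ.map_target hz.1)
      mdifferentiableAt_mul_left' u
    rw [h1]
    refine h2.symm.trans ?_
    have h3 : HasFDerivAt (fun q : E => (z, q)) (ContinuousLinearMap.inr ℝ E E) e :=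
      hasFDerivAt_prodMk_right z e
    have h4 := HasFDerivAt.comp e (g := μ) (f := fun q : E => (z, q)) hz.2.1.hasFDerivAt h3
    exact congrArg (fun ψ : E →L[ℝ] E => ψ a) h4.fderiv
  -- the right-invariant field is the partial derivative of `μ` in the first argument
  have hYe : (Y : E → E) =ᶠ[nhds e] fun z => fderiv ℝ μ (e, z) (b, 0) := by
    filter_upwards [hev] with z hz
    have h1 : Y z = mder E E φ (φ.symm z) (mder E E (· * φ.symm z) (1 : D) v) :=
      mpullbackWithin_extChartAt_symm (rightVF v : VField E D) hz.1
    have h2 := hloc (fun y => y * φ.symm z) (φ.symm z) (one_mul _) (φ.map_target hz.1)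
      mdifferentiableAt_mul_right' v
    rw [h1]
    refine h2.symm.trans ?_
    have h3 : HasFDerivAt (fun q : E => (q, z)) (ContinuousLinearMap.inl ℝ E E) e :=
      hasFDerivAt_prodMk_left e z
    have h4 := HasFDerivAt.comp e (g := μ) (f := fun q : E => (q, z)) hz.2.2.hasFDerivAt h3
    exact congrArg (fun ψ : E →L[ℝ] E => ψ b) h4.fderiv
  have hXa : (X e : E) = a := by
    have h1 : X e = mder E E φ (φ.symm e) (leftTr E (φ.symm e) u) :=
      mpullbackWithin_extChartAt_symm (leftVF u : VField E D) het
    rw [h1, hse, leftTr_one]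
  have hYb : (Y e : E) = b := by
    have h1 : Y e = mder E E φ (φ.symm e) (mder E E (· * φ.symm e) (1 : D) v) :=
      mpullbackWithin_extChartAt_symm (rightVF v : VField E D) het
    rw [h1, hse]
    simp only [mul_one, mder_id]
    rfl
  have two_le : (1 + 1 : WithTop ℕ∞) ≤ ∞ := WithTop.coe_le_coe.2 (le_top (a := (1 + 1 : ℕ∞)))
  have hμ2 : DifferentiableAt ℝ (fderiv ℝ μ) (e, e) :=
    (hμ_smooth.fderiv_right (m := 1) two_le).differentiableAt (by simp)
  have hXd (w : E) : fderiv ℝ (X : E → E) e w = fderiv ℝ (fderiv ℝ μ) (e, e) (w, 0) (0, a) := by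
    rw [hXe.fderiv_eq]
    have h3 : HasFDerivAt (fun q : E => (q, e)) (ContinuousLinearMap.inl ℝ E E) e :=
      hasFDerivAt_prodMk_left e e
    have h4 := HasFDerivAt.comp e (g := fderiv ℝ μ) (f := fun q : E => (q, e)) hμ2.hasFDerivAt h3
    have h5 := h4.clm_apply (hasFDerivAt_const ((0, a) : E × E) e)
    rw [show (fun z => fderiv ℝ μ (z, e) (0, a)) =
      fun z => (fderiv ℝ μ ∘ fun q : E => (q, e)) z (0, a) from rfl, h5.fderiv]
    simp
  have hYd (w : E) : fderiv ℝ (Y : E → E) e w = fderiv ℝ (fderiv ℝ μ) (e, e) (0, w) (b, 0) := by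
    rw [hYe.fderiv_eq]
    have h3 : HasFDerivAt (fun q : E => (e, q)) (ContinuousLinearMap.inr ℝ E E) e :=
      hasFDerivAt_prodMk_right e e
    have h4 := HasFDerivAt.comp e (g := fderiv ℝ μ) (f := fun q : E => (e, q)) hμ2.hasFDerivAt h3
    have h5 := h4.clm_apply (hasFDerivAt_const ((b, 0) : E × E) e)
    rw [show (fun z => fderiv ℝ μ (e, z) (b, 0)) =
      fun z => (fderiv ℝ μ ∘ fun q : E => (e, q)) z (b, 0) from rfl, h5.fderiv]
    simp
  have hsymm2 : IsSymmSndFDerivAt ℝ μ (e, e) :=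
    hμ_smooth.isSymmSndFDerivAt (by
      rw [minSmoothness_of_isRCLikeNormedField, ← one_add_one_eq_two]
      exact two_le)
  have hbr : lieBracketWithin ℝ (X : E → E) (Y : E → E)
      (φ.symm ⁻¹' Set.univ ∩ Set.range 𝓘(ℝ, E)) e = 0 := by
    have hset : φ.symm ⁻¹' Set.univ ∩ Set.range 𝓘(ℝ, E) = Set.univ := by
      rw [Set.preimage_univ, Set.univ_inter]
      exact Set.range_id
    rw [hset]
    refine (congrFun (lieBracketWithin_univ (𝕜 := ℝ) (V := (X : E → E))
      (W := (Y : E → E))) e).trans ?_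
    change fderiv ℝ (Y : E → E) e (X e) - fderiv ℝ (X : E → E) e (Y e) = 0
    rw [hXa, hYb, hXd, hYd, hsymm2.eq, sub_self]
  rw [← mlieBracketWithin_univ, mlieBracketWithin_apply]
  exact (congrArg (mfderiv 𝓘(ℝ, E) 𝓘(ℝ, E) φ 1).inverse hbr).trans (map_zero _)

/-- The derivative of the adjoint action is the Lie bracket: in the left trivialization, this is the
vanishing at `1` of the bracket of a left-invariant and a right-invariant vector field. -/
theorem mder_adInv_one [FiniteDimensional ℝ E] (u v : E) :
    mder E E (fun x : D => adInv E x v) 1 u = - lieB E D u v := by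
  have h := leftTriv_mlieBracket (isSmoothVF_leftVF (D := D) u) (isSmoothVF_rightVF v) 1
  have h0 : leftTriv (mlieBracket 𝓘(ℝ, E) (leftVF u : VField E D) (rightVF v)) 1 = 0 :=
    (congrArg (mcForm E 1) (mlieBracket_leftVF_rightVF_one u v)).trans (map_zero _)
  have key (a b : D → E) (ha : a = fun x => adInv E x v) (hb : b = fun _ => u) (s t : E)
      (hs : s = u) : mder E E a 1 s - mder E E b 1 t + lieB E D (b 1) (a 1) =
        mder E E (fun x : D => adInv E x v) 1 u + lieB E D u v := by
    subst ha hb hs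
    simp [mder_const, adInv_one]
  exact eq_neg_of_add_eq_zero_left ((key _ _ (leftTriv_rightVF v) (leftTriv_leftVF u) _ _
    (leftTr_one (D := D) u)).symm.trans (h.symm.trans h0))

end Adjoint

/-! ### Logarithmic derivatives and abelian subgroups -/

section Constant

variable {E : Type*} [NormedAddCommGroup E] [NormedSpace ℝ E]
  {F : Type*} [NormedAddCommGroup F] [NormedSpace ℝ F]
  {M : Type*} [TopologicalSpace M] [ChartedSpace F M] [IsManifold 𝓘(ℝ, F) ∞ M]
  {N : Type*} [TopologicalSpace N] [ChartedSpace E N] [IsManifold 𝓘(ℝ, E) ∞ N]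

/-- A map between manifolds with vanishing differential near a point is constant near it, by the
mean value theorem on a ball in a chart. -/
theorem eventually_eq_of_mder_eq_zero {f : M → N} {x : M}
    (h : ∀ᶠ y in nhds x, MDifferentiableAt 𝓘(ℝ, F) 𝓘(ℝ, E) f y ∧ mder F E f y = 0) :
    ∀ᶠ y in nhds x, f y = f x := by
  set φ := extChartAt 𝓘(ℝ, F) x
  set ψ := extChartAt 𝓘(ℝ, E) (f x)
  have hxs : x ∈ φ.source := mem_extChartAt_source x
  have hxt : φ x ∈ φ.target := mem_extChartAt_target x
  have hfx : ∀ᶠ y in nhds x, f y ∈ ψ.source :=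
    h.self_of_nhds.1.continuousAt.eventually (extChartAt_source_mem_nhds (f x))
  have hc : Filter.Tendsto φ.symm (nhds (φ x)) (nhds x) := by
    have := (contMDiffAt_extChartAt_symm hxt).continuousAt
    rwa [ContinuousAt, φ.left_inv hxs] at this
  obtain ⟨r, hr, hball⟩ := Metric.eventually_nhds_iff_ball.1
    ((hc.eventually (h.and hfx)).and (extChartAt_target_mem_nhds_of_mem hxt))
  have hg (z : F) (hz : z ∈ Metric.ball (φ x) r) :
      HasFDerivAt (fun z => ψ (f (φ.symm z))) (0 : F →L[ℝ] E) z := by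
    obtain ⟨⟨⟨h1, h2⟩, h3⟩, h4⟩ := hball z hz
    have d1 : MDifferentiableAt 𝓘(ℝ, F) 𝓘(ℝ, F) φ.symm z :=
      (contMDiffAt_extChartAt_symm h4).mdifferentiableAt (by simp)
    have d2 : MDifferentiableAt 𝓘(ℝ, E) 𝓘(ℝ, E) ψ (f (φ.symm z)) :=
      (contMDiffAt_extChartAt_of_mem h3).mdifferentiableAt (by simp)
    have d3 : MDifferentiableAt 𝓘(ℝ, F) 𝓘(ℝ, E) (fun z => f (φ.symm z)) z :=
      MDifferentiableAt.comp z h1 d1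
    have d4 : MDifferentiableAt 𝓘(ℝ, F) 𝓘(ℝ, E) (fun z => ψ (f (φ.symm z))) z :=
      MDifferentiableAt.comp z d2 d3
    have h5 : fderiv ℝ (fun z => ψ (f (φ.symm z))) z = 0 := by
      rw [← mder_eq_fderiv, mder_comp (g := ψ) z d2 d3, mder_comp (g := f) z h1 d1, h2,
        ContinuousLinearMap.zero_comp, ContinuousLinearMap.comp_zero]
    have := (mdifferentiableAt_iff_differentiableAt.1 d4).hasFDerivAt
    rwa [h5] at this
  have hconst (z : F) (hz : z ∈ Metric.ball (φ x) r) : ψ (f (φ.symm z)) = ψ (f x) := by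
    have := (convex_ball (φ x) r).is_const_of_fderivWithin_eq_zero (𝕜 := ℝ)
      (f := fun z => ψ (f (φ.symm z)))
      (fun z hz => (hg z hz).differentiableAt.differentiableWithinAt)
      (fun z hz => (hg z hz).hasFDerivWithinAt.fderivWithin
        (Metric.isOpen_ball.uniqueDiffWithinAt hz)) hz (Metric.mem_ball_self hr)
    rwa [φ.left_inv hxs] at this
  have hφ : ∀ᶠ y in nhds x, φ y ∈ Metric.ball (φ x) r :=
    (contMDiffAt_extChartAt_of_mem hxs).continuousAt.eventually
      (Metric.isOpen_ball.mem_nhds (Metric.mem_ball_self hr))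
  filter_upwards [hφ, hfx, extChartAt_source_mem_nhds (I := 𝓘(ℝ, F)) x] with y h1 h2 h3
  have h4 := hconst _ h1
  rw [φ.left_inv h3] at h4
  exact ψ.injOn h2 (mem_extChartAt_source (f x)) h4

theorem eq_of_mder_eq_zero [PreconnectedSpace M] {f : M → N}
    (hf : ∀ y, MDifferentiableAt 𝓘(ℝ, F) 𝓘(ℝ, E) f y) (h : ∀ y, mder F E f y = 0) (x y : M) :
    f x = f y :=
  ((IsLocallyConstant.iff_eventually_eq f).2 fun _ => eventually_eq_of_mder_eq_zero
    (Filter.Eventually.of_forall fun y => ⟨hf y, h y⟩)).apply_eq_of_preconnectedSpace x y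

end Constant

section LogDerivative

variable {E : Type*} [NormedAddCommGroup E] [NormedSpace ℝ E]
  {F : Type*} [NormedAddCommGroup F] [NormedSpace ℝ F]
  {M : Type*} [TopologicalSpace M] [ChartedSpace F M]
  {D : Type*} [TopologicalSpace D] [ChartedSpace E D] [Group D]

variable (E F) in
/-- The left logarithmic derivative `f⁻¹ df` of a map into a Lie group. -/
def logDer (f : M → D) (x : M) : F →L[ℝ] E := (mcForm E (f x)).comp (mder F E f x)

theorem logDer_apply (f : M → D) (x : M) (v : F) :
    logDer E F f x v = mcForm E (f x) (mder F E f x v) := rfl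

variable [LieGroup 𝓘(ℝ, E) ∞ D]

theorem mder_eq_zero_of_logDer {f : M → D} {x : M} (h : logDer E F f x = 0) : mder F E f x = 0 := by
  ext v
  have h1 : mcForm E (f x) (mder F E f x v) = 0 := congrArg (fun φ : F →L[ℝ] E => φ v) h
  rw [← leftTr_mcForm (E := E) (f x) (mder F E f x v), h1, map_zero]
  rfl

theorem logDer_const_mul (a : D) {f : M → D} {x : M}
    (hf : MDifferentiableAt 𝓘(ℝ, F) 𝓘(ℝ, E) f x) :
    logDer E F (fun y => a * f y) x = logDer E F f x := by
  ext v
  rw [logDer_apply, logDer_apply, mder_comp_apply (g := (a * ·)) x mdifferentiableAt_mul_left' hf,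
    mcForm_mul_left]

theorem mcForm_mder_mul_right_apply (a b : D) (u : E) :
    mcForm E (a * b) (mder E E (· * b) a u) = adInv E b (mcForm E a u) := by
  obtain ⟨w, rfl⟩ : ∃ w, leftTr E a w = u := ⟨_, leftTr_mcForm a u⟩
  have h := mder_comp_apply (E := E) (F := E) (W := E) (g := fun z : D => z * b)
    (f := fun z : D => a * z) 1 mdifferentiableAt_mul_right' mdifferentiableAt_mul_left' w
  have h' := mder_comp_apply (E := E) (F := E) (W := E) (g := fun z : D => a * z)
    (f := fun z : D => z * b) 1 mdifferentiableAt_mul_left' mdifferentiableAt_mul_right' w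
  simp only [mul_assoc, mul_one, one_mul] at h h'
  rw [mcForm_leftTr, ← mcForm_mder_mul_right b w, ← mcForm_mul_left a b]
  exact congrArg (mcForm E (a * b)) (h.symm.trans h')

theorem logDer_mul_const {f : M → D} {x : M} (b : D) (hf : MDifferentiableAt 𝓘(ℝ, F) 𝓘(ℝ, E) f x)
    (v : F) : logDer E F (fun y => f y * b) x v = adInv E b (logDer E F f x v) := by
  rw [logDer_apply, logDer_apply, mder_comp_apply (g := (· * b)) x mdifferentiableAt_mul_right' hf,
    mcForm_mder_mul_right_apply]

theorem mdifferentiableAt_mul {p q : M → D} {x : M} (hp : MDifferentiableAt 𝓘(ℝ, F) 𝓘(ℝ, E) p x)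
    (hq : MDifferentiableAt 𝓘(ℝ, F) 𝓘(ℝ, E) q x) :
    MDifferentiableAt 𝓘(ℝ, F) 𝓘(ℝ, E) (fun y => p y * q y) x := by
  have h : MDifferentiableAt (𝓘(ℝ, E).prod 𝓘(ℝ, E)) 𝓘(ℝ, E) (fun z : D × D => z.1 * z.2)
      (p x, q x) := (contMDiff_mul 𝓘(ℝ, E) ∞).mdifferentiableAt (by simp)
  exact MDifferentiableAt.comp x (g := fun z : D × D => z.1 * z.2) h (hp.prodMk hq)

theorem mdifferentiableAt_inv {q : M → D} {x : M} (hq : MDifferentiableAt 𝓘(ℝ, F) 𝓘(ℝ, E) q x) :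
    MDifferentiableAt 𝓘(ℝ, F) 𝓘(ℝ, E) (fun y => (q y)⁻¹) x := by
  have h : MDifferentiableAt 𝓘(ℝ, E) 𝓘(ℝ, E) (fun z : D => z⁻¹) (q x) :=
    (contMDiff_inv 𝓘(ℝ, E) ∞).mdifferentiableAt (by simp)
  exact MDifferentiableAt.comp x (g := fun z : D => z⁻¹) h hq

/-- The Leibniz rule for the logarithmic derivative. -/
theorem logDer_mul {p q : M → D} {x : M} (hp : MDifferentiableAt 𝓘(ℝ, F) 𝓘(ℝ, E) p x)
    (hq : MDifferentiableAt 𝓘(ℝ, F) 𝓘(ℝ, E) q x) (v : F) :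
    logDer E F (fun y => p y * q y) x v =
      logDer E F q x v + adInv E (q x) (logDer E F p x v) := by
  have h : MDifferentiableAt (𝓘(ℝ, E).prod 𝓘(ℝ, E)) 𝓘(ℝ, E) (fun z : D × D => z.1 * z.2)
      (p x, q x) := (contMDiff_mul 𝓘(ℝ, E) ∞).mdifferentiableAt (by simp)
  have h1 : mder F E (fun y => p y * q y) x v =
      mder E E (· * q x) (p x) (mder F E p x v) + mder E E (p x * ·) (q x) (mder F E q x v) := by
    have e1 := mfderiv_comp x (g := fun z : D × D => z.1 * z.2) h (hp.prodMk hq)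
    have e2 := hp.mfderiv_prod hq
    have e3 : mder F E (fun y => p y * q y) x v =
        (mfderiv (𝓘(ℝ, E).prod 𝓘(ℝ, E)) 𝓘(ℝ, E) (fun z : D × D => z.1 * z.2) (p x, q x) :
          E × E →L[ℝ] E) (mder F E p x v, mder F E q x v) := by
      refine (congrArg (fun φ : F →L[ℝ] E => φ v) e1).trans ?_
      exact congrArg (fun φ : F →L[ℝ] E × E => (mfderiv (𝓘(ℝ, E).prod 𝓘(ℝ, E)) 𝓘(ℝ, E)
        (fun z : D × D => z.1 * z.2) (p x, q x) : E × E →L[ℝ] E) (φ v)) e2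
    exact e3.trans (mfderiv_prod_eq_add_apply h)
  rw [logDer_apply, h1, map_add, mcForm_mder_mul_right_apply, mcForm_mul_left, add_comm]
  rfl

/-- Two maps with the same logarithmic derivative differ locally by a left translation. -/
theorem eventually_eq_of_logDer_eq [IsManifold 𝓘(ℝ, F) ∞ M] {p q : M → D} {x : M}
    (hp : ∀ᶠ y in nhds x, MDifferentiableAt 𝓘(ℝ, F) 𝓘(ℝ, E) p y)
    (hq : ∀ᶠ y in nhds x, MDifferentiableAt 𝓘(ℝ, F) 𝓘(ℝ, E) q y)
    (h : ∀ᶠ y in nhds x, logDer E F p y = logDer E F q y) :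
    ∀ᶠ y in nhds x, p y * (q y)⁻¹ = p x * (q x)⁻¹ := by
  refine eventually_eq_of_mder_eq_zero (E := E) (F := F) (f := fun y => p y * (q y)⁻¹) ?_
  filter_upwards [hp, hq, h] with y hp hq h
  have hw := mdifferentiableAt_mul hp (mdifferentiableAt_inv hq)
  refine ⟨hw, mder_eq_zero_of_logDer ?_⟩
  ext v
  have h1 := logDer_mul hw hq v
  simp only [inv_mul_cancel_right] at h1
  have h2 : adInv E (q y) (logDer E F (fun y => p y * (q y)⁻¹) y v) = 0 := by
    have h3 : logDer E F (fun y => p y) y v = logDer E F q y v := congrArg (fun φ => φ v) h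
    rw [h3] at h1
    exact left_eq_add.1 h1
  exact adInv_injective (q y) (h2.trans (map_zero _).symm)

/-- Two maps from a connected manifold with the same logarithmic derivative agree if they agree at
one point. -/
theorem eq_of_logDer_eq [IsManifold 𝓘(ℝ, F) ∞ M] [PreconnectedSpace M] {p q : M → D}
    (hp : ∀ y, MDifferentiableAt 𝓘(ℝ, F) 𝓘(ℝ, E) p y)
    (hq : ∀ y, MDifferentiableAt 𝓘(ℝ, F) 𝓘(ℝ, E) q y)
    (h : ∀ y, logDer E F p y = logDer E F q y) {x : M} (hx : p x = q x) (y : M) : p y = q y := by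
  have h1 := ((IsLocallyConstant.iff_eventually_eq fun y => p y * (q y)⁻¹).2 fun x =>
    eventually_eq_of_logDer_eq (.of_forall hp) (.of_forall hq)
      (.of_forall h)).apply_eq_of_preconnectedSpace y x
  beta_reduce at h1
  rwa [hx, mul_inv_cancel, mul_inv_eq_one] at h1

end LogDerivative

section Subgroup

variable {E : Type*} [NormedAddCommGroup E] [NormedSpace ℝ E]
  {D : Type*} [TopologicalSpace D] [ChartedSpace E D] [Group D] [LieGroup 𝓘(ℝ, E) ∞ D]
  {F : Type*} [NormedAddCommGroup F] [NormedSpace ℝ F]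
  {G : Type*} [TopologicalSpace G] [ChartedSpace F G] [Group G] [LieGroup 𝓘(ℝ, F) ∞ G]
  {ι : G →* D} {s : Submodule ℝ (GroupLieAlgebra 𝓘(ℝ, E) D)}

namespace IsLieSubgroup

theorem finiteDimensional [FiniteDimensional ℝ E] (hι : IsLieSubgroup (F := F) ι s) :
    FiniteDimensional ℝ F :=
  FiniteDimensional.of_injective (mder F E ι 1).toLinearMap (hι.immersion 1)

theorem mdifferentiableAt (hι : IsLieSubgroup (F := F) ι s) (h : G) :
    MDifferentiableAt 𝓘(ℝ, F) 𝓘(ℝ, E) ι h :=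
  hι.smooth.mdifferentiableAt (by simp)

theorem mdifferentiableAt_translate (hι : IsLieSubgroup (F := F) ι s) (γ : D) (h : G) :
    MDifferentiableAt 𝓘(ℝ, F) 𝓘(ℝ, E) (fun h => γ * ι h) h :=
  MDifferentiableAt.comp h (mdifferentiableAt_mul_left' (E := E)) (hι.mdifferentiableAt h)

theorem mem_iff (hι : IsLieSubgroup (F := F) ι s) (u : E) : u ∈ s ↔ ∃ w, mder F E ι 1 w = u :=
  (hι.lieAlgebra u).trans ⟨fun ⟨w, hw⟩ => ⟨w, hw⟩, fun ⟨w, hw⟩ => ⟨w, hw⟩⟩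

/-- The inclusion intertwines the Maurer-Cartan forms. -/
theorem logDer_eq (hι : IsLieSubgroup (F := F) ι s) (h : G) (v : F) :
    logDer E F ι h v = mder F E ι 1 (mcForm F h v) := by
  obtain ⟨w, rfl⟩ : ∃ w, leftTr F h w = v := ⟨_, leftTr_mcForm h v⟩
  have e1 := mder_comp_apply (E := F) (F := F) (W := E) (g := ι) (f := fun k : G => h * k) 1
    (hι.mdifferentiableAt _) mdifferentiableAt_mul_left' w
  have e2 := mder_comp_apply (E := F) (F := E) (W := E) (g := fun z => ι h * z) (f := ι) 1
    mdifferentiableAt_mul_left' (hι.mdifferentiableAt _) w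
  simp only [map_mul, mul_one, map_one] at e1 e2
  rw [mcForm_leftTr, logDer_apply]
  refine (congrArg (mcForm E (ι h)) (e1.symm.trans e2)).trans ?_
  exact mcForm_leftTr (ι h) _

theorem logDer_translate (hι : IsLieSubgroup (F := F) ι s) (γ : D) (h : G) (v : F) :
    logDer E F (fun h => γ * ι h) h v = mder F E ι 1 (mcForm F h v) := by
  rw [logDer_const_mul γ (hι.mdifferentiableAt h), hι.logDer_eq]

/-- The tangent space of a left coset is the left-invariant distribution of the Lie algebra. -/
theorem mem_range_mder_translate_iff (hι : IsLieSubgroup (F := F) ι s) (γ : D) (h : G) (u : E) :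
    u ∈ Set.range (mder F E (fun h => γ * ι h) h) ↔ mcForm E (γ * ι h) u ∈ s := by
  rw [hι.mem_iff]
  constructor
  · rintro ⟨v, rfl⟩
    exact ⟨_, (hι.logDer_translate γ h v).symm⟩
  · rintro ⟨w, hw⟩
    refine ⟨leftTr F h w, mcForm_injective (E := E) (γ * ι h) ?_⟩
    have h1 := hι.logDer_translate γ h (leftTr F h w)
    rw [mcForm_leftTr, hw] at h1
    exact h1

theorem adInv_mder (hι : IsLieSubgroup (F := F) ι s) (h : G) (w : F) :
    adInv E (ι h) (mder F E ι 1 w) = mder F E ι 1 (adInv F h w) := by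
  have e1 := mder_comp_apply (E := F) (F := F) (W := E) (g := ι) (f := fun k : G => h⁻¹ * k * h) 1
    (hι.mdifferentiableAt _) mdifferentiableAt_conj w
  have e2 := mder_comp_apply (E := F) (F := E) (W := E) (g := fun z => (ι h)⁻¹ * z * ι h) (f := ι) 1
    mdifferentiableAt_conj (hι.mdifferentiableAt _) w
  simp only [map_mul, map_inv, mul_one, inv_mul_cancel, map_one] at e1 e2
  exact e2.symm.trans e1

theorem mdifferentiableAt_adInv (hι : IsLieSubgroup (F := F) ι s) (u : E) (h : G) :
    MDifferentiableAt 𝓘(ℝ, F) 𝓘(ℝ, E) (fun h => adInv E (ι h) u) h :=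
  MDifferentiableAt.comp h (g := fun x => adInv E x u)
    ((contMDiff_adInv_apply u).mdifferentiableAt (by simp)) (hι.mdifferentiableAt h)

theorem mder_adInv_one [FiniteDimensional ℝ E] (hι : IsLieSubgroup (F := F) ι s) (u : E) (w : F) :
    mder F E (fun h => adInv E (ι h) u) 1 w = - lieB E D (mder F E ι 1 w) u := by
  rw [← ParaHermitian.mder_adInv_one]
  have e := mder_comp_apply (E := F) (F := E) (W := E) (g := fun x => adInv E x u) (f := ι) 1
    ((contMDiff_adInv_apply u).mdifferentiableAt (by simp)) (hι.mdifferentiableAt _) w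
  rw [map_one] at e
  exact e

/-- A connected Lie subgroup is abelian if and only if its Lie algebra is abelian. If the Lie
algebra is abelian, then the adjoint action has vanishing derivative, hence is trivial; so a
conjugation and the identity have the same logarithmic derivative, hence coincide. -/
theorem comm_iff [FiniteDimensional ℝ E] [ConnectedSpace G] (hι : IsLieSubgroup (F := F) ι s) :
    (∀ a b : G, a * b = b * a) ↔ ∀ u ∈ s, ∀ v ∈ s, lieB E D u v = 0 := by
  constructor
  · intro h u hu v hv
    obtain ⟨w, rfl⟩ := (hι.mem_iff u).1 hu
    obtain ⟨w', rfl⟩ := (hι.mem_iff v).1 hv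
    have h1 (k : G) : adInv E (ι k) (mder F E ι 1 w') = mder F E ι 1 w' := by
      rw [hι.adInv_mder]
      simp [adInv, h k⁻¹, mder_id]
    have h2 := hι.mder_adInv_one (mder F E ι 1 w') w
    simp only [h1, mder_const] at h2
    exact neg_eq_zero.1 h2.symm
  · intro h
    have hinv (w : F) (a : G) : adInv E (ι a) (mder F E ι 1 w) = mder F E ι 1 w := by
      have hz (k : G) : mder F E (fun k => adInv E (ι k) (mder F E ι 1 w)) k = 0 := by
        ext v
        obtain ⟨w', rfl⟩ : ∃ w', leftTr F k w' = v := ⟨_, leftTr_mcForm k v⟩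
        have e1 := mder_comp_apply (E := F) (F := F) (W := E)
          (g := fun k => adInv E (ι k) (mder F E ι 1 w)) (f := fun l : G => k * l) 1
          (hι.mdifferentiableAt_adInv _ _) mdifferentiableAt_mul_left' w'
        simp only [map_mul, adInv_mul, mul_one] at e1
        refine e1.symm.trans ((hι.mder_adInv_one _ w').trans ?_)
        rw [hι.adInv_mder, h _ ((hι.mem_iff _).2 ⟨_, rfl⟩) _ ((hι.mem_iff _).2 ⟨_, rfl⟩), neg_zero]
        rfl
      have := eq_of_mder_eq_zero (hι.mdifferentiableAt_adInv (mder F E ι 1 w)) hz a 1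
      rwa [map_one, adInv_one] at this
    intro a b
    have hd (y : G) : MDifferentiableAt 𝓘(ℝ, F) 𝓘(ℝ, E) (fun k => (ι b)⁻¹ * ι k * ι b) y :=
      MDifferentiableAt.comp y (g := fun z => (ι b)⁻¹ * z * ι b) (mdifferentiableAt_conj (E := E))
        (hι.mdifferentiableAt y)
    have key := eq_of_logDer_eq (p := fun k => (ι b)⁻¹ * ι k * ι b) (q := ι) hd
      hι.mdifferentiableAt (fun k => by
        ext v
        rw [logDer_mul_const (f := fun k => (ι b)⁻¹ * ι k) _ (hι.mdifferentiableAt_translate _ k),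
          hι.logDer_translate, hι.logDer_eq, hinv]) (x := 1) (by simp) a
    refine hι.injective ?_
    rw [mul_assoc, inv_mul_eq_iff_eq_mul] at key
    rw [map_mul, map_mul, key]

end IsLieSubgroup

/-- A Lie group is a Lie subgroup of itself. -/
theorem isLieSubgroup_id : IsLieSubgroup (F := E) (MonoidHom.id D)
    (⊤ : Submodule ℝ (GroupLieAlgebra 𝓘(ℝ, E) D)) where
  smooth := contMDiff_id
  injective := Function.injective_id
  immersion h := by
    have : mder E E (MonoidHom.id D) h = ContinuousLinearMap.id ℝ E := mder_id h
    change Function.Injective (mder E E (MonoidHom.id D) h)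
    rw [this]
    exact Function.injective_id
  lieAlgebra u := by
    have : mder E E (MonoidHom.id D) 1 = ContinuousLinearMap.id ℝ E := mder_id 1
    refine ⟨fun _ => ⟨(u : E), ?_⟩, fun _ => Submodule.mem_top⟩
    change mder E E (MonoidHom.id D) 1 u = u
    rw [this]
    rfl

end Subgroup

/-! ### Cosets as leaves -/

section Leaves

variable {E : Type*} [NormedAddCommGroup E] [NormedSpace ℝ E]
  {D : Type*} [TopologicalSpace D] [ChartedSpace E D] [Group D] [LieGroup 𝓘(ℝ, E) ∞ D]
  {F : Type*} [NormedAddCommGroup F] [NormedSpace ℝ F]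
  {G : Type*} [TopologicalSpace G] [ChartedSpace F G] [Group G] [LieGroup 𝓘(ℝ, F) ∞ G]
  {F' : Type*} [NormedAddCommGroup F'] [NormedSpace ℝ F']
  {G' : Type*} [TopologicalSpace G'] [ChartedSpace F' G'] [Group G'] [LieGroup 𝓘(ℝ, F') ∞ G']
  {ι : G →* D} {ι' : G' →* D} {s s' : Submodule ℝ (GroupLieAlgebra 𝓘(ℝ, E) D)}
  {L : Distribution E D}

theorem logDer_comp {W : Type*} [NormedAddCommGroup W] [NormedSpace ℝ W]
    {O : Type*} [TopologicalSpace O] [ChartedSpace W O] {f : G → D} {g : O → G} {x : O}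
    (hf : MDifferentiableAt 𝓘(ℝ, F) 𝓘(ℝ, E) f (g x))
    (hg : MDifferentiableAt 𝓘(ℝ, W) 𝓘(ℝ, F) g x) (v : W) :
    logDer E W (fun y => f (g y)) x v = logDer E F f (g x) (mder W F g x v) := by
  rw [logDer_apply, mder_comp_apply (g := f) x hf hg, logDer_apply]

namespace IsLieSubgroup

/-- Nearby points of a left coset are joined by a smooth curve in the coset: a segment in a chart,
reparametrized by a smooth transition function. -/
theorem exists_tangentStep (hι : IsLieSubgroup (F := F) ι s)
    (hL : ∀ (x : D) (u : E), u ∈ L x ↔ mcForm E x u ∈ s) (γ : D) (h₀ : G) :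
    ∃ U ∈ nhds h₀, ∀ h ∈ U, ∀ k ∈ U, TangentStep L (γ * ι h) (γ * ι k) := by
  set φ := extChartAt 𝓘(ℝ, F) h₀
  have hs : h₀ ∈ φ.source := mem_extChartAt_source h₀
  obtain ⟨r, hr, hball⟩ := Metric.mem_nhds_iff.1
    (extChartAt_target_mem_nhds_of_mem (mem_extChartAt_target (I := 𝓘(ℝ, F)) h₀))
  have hφ : φ ⁻¹' Metric.ball (φ h₀) r ∈ nhds h₀ :=
    (contMDiffAt_extChartAt_of_mem hs).continuousAt
      (Metric.isOpen_ball.mem_nhds (Metric.mem_ball_self hr))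
  refine ⟨φ ⁻¹' Metric.ball (φ h₀) r ∩ φ.source,
    Filter.inter_mem hφ (extChartAt_source_mem_nhds h₀), fun h hh k hk => ?_⟩
  set σ : ℝ → F := fun t => φ h + Real.smoothTransition t • (φ k - φ h) with hσ
  have hσ_smooth : ContMDiff 𝓘(ℝ, ℝ) 𝓘(ℝ, F) ∞ σ :=
    (contDiff_const.add (Real.smoothTransition.contDiff.smul contDiff_const)).contMDiff
  have hσ_mem (t : ℝ) : σ t ∈ φ.target :=
    hball ((convex_ball (φ h₀) r).add_smul_sub_mem hh.1 hk.1
      ⟨Real.smoothTransition.nonneg t, Real.smoothTransition.le_one t⟩)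
  have hc₀ : ContMDiff 𝓘(ℝ, ℝ) 𝓘(ℝ, F) ∞ fun t => φ.symm (σ t) := fun t =>
    ContMDiffAt.comp t (g := φ.symm) (contMDiffAt_extChartAt_symm (hσ_mem t)) (hσ_smooth t)
  refine ⟨fun t => γ * ι (φ.symm (σ t)), contMDiff_const.mul (hι.smooth.comp hc₀), ?_, ?_, ?_⟩
  · simp [hσ, φ.left_inv hh.2]
  · simp [hσ, φ.left_inv hk.2]
  · intro t
    refine (hL _ _).2 ((hι.mem_range_mder_translate_iff γ _ _).1
      ⟨mder ℝ F (fun t => φ.symm (σ t)) t 1, ?_⟩)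
    exact (mder_comp_apply (E := ℝ) (F := F) (W := E) (g := fun h => γ * ι h)
        (f := fun t => φ.symm (σ t)) t (hι.mdifferentiableAt_translate _ _)
        ((hc₀ t).mdifferentiableAt (by simp)) 1).symm

/-- A left coset of a connected subgroup is contained in a leaf: the points of the subgroup that are
reached form a nonempty open and closed set. -/
theorem translate_mem_leaf [ConnectedSpace G] (hι : IsLieSubgroup (F := F) ι s)
    (hL : ∀ (x : D) (u : E), u ∈ L x ↔ mcForm E x u ∈ s) (γ : D) (h : G) :
    γ * ι h ∈ leaf L γ := by
  have hopen (A : Set G) (hA : ∀ h k : G, TangentStep L (γ * ι h) (γ * ι k) →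
      h ∈ A → k ∈ A) : IsOpen A := by
    refine isOpen_iff_mem_nhds.2 fun h₀ h₀A => ?_
    obtain ⟨U, hU, hstep⟩ := hι.exists_tangentStep hL γ h₀
    exact Filter.mem_of_superset hU fun k hk => hA h₀ k (hstep _ (mem_of_mem_nhds hU) _ hk) h₀A
  have hclopen : IsClopen {h : G | γ * ι h ∈ leaf L γ} := by
    refine ⟨⟨isOpen_iff_mem_nhds.2 fun h₀ h₀A => ?_⟩, hopen _ fun h k hk hh => hh.tail hk⟩
    obtain ⟨U, hU, hstep⟩ := hι.exists_tangentStep hL γ h₀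
    exact Filter.mem_of_superset hU fun k hk hkA =>
      h₀A (Relation.ReflTransGen.tail hkA (hstep _ hk _ (mem_of_mem_nhds hU)))
  have h1 : (1 : G) ∈ {h : G | γ * ι h ∈ leaf L γ} := by
    change Relation.ReflTransGen (TangentStep L) γ (γ * ι 1)
    rw [map_one, mul_one]
  exact Set.eq_univ_iff_forall.1 (hclopen.eq_univ ⟨1, h1⟩) h

/-- The derivative of the inclusion in the charts at the identities. -/
theorem fderiv_chart (hι : IsLieSubgroup (F := F) ι s) (v : F) :
    fderiv ℝ (fun q => extChartAt 𝓘(ℝ, E) (1 : D) (ι ((extChartAt 𝓘(ℝ, F) (1 : G)).symm q)))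
      (extChartAt 𝓘(ℝ, F) (1 : G) 1) (mder F F (extChartAt 𝓘(ℝ, F) (1 : G)) 1 v) =
      mder E E (extChartAt 𝓘(ℝ, E) (1 : D)) 1 (mder F E ι 1 v) := by
  have hs : (1 : G) ∈ (extChartAt 𝓘(ℝ, F) (1 : G)).source := mem_extChartAt_source 1
  have e1 : (extChartAt 𝓘(ℝ, F) (1 : G)).symm (extChartAt 𝓘(ℝ, F) (1 : G) 1) = 1 :=
    (extChartAt 𝓘(ℝ, F) (1 : G)).left_inv hs
  have d0 : MDifferentiableAt 𝓘(ℝ, E) 𝓘(ℝ, E) (extChartAt 𝓘(ℝ, E) (1 : D)) 1 :=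
    (contMDiffAt_extChartAt_of_mem (mem_extChartAt_source 1)).mdifferentiableAt (by simp)
  have d1 : MDifferentiableAt 𝓘(ℝ, F) 𝓘(ℝ, F) (extChartAt 𝓘(ℝ, F) (1 : G)).symm
      (extChartAt 𝓘(ℝ, F) (1 : G) 1) :=
    (contMDiffAt_extChartAt_symm (mem_extChartAt_target 1)).mdifferentiableAt (by simp)
  have d2 := hι.mdifferentiableAt
    ((extChartAt 𝓘(ℝ, F) (1 : G)).symm (extChartAt 𝓘(ℝ, F) (1 : G) 1))
  have d3 : MDifferentiableAt 𝓘(ℝ, F) 𝓘(ℝ, E) (fun q => ι ((extChartAt 𝓘(ℝ, F) (1 : G)).symm q))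
      (extChartAt 𝓘(ℝ, F) (1 : G) 1) := MDifferentiableAt.comp _ d2 d1
  rw [← mder_eq_fderiv, mder_comp_apply (g := extChartAt 𝓘(ℝ, E) (1 : D)) _
    (by rwa [e1, map_one]) d3, mder_comp_apply (g := ι) _ d2 d1, mder_extChartAt_mder_symm hs, e1,
    map_one]

/-- Near the identity every element of `D` is a product of elements of two subgroups with
complementary Lie algebras, and the factors depend smoothly on it. -/
theorem exists_local_factorization [FiniteDimensional ℝ E] (hι : IsLieSubgroup (F := F) ι s)
    (hι' : IsLieSubgroup (F := F') ι' s') (hs : IsCompl s s') :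
    ∃ (p' : D → G') (p : D → G), p' 1 = 1 ∧ p 1 = 1 ∧
      (∀ᶠ x in nhds (1 : D), MDifferentiableAt 𝓘(ℝ, E) 𝓘(ℝ, F') p' x ∧
        MDifferentiableAt 𝓘(ℝ, E) 𝓘(ℝ, F) p x) ∧
      ∀ᶠ x in nhds (1 : D), ι' (p' x) * ι (p x) = x := by
  have : FiniteDimensional ℝ F := hι.finiteDimensional
  have : FiniteDimensional ℝ F' := hι'.finiteDimensional
  have : CompleteSpace F := FiniteDimensional.complete ℝ F
  have : CompleteSpace F' := FiniteDimensional.complete ℝ F'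
  have : CompleteSpace E := FiniteDimensional.complete ℝ E
  set ψ := extChartAt 𝓘(ℝ, E) (1 : D)
  set φ := extChartAt 𝓘(ℝ, F) (1 : G)
  set φ' := extChartAt 𝓘(ℝ, F') (1 : G')
  have ψs : (1 : D) ∈ ψ.source := mem_extChartAt_source 1
  have φs : (1 : G) ∈ φ.source := mem_extChartAt_source 1
  have φs' : (1 : G') ∈ φ'.source := mem_extChartAt_source 1
  have φt : φ 1 ∈ φ.target := mem_extChartAt_target 1
  have φt' : φ' 1 ∈ φ'.target := mem_extChartAt_target 1
  have φ1 : φ.symm (φ 1) = 1 := φ.left_inv φs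
  have φ1' : φ'.symm (φ' 1) = 1 := φ'.left_inv φs'
  -- the product map in the charts at the identities, to which the inverse function theorem applies
  set m : F' × F → D := fun z => ι' (φ'.symm z.1) * ι (φ.symm z.2)
  have m1 : m (φ' 1, φ 1) = 1 := by simp [m, φ1, φ1']
  have hm : ContMDiffAt 𝓘(ℝ, F' × F) 𝓘(ℝ, E) ∞ m (φ' 1, φ 1) := by
    have h1 : ContMDiffAt 𝓘(ℝ, F' × F) 𝓘(ℝ, F') ∞ (fun z : F' × F => φ'.symm z.1) (φ' 1, φ 1) :=
      ContMDiffAt.comp (φ' 1, φ 1) (g := φ'.symm) (contMDiffAt_extChartAt_symm φt')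
        contDiff_fst.contMDiff.contMDiffAt
    have h2 : ContMDiffAt 𝓘(ℝ, F' × F) 𝓘(ℝ, F) ∞ (fun z : F' × F => φ.symm z.2) (φ' 1, φ 1) :=
      ContMDiffAt.comp (φ' 1, φ 1) (g := φ.symm) (contMDiffAt_extChartAt_symm φt)
        contDiff_snd.contMDiff.contMDiffAt
    exact (hι'.smooth.contMDiffAt.comp _ h1).mul (hι.smooth.contMDiffAt.comp _ h2)
  have hψ : ContMDiffAt 𝓘(ℝ, E) 𝓘(ℝ, E) ∞ ψ (m (φ' 1, φ 1)) := by
    rw [m1]; exact contMDiffAt_extChartAt_of_mem ψs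
  set Θ : F' × F → E := fun z => ψ (m z)
  have hΘ : ContDiffAt ℝ ∞ Θ (φ' 1, φ 1) :=
    contMDiffAt_iff_contDiffAt.1 (ContMDiffAt.comp (φ' 1, φ 1) (g := ψ) hψ hm)
  have hΘ1 : Θ (φ' 1, φ 1) = ψ 1 := congrArg ψ m1
  set T := fderiv ℝ Θ (φ' 1, φ 1)
  have hΘd : HasFDerivAt Θ T (φ' 1, φ 1) := (hΘ.differentiableAt (by simp)).hasFDerivAt
  have hT' (v : F') : T (mder F' F' φ' 1 v, 0) = mder E E ψ 1 (mder F' E ι' 1 v) := by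
    rw [← hι'.fderiv_chart v]
    have h1 := HasFDerivAt.comp (φ' 1) (g := Θ) (f := fun q : F' => (q, φ 1)) hΘd
      (hasFDerivAt_prodMk_left (φ' 1) (φ 1))
    have h2 : Θ ∘ (fun q : F' => (q, φ 1)) = fun q => ψ (ι' (φ'.symm q)) := by
      funext q; simp [Θ, m, φ1]
    rw [h2] at h1
    rw [h1.fderiv]
    rfl
  have hT (v : F) : T (0, mder F F φ 1 v) = mder E E ψ 1 (mder F E ι 1 v) := by
    rw [← hι.fderiv_chart v]
    have h1 := HasFDerivAt.comp (φ 1) (g := Θ) (f := fun q : F => (φ' 1, q)) hΘd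
      (hasFDerivAt_prodMk_right (φ' 1) (φ 1))
    have h2 : Θ ∘ (fun q : F => (φ' 1, q)) = fun q => ψ (ι (φ.symm q)) := by
      funext q; simp [Θ, m, φ1']
    rw [h2] at h1
    rw [h1.fderiv]
    rfl
  have hTadd (v' : F') (v : F) : T (mder F' F' φ' 1 v', mder F F φ 1 v) =
      mder E E ψ 1 (mder F' E ι' 1 v' + mder F E ι 1 v) := by
    rw [map_add, ← hT', ← hT, ← map_add]
    simp
  have φsurj (w : F) : mder F F φ 1 (mder F F φ.symm (φ 1) w) = w := by
    have := mder_extChartAt_symm_mder φt w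
    rwa [φ1] at this
  have φsurj' (w : F') : mder F' F' φ' 1 (mder F' F' φ'.symm (φ' 1) w) = w := by
    have := mder_extChartAt_symm_mder φt' w
    rwa [φ1'] at this
  have hbij : Function.Bijective T := by
    constructor
    · refine (injective_iff_map_eq_zero T).2 ?_
      rintro ⟨w', w⟩ hw
      rw [← φsurj w, ← φsurj' w', hTadd] at hw
      have h1 := congrArg (mder E E ψ.symm (ψ 1)) hw
      rw [mder_extChartAt_mder_symm ψs, map_zero] at h1
      have h2 : mder F E ι 1 (mder F F φ.symm (φ 1) w) ∈ s := (hι.mem_iff _).2 ⟨_, rfl⟩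
      have h3 : mder F' E ι' 1 (mder F' F' φ'.symm (φ' 1) w') ∈ s' := (hι'.mem_iff _).2 ⟨_, rfl⟩
      have h4 : mder F' E ι' 1 (mder F' F' φ'.symm (φ' 1) w') ∈ s := by
        rw [eq_neg_of_add_eq_zero_left h1]
        exact s.neg_mem h2
      have h5 := Submodule.disjoint_def.1 hs.disjoint _ h4 h3
      have h5' : mder F' E ι' 1 (mder F' F' φ'.symm (φ' 1) w') = 0 := h5
      rw [h5', zero_add] at h1
      have h6 : mder F' F' φ'.symm (φ' 1) w' = 0 := hι'.immersion 1 (h5'.trans (map_zero _).symm)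
      have h7 : mder F F φ.symm (φ 1) w = 0 := hι.immersion 1 (h1.trans (map_zero _).symm)
      rw [← φsurj w, ← φsurj' w', h6, h7, map_zero, map_zero]
      rfl
    · intro u
      let x : GroupLieAlgebra 𝓘(ℝ, E) D := mder E E ψ.symm (ψ 1) u
      have h1 : x ∈ s ⊔ s' := hs.sup_eq_top ▸ Submodule.mem_top
      obtain ⟨a, ha, a', ha', hsum⟩ := Submodule.mem_sup.1 h1
      obtain ⟨v, rfl⟩ := (hι.mem_iff a).1 ha
      obtain ⟨v', rfl⟩ := (hι'.mem_iff a').1 ha'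
      refine ⟨(mder F' F' φ' 1 v', mder F F φ 1 v), ?_⟩
      have hsum' : mder F' E ι' 1 v' + mder F E ι 1 v = mder E E ψ.symm (ψ 1) u :=
        (add_comm _ _).trans hsum
      rw [hTadd, hsum']
      have h2 := mder_extChartAt_symm_mder (mem_extChartAt_target (I := 𝓘(ℝ, E)) (1 : D)) u
      have h3 : ψ.symm (ψ 1) = 1 := ψ.left_inv ψs
      rwa [h3] at h2
  let e : (F' × F) ≃L[ℝ] E := (LinearEquiv.ofBijective T.toLinearMap hbij).toContinuousLinearEquiv
  have hΘe : HasFDerivAt Θ (e : F' × F →L[ℝ] E) (φ' 1, φ 1) := hΘd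
  have hn : (∞ : WithTop ℕ∞) ≠ 0 := by simp
  have hinv : ContDiffAt ℝ ∞ (hΘ.localInverse hΘe hn) (ψ 1) := hΘ1 ▸ hΘ.to_localInverse hΘe hn
  have hright : ∀ᶠ y in nhds (ψ 1), Θ (hΘ.localInverse hΘe hn y) = y :=
    hΘ1 ▸ (hΘ.hasStrictFDerivAt' hΘe hn).eventually_right_inverse
  have hval : hΘ.localInverse hΘe hn (ψ 1) = (φ' 1, φ 1) := by
    rw [← hΘ1]; exact hΘ.localInverse_apply_image hΘe hn
  set θ := hΘ.localInverse hΘe hn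
  have hψc : Filter.Tendsto ψ (nhds 1) (nhds (ψ 1)) :=
    (contMDiffAt_extChartAt_of_mem ψs).continuousAt
  have hθc : Filter.Tendsto (fun x => θ (ψ x)) (nhds 1) (nhds (φ' 1, φ 1)) := by
    have := hinv.continuousAt.tendsto.comp hψc
    rwa [hval] at this
  refine ⟨fun x => φ'.symm (θ (ψ x)).1, fun x => φ.symm (θ (ψ x)).2, ?_, ?_, ?_, ?_⟩
  · beta_reduce; rw [hval, φ1']
  · beta_reduce; rw [hval, φ1]
  · have hθd : ∀ᶠ y in nhds (ψ 1), DifferentiableAt ℝ θ y :=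
      ((hinv.of_le (m := 1) (by simp)).eventually (by simp)).mono fun y hy =>
        hy.differentiableAt (by simp)
    have c1 := hθc.fst_nhds.eventually (extChartAt_target_mem_nhds_of_mem φt')
    have c2 := hθc.snd_nhds.eventually (extChartAt_target_mem_nhds_of_mem φt)
    filter_upwards [hψc.eventually hθd, c1, c2, extChartAt_source_mem_nhds (I := 𝓘(ℝ, E)) (1 : D)]
      with x h1 h2 h3 h4
    have d1 : MDifferentiableAt 𝓘(ℝ, E) 𝓘(ℝ, F' × F) (fun x => θ (ψ x)) x :=
      MDifferentiableAt.comp x (g := θ) (mdifferentiableAt_iff_differentiableAt.2 h1)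
        ((contMDiffAt_extChartAt_of_mem h4).mdifferentiableAt (by simp))
    have d2 : MDifferentiableAt 𝓘(ℝ, E) 𝓘(ℝ, F') (fun x => (θ (ψ x)).1) x :=
      MDifferentiableAt.comp x (g := Prod.fst)
        (mdifferentiableAt_iff_differentiableAt.2 differentiableAt_fst) d1
    have d3 : MDifferentiableAt 𝓘(ℝ, E) 𝓘(ℝ, F) (fun x => (θ (ψ x)).2) x :=
      MDifferentiableAt.comp x (g := Prod.snd)
        (mdifferentiableAt_iff_differentiableAt.2 differentiableAt_snd) d1
    exact ⟨MDifferentiableAt.comp x (g := φ'.symm)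
        ((contMDiffAt_extChartAt_symm h2).mdifferentiableAt (by simp)) d2,
      MDifferentiableAt.comp x (g := φ.symm)
        ((contMDiffAt_extChartAt_symm h3).mdifferentiableAt (by simp)) d3⟩
  · have hms : ∀ᶠ x in nhds (1 : D), m (θ (ψ x)) ∈ ψ.source := by
      have h1 : Filter.Tendsto (fun x => m (θ (ψ x))) (nhds 1) (nhds 1) := by
        have := hm.continuousAt.tendsto
        rw [m1] at this
        exact this.comp hθc
      exact h1.eventually (extChartAt_source_mem_nhds (1 : D))
    filter_upwards [hψc.eventually hright, hms, extChartAt_source_mem_nhds (I := 𝓘(ℝ, E)) (1 : D)]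
      with x h1 h2 h3
    exact ψ.injOn h2 h3 h1

/-- A curve tangent to the distribution of a subgroup stays in a left coset: in the local
factorization of the curve the complementary factor has derivative zero. -/
theorem eventually_mem_range [FiniteDimensional ℝ E] (hι : IsLieSubgroup (F := F) ι s)
    (hι' : IsLieSubgroup (F := F') ι' s') (hs : IsCompl s s') {c : ℝ → D}
    (hc : ∀ t, MDifferentiableAt 𝓘(ℝ, ℝ) 𝓘(ℝ, E) c t) (hcs : ∀ t v, logDer E ℝ c t v ∈ s) (t₀ : ℝ) :
    ∀ᶠ t in nhds t₀, (c t₀)⁻¹ * c t ∈ ι.range := by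
  obtain ⟨p', p, hp'1, -, hd, hfac⟩ := hι.exists_local_factorization hι' hs
  set q : ℝ → D := fun t => (c t₀)⁻¹ * c t
  have hq (t : ℝ) : MDifferentiableAt 𝓘(ℝ, ℝ) 𝓘(ℝ, E) q t :=
    MDifferentiableAt.comp t (mdifferentiableAt_mul_left' (E := E)) (hc t)
  have hq1 : q t₀ = 1 := inv_mul_cancel _
  have hqc : Filter.Tendsto q (nhds t₀) (nhds 1) := by
    have := (hq t₀).continuousAt.tendsto
    rwa [hq1] at this
  have hd' := hqc.eventually hd
  have hfac' := hqc.eventually hfac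
  have hmain : ∀ᶠ t in nhds t₀, MDifferentiableAt 𝓘(ℝ, ℝ) 𝓘(ℝ, E) (fun t => ι' (p' (q t))) t ∧
      mder ℝ E (fun t => ι' (p' (q t))) t = 0 := by
    filter_upwards [hd', hfac'.eventually_nhds] with t h1 h2
    have d1 : MDifferentiableAt 𝓘(ℝ, ℝ) 𝓘(ℝ, F') (fun t => p' (q t)) t :=
      MDifferentiableAt.comp t h1.1 (hq t)
    have d2 : MDifferentiableAt 𝓘(ℝ, ℝ) 𝓘(ℝ, F) (fun t => p (q t)) t :=
      MDifferentiableAt.comp t h1.2 (hq t)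
    have d3 : MDifferentiableAt 𝓘(ℝ, ℝ) 𝓘(ℝ, E) (fun t => ι' (p' (q t))) t :=
      MDifferentiableAt.comp t (hι'.mdifferentiableAt _) d1
    have d4 : MDifferentiableAt 𝓘(ℝ, ℝ) 𝓘(ℝ, E) (fun t => ι (p (q t))) t :=
      MDifferentiableAt.comp t (hι.mdifferentiableAt _) d2
    refine ⟨d3, mder_eq_zero_of_logDer ?_⟩
    refine ContinuousLinearMap.ext fun v => ?_
    have e1 := logDer_mul d3 d4 v
    have e2 : logDer E ℝ (fun t => ι' (p' (q t)) * ι (p (q t))) t v = logDer E ℝ c t v := by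
      rw [← logDer_const_mul (c t₀)⁻¹ (hc t)]
      have : (fun t => ι' (p' (q t)) * ι (p (q t))) =ᶠ[nhds t] fun t => (c t₀)⁻¹ * c t := h2
      rw [logDer_apply, logDer_apply, this.mder_eq, this.eq_of_nhds]
    have e3 : logDer E ℝ (fun t => ι (p (q t))) t v =
        mder F E ι 1 (mcForm F (p (q t)) (mder ℝ F (fun t => p (q t)) t v)) := by
      rw [logDer_comp (f := ι) (hι.mdifferentiableAt _) d2, hι.logDer_eq]
    have e4 : logDer E ℝ (fun t => ι' (p' (q t))) t v =
        mder F' E ι' 1 (mcForm F' (p' (q t)) (mder ℝ F' (fun t => p' (q t)) t v)) := by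
      rw [logDer_comp (f := ι') (hι'.mdifferentiableAt _) d1, hι'.logDer_eq]
    have m1 : adInv E (ι (p (q t))) (logDer E ℝ (fun t => ι' (p' (q t))) t v) ∈ s := by
      rw [← sub_eq_of_eq_add' e1, e2]
      refine s.sub_mem (hcs t v) ?_
      rw [e3]
      exact (hι.mem_iff _).2 ⟨_, rfl⟩
    obtain ⟨w, hw⟩ := (hι.mem_iff _).1 m1
    have m2 : logDer E ℝ (fun t => ι' (p' (q t))) t v ∈ s := by
      have := congrArg (adInv E (ι (p (q t)))⁻¹) hw
      rw [adInv_inv_adInv, ← map_inv, hι.adInv_mder] at this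
      rw [← this]
      exact (hι.mem_iff _).2 ⟨_, rfl⟩
    have m3 : logDer E ℝ (fun t => ι' (p' (q t))) t v ∈ s' := by
      rw [e4]
      exact (hι'.mem_iff _).2 ⟨_, rfl⟩
    exact Submodule.disjoint_def.1 hs.disjoint _ m2 m3
  filter_upwards [eventually_eq_of_mder_eq_zero (E := E) (F := ℝ) hmain, hfac'] with t h1 h2
  rw [hq1, hp'1, map_one] at h1
  rw [h1, one_mul] at h2
  exact ⟨p (q t), h2⟩

/-- The leaves of the left-invariant distribution of a connected Lie subgroup are its left cosets,
if some other Lie subgroup has a complementary Lie algebra. The cosets need not be embedded or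
closed: along a tangent curve `c` membership of `(c 0)⁻¹ * c t` in the subgroup is locally constant
in `t`. -/
theorem leaf_eq [FiniteDimensional ℝ E] [ConnectedSpace G] (hι : IsLieSubgroup (F := F) ι s)
    (hι' : IsLieSubgroup (F := F') ι' s') (hs : IsCompl s s')
    (hL : ∀ (x : D) (u : E), u ∈ L x ↔ mcForm E x u ∈ s) (γ : D) :
    leaf L γ = Set.range fun h => γ * ι h := by
  refine Set.Subset.antisymm (fun q hq => ?_) ?_
  · have hstep {a b : D} (hab : TangentStep L a b) : a⁻¹ * b ∈ ι.range := by
      obtain ⟨c, hc, rfl, rfl, hcL⟩ := hab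
      have hcd (t : ℝ) : MDifferentiableAt 𝓘(ℝ, ℝ) 𝓘(ℝ, E) c t := (hc t).mdifferentiableAt (by simp)
      have hcs (t v : ℝ) : logDer E ℝ c t v ∈ s := by
        have h1 : logDer E ℝ c t 1 ∈ s := (hL _ _).1 (hcL t)
        have h2 : logDer E ℝ c t v = v • logDer E ℝ c t 1 := by
          rw [← map_smul, smul_eq_mul, mul_one]
        rw [h2]
        exact s.smul_mem v h1
      have hloc (t₀ : ℝ) := hι.eventually_mem_range hι' hs hcd hcs t₀
      have hclopen : IsClopen {t : ℝ | (c 0)⁻¹ * c t ∈ ι.range} := by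
        have key (t₀ t : ℝ) (h : (c t₀)⁻¹ * c t ∈ ι.range) :
            (c 0)⁻¹ * c t ∈ ι.range ↔ (c 0)⁻¹ * c t₀ ∈ ι.range := by
          have h1 : (c 0)⁻¹ * c t = (c 0)⁻¹ * c t₀ * ((c t₀)⁻¹ * c t) := by group
          rw [h1]
          exact Subgroup.mul_mem_cancel_right _ h
        refine ⟨⟨isOpen_iff_mem_nhds.2 fun t₀ h₀ => ?_⟩, isOpen_iff_mem_nhds.2 fun t₀ h₀ => ?_⟩
        · filter_upwards [hloc t₀] with t ht h using h₀ ((key t₀ t ht).1 h)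
        · filter_upwards [hloc t₀] with t ht using (key t₀ t ht).2 h₀
      have h0 : (0 : ℝ) ∈ {t : ℝ | (c 0)⁻¹ * c t ∈ ι.range} := by
        change (c 0)⁻¹ * c 0 ∈ ι.range
        rw [inv_mul_cancel]
        exact ι.range.one_mem
      exact Set.eq_univ_iff_forall.1 (hclopen.eq_univ ⟨0, h0⟩) 1
    have hmem : γ⁻¹ * q ∈ ι.range := by
      induction hq with
      | refl => rw [inv_mul_cancel]; exact ι.range.one_mem
      | tail _ hab ih =>
        have := ι.range.mul_mem ih (hstep hab)
        rwa [mul_assoc, mul_inv_cancel_left] at this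
    obtain ⟨h, hh⟩ := hmem
    exact ⟨h, by simp [hh]⟩
  · rintro _ ⟨h, rfl⟩
    exact hι.translate_mem_leaf hL γ h

end IsLieSubgroup

end Leaves

/-! ### The subgroups of a Manin triple -/

namespace Polarization

variable {E : Type*} [NormedAddCommGroup E] [NormedSpace ℝ E] [FiniteDimensional ℝ E]
  {D : Type*} [TopologicalSpace D] [ChartedSpace E D] [Group D] [LieGroup 𝓘(ℝ, E) ∞ D]
  {d : ℕ} (P : Polarization E D d)

theorem mem_gSub (u : E) : u ∈ P.gSub ↔ ∀ m, P.co (Sum.inr m) u = 0 := P.mem_span_inl_iff u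

theorem gSub_swap : P.swap.gSub = P.gSub' := by
  have h (m : Fin d) : P.swap.basis (Sum.inl m) = P.basis (Sum.inr m) := P.b_swap _
  simp only [gSub, gSub', h]

theorem mem_gSub' (u : E) : u ∈ P.gSub' ↔ ∀ m, P.co (Sum.inl m) u = 0 := by
  rw [← gSub_swap]
  refine (P.swap.mem_gSub u).trans (forall_congr' fun m => ?_)
  rw [co_swap]
  rfl

theorem isCompl_gSub : IsCompl P.gSub P.gSub' := by
  constructor
  · refine Submodule.disjoint_def.2 fun u h h' => P.ext_co fun A => ?_
    rcases A with m | m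
    · exact ((P.mem_gSub' u).1 h' m).trans (map_zero (P.co _)).symm
    · exact ((P.mem_gSub u).1 h m).trans (map_zero (P.co _)).symm
  · refine codisjoint_iff.2 (Submodule.eq_top_iff'.2 fun u => ?_)
    have h2 := P.basis.sum_repr u
    rw [Fintype.sum_sum_type] at h2
    rw [← h2]
    exact Submodule.add_mem_sup
      (Submodule.sum_mem _ fun m _ => Submodule.smul_mem _ _ (Submodule.subset_span ⟨m, rfl⟩))
      (Submodule.sum_mem _ fun m _ => Submodule.smul_mem _ _ (Submodule.subset_span ⟨m, rfl⟩))

theorem mem_Lplus_iff_gSub (x : D) (u : E) : u ∈ Lplus P.K x ↔ mcForm E x u ∈ P.gSub :=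
  (P.mem_Lplus x u).trans (P.mem_gSub _).symm

theorem mem_Lminus_iff_gSub' (x : D) (u : E) : u ∈ Lminus P.K x ↔ mcForm E x u ∈ P.gSub' := by
  rw [Lminus_eq, ← gSub_swap]
  exact P.swap.mem_Lplus_iff_gSub x u

/-- For a Manin triple `f` vanishes if and only if the first half is an abelian subalgebra. -/
theorem lieB_gSub_eq_zero_iff (h : P.IsManinTriple) :
    (∀ u ∈ P.gSub, ∀ v ∈ P.gSub, lieB E D u v = 0) ↔ P.f = 0 := by
  constructor
  · intro h0
    funext m n k
    have h1 := h0 (P.b (Sum.inl m)) ((P.mem_gSub _).2 fun n => P.co_inr_b_inl n m)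
      (P.b (Sum.inl n)) ((P.mem_gSub _).2 fun k => P.co_inr_b_inl k n)
    have h2 := P.co_inl_lll m n k
    rw [h1, map_zero] at h2
    exact h2.symm
  · intro hf u hu v hv
    refine P.η₀_nondeg fun A => ?_
    rcases A with k | k
    · have := P.trilinear_eq_of_inl (isTrilinear_bilin_comp P.η₀ (lieB E D)) IsTrilinear.zero
        (fun m n k => by simp [h.1]) ((P.mem_gSub u).1 hu) ((P.mem_gSub v).1 hv)
        (P.co_inr_b_inl · k)
      exact this
    · have ht : IsTrilinear fun u v w : E =>
          P.co (Sum.inl k) (lieB E D u v) * P.co (Sum.inl k) w := by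
        constructor <;> intros <;> simp <;> ring
      have := P.trilinear_eq_of_inl ht IsTrilinear.zero (fun m n k => by simp [hf])
        ((P.mem_gSub u).1 hu) ((P.mem_gSub v).1 hv) (P.co_inr_b_inl · k)
      simpa [co_b] using this

theorem lieB_gSub'_eq_zero_iff (h : P.IsManinTriple) :
    (∀ u ∈ P.gSub', ∀ v ∈ P.gSub', lieB E D u v = 0) ↔ P.Q = 0 := by
  rw [← gSub_swap]
  exact P.swap.lieB_gSub_eq_zero_iff ⟨h.2, h.1⟩

theorem lieB_eq_zero_iff (h : P.IsManinTriple) :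
    (∀ u v : E, lieB E D u v = 0) ↔ P.f = 0 ∧ P.Q = 0 := by
  constructor
  · intro h0
    exact ⟨(P.lieB_gSub_eq_zero_iff h).1 fun u _ v _ => h0 u v,
      (P.lieB_gSub'_eq_zero_iff h).1 fun u _ v _ => h0 u v⟩
  · rintro ⟨hf, hQ⟩ u v
    refine P.η₀_nondeg fun C => ?_
    refine P.trilinear_eq_of_basis (isTrilinear_bilin_comp P.η₀ (lieB E D)) IsTrilinear.zero
      (fun A B C => ?_) u v (P.b C)
    rcases A with a | a <;> rcases B with b | b <;> rcases C with c | c <;>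
      simp [h.1, h.2, hf, hQ]

variable {F : Type*} [NormedAddCommGroup F] [NormedSpace ℝ F]
  {G : Type*} [TopologicalSpace G] [ConnectedSpace G] [ChartedSpace F G] [Group G]
  [LieGroup 𝓘(ℝ, F) ∞ G] {ι : G →* D}
  {F' : Type*} [NormedAddCommGroup F'] [NormedSpace ℝ F']
  {G' : Type*} [TopologicalSpace G'] [ConnectedSpace G'] [ChartedSpace F' G'] [Group G']
  [LieGroup 𝓘(ℝ, F') ∞ G'] {ι' : G' →* D}

theorem isParaKahler_iff_comm (h : P.IsManinTriple) (hι : IsLieSubgroup (F := F) ι P.gSub)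
    (hι' : IsLieSubgroup (F := F') ι' P.gSub') : IsParaKahler P.K P.η ↔
      (∀ a b : G, a * b = b * a) ∧ (∀ a b : G', a * b = b * a) := by
  rw [P.isParaKahler_iff h, hι.comm_iff, hι'.comm_iff, ← P.lieB_gSub_eq_zero_iff h,
    ← P.lieB_gSub'_eq_zero_iff h]

theorem isParaKahler_iff_comm_of_connected [ConnectedSpace D] (h : P.IsManinTriple) :
    IsParaKahler P.K P.η ↔ ∀ a b : D, a * b = b * a := by
  rw [P.isParaKahler_iff h, (isLieSubgroup_id (E := E) (D := D)).comm_iff, ← P.lieB_eq_zero_iff h]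
  exact ⟨fun h u _ v _ => h u v, fun h u v => h u Submodule.mem_top v Submodule.mem_top⟩

theorem leaf_Lplus (hι : IsLieSubgroup (F := F) ι P.gSub)
    (hι' : IsLieSubgroup (F := F') ι' P.gSub') (γ : D) :
    leaf (Lplus P.K) γ = Set.range fun h => γ * ι h :=
  hι.leaf_eq hι' P.isCompl_gSub P.mem_Lplus_iff_gSub γ

theorem leaf_Lminus (hι : IsLieSubgroup (F := F) ι P.gSub)
    (hι' : IsLieSubgroup (F := F') ι' P.gSub') (γ : D) :
    leaf (Lminus P.K) γ = Set.range fun h => γ * ι' h :=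
  hι'.leaf_eq hι P.isCompl_gSub.symm P.mem_Lminus_iff_gSub' γ

end Polarization

end ParaHermitian

end

open ParaHermitian in
theorem mainTheorem5
    {E : Type*} [NormedAddCommGroup E] [NormedSpace ℝ E]
    {D : Type*} [TopologicalSpace D] [T2Space D] [ChartedSpace E D] [Group D]
    [LieGroup 𝓘(ℝ, E) ∞ D]
    {d : ℕ} (P : Polarization E D d)
    {F : Type*} [NormedAddCommGroup F] [NormedSpace ℝ F]
    {G : Type*} [TopologicalSpace G] [ConnectedSpace G] [ChartedSpace F G] [Group G]
    [LieGroup 𝓘(ℝ, F) ∞ G] (ι : G →* D)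
    {F' : Type*} [NormedAddCommGroup F'] [NormedSpace ℝ F']
    {G' : Type*} [TopologicalSpace G'] [ConnectedSpace G'] [ChartedSpace F' G'] [Group G']
    [LieGroup 𝓘(ℝ, F') ∞ G'] (ι' : G' →* D) :
    -- I. An arbitrary polarization: the left-invariant almost para-Hermitian structure.
    (IsAlmostParaHermitian P.K P.η ∧ IsLeftInvariantEnd P.K ∧ IsLeftInvariantBilin P.η ∧
      (∀ x, Lplus P.K x = Submodule.span ℝ (Set.range fun m => P.Z m x)) ∧
      (∀ x, Lminus P.K x = Submodule.span ℝ (Set.range fun m => P.Z' m x)) ∧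
      IsLagrangian P.Ω (Lplus P.K) ∧ IsLagrangian P.Ω (Lminus P.K) ∧
      (IsInvolutive (Lplus P.K) ↔ P.H = 0) ∧ (IsInvolutive (Lminus P.K) ↔ P.R = 0) ∧
      (∀ x u v, P.Ω x u v = ∑ m, wedge₂ (P.Θ m x) (P.Θ' m x) u v) ∧
      (∀ X Y W : VField E D, IsSmoothVF X → IsSmoothVF Y → IsSmoothVF W → ∀ x,
        extDeriv₂ P.Ω X Y W x = (1 / 2) * ∑ m, ∑ n, ∑ p,
          (P.H m n p * wedge₃ (P.Θ m x) (P.Θ n x) (P.Θ p x) (X x) (Y x) (W x)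
            - P.R m n p * wedge₃ (P.Θ' m x) (P.Θ' n x) (P.Θ' p x) (X x) (Y x) (W x)
            + P.f m n p * wedge₃ (P.Θ m x) (P.Θ n x) (P.Θ' p x) (X x) (Y x) (W x)
            - P.Q m n p * wedge₃ (P.Θ' m x) (P.Θ' n x) (P.Θ p x) (X x) (Y x) (W x)))) ∧
    -- II. Brackets of an arbitrary polarization; fluxes obstruct weak integrability.
    ((∃ nab, IsLeviCivita P.η nab) ∧
      ∀ nab, IsLeviCivita P.η nab →
        ((∀ m n, dBracket P.K P.η nab.toFun (P.Z m) (P.Z n) =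
          fun x => ∑ k, P.f m n k • P.Z k x) ∧
        (∀ m n, dBracket P.K P.η nab.toFun (P.Z' m) (P.Z' n) =
          fun x => ∑ k, P.Q m n k • P.Z' k x) ∧
        (∀ m n, connBracket P.η nab.toFun (P.Z m) (P.Z n) =
          fun x => ∑ k, ((3 / 2) * P.f m n k) • P.Z k x
            + ∑ k, ((3 / 2) * antisymm P.H m n k) • P.Z' k x) ∧
        (∀ m n, connBracket P.η nab.toFun (P.Z' m) (P.Z' n) =
          fun x => ∑ k, ((3 / 2) * P.Q m n k) • P.Z' k x
            + ∑ k, ((3 / 2) * antisymm P.R m n k) • P.Z k x) ∧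
        (IsWeaklyIntegrable P.η (connBracket P.η nab.toFun) (Lplus P.K) ↔ antisymm P.H = 0) ∧
        (IsWeaklyIntegrable P.η (connBracket P.η nab.toFun) (Lminus P.K) ↔ antisymm P.R = 0) ∧
        (P.IsAdInvariant →
          (IsWeaklyIntegrable P.η (connBracket P.η nab.toFun) (Lplus P.K) ↔
            IsInvolutive (Lplus P.K)) ∧
          (IsWeaklyIntegrable P.η (connBracket P.η nab.toFun) (Lminus P.K) ↔
            IsInvolutive (Lminus P.K))) ∧
        (∀ K₀, IsParaKahler K₀ P.η →
          (IsCompatibleWith P.K K₀ P.η nab.toFun ↔ antisymm P.H = 0 ∧ antisymm P.R = 0)))) ∧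
    -- III. A Manin triple polarization.
    (P.IsManinTriple →
      (IsParaHermitian P.K P.η ∧ P.IsAdInvariant ∧
      (∀ X Y W : VField E D, IsSmoothVF X → IsSmoothVF Y → IsSmoothVF W → ∀ x,
        extDeriv₂ P.Ω X Y W x = (1 / 2) * ∑ m, ∑ n, ∑ p,
          (P.f m n p * wedge₃ (P.Θ' p x) (P.Θ m x) (P.Θ n x) (X x) (Y x) (W x)
            - P.Q m n p * wedge₃ (P.Θ p x) (P.Θ' m x) (P.Θ' n x) (X x) (Y x) (W x))) ∧
      (IsParaKahler P.K P.η ↔ P.f = 0 ∧ P.Q = 0) ∧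
      (∀ nab, IsLeviCivita P.η nab →
        (∀ m n, dBracket P.K P.η nab.toFun (P.Z m) (P.Z n) =
          fun x => ∑ k, P.f m n k • P.Z k x) ∧
        (∀ m n, dBracket P.K P.η nab.toFun (P.Z' m) (P.Z' n) =
          fun x => ∑ k, P.Q m n k • P.Z' k x) ∧
        (∀ m n, connBracket P.η nab.toFun (P.Z m) (P.Z n) =
          fun x => ∑ k, ((3 / 2) * P.f m n k) • P.Z k x) ∧
        (∀ m n, connBracket P.η nab.toFun (P.Z' m) (P.Z' n) =
          fun x => ∑ k, ((3 / 2) * P.Q m n k) • P.Z' k x) ∧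
        EigenbundlesWeaklyIntegrable P.K P.η (connBracket P.η nab.toFun) ∧
        (∀ K₀, IsParaKahler K₀ P.η → IsCompatibleWith P.K K₀ P.η nab.toFun)) ∧
      -- the two subgroups
      (IsLieSubgroup (F := F) ι P.gSub → IsLieSubgroup (F := F') ι' P.gSub' →
        (∀ (γ : D) (h : G), (Lplus P.K (γ * ι h) : Set _) =
          Set.range (mfderiv 𝓘(ℝ, F) 𝓘(ℝ, E) (fun h' => γ * ι h') h)) ∧
        (∀ (γ : D) (h : G'), (Lminus P.K (γ * ι' h) : Set _) =
          Set.range (mfderiv 𝓘(ℝ, F') 𝓘(ℝ, E) (fun h' => γ * ι' h') h)) ∧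
        (∀ γ : D, leaf (Lplus P.K) γ = Set.range fun h => γ * ι h) ∧
        (∀ γ : D, leaf (Lminus P.K) γ = Set.range fun h => γ * ι' h) ∧
        (IsParaKahler P.K P.η ↔
          (∀ a b : G, a * b = b * a) ∧ (∀ a b : G', a * b = b * a)) ∧
        (ConnectedSpace D → (IsParaKahler P.K P.η ↔ ∀ a b : D, a * b = b * a))))) := by
  have : FiniteDimensional ℝ E := P.finiteDimensional
  refine ⟨⟨P.isAlmostParaHermitian, P.isLeftInvariantEnd, P.isLeftInvariantBilin, P.Lplus_eq_span,
    P.Lminus_eq_span, P.isLagrangian_Lplus, P.isLagrangian_Lminus, P.isInvolutive_Lplus_iff,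
    P.isInvolutive_Lminus_iff, P.Ω_eq_sum_wedge₂, fun X Y W hX hY hW x => P.extDeriv₂_Ω hX hY hW x⟩,
    ⟨P.exists_isLeviCivita, fun nab h => ⟨P.dBracket_Z h, P.dBracket_Z' h, P.connBracket_Z h,
      P.connBracket_Z' h, P.isWeaklyIntegrable_Lplus_iff h, P.isWeaklyIntegrable_Lminus_iff h,
      fun ha => ⟨?_, ?_⟩, fun K₀ hK => P.isCompatibleWith_iff h hK⟩⟩,
    fun hM => ⟨P.isParaHermitian_of_isManinTriple hM, P.isAdInvariant_of_isManinTriple hM,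
      fun X Y W hX hY hW x => P.extDeriv₂_Ω_of_isManinTriple hM hX hY hW x, P.isParaKahler_iff hM,
      fun nab h => ⟨P.dBracket_Z h, P.dBracket_Z' h, P.connBracket_Z_of_isManinTriple hM h,
        P.connBracket_Z'_of_isManinTriple hM h,
        ⟨(P.isWeaklyIntegrable_Lplus_iff h).2 (by rw [hM.1, Polarization.antisymm_zero]),
          (P.isWeaklyIntegrable_Lminus_iff h).2 (by rw [hM.2, Polarization.antisymm_zero])⟩,
        fun K₀ hK => (P.isCompatibleWith_iff h hK).2
          ⟨by rw [hM.1, Polarization.antisymm_zero], by rw [hM.2, Polarization.antisymm_zero]⟩⟩,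
      fun hι hι' => ⟨fun γ h => ?_, fun γ h => ?_, P.leaf_Lplus hι hι', P.leaf_Lminus hι hι',
        P.isParaKahler_iff_comm hM hι hι', fun _ => P.isParaKahler_iff_comm_of_connected hM⟩⟩⟩
  · rw [P.isWeaklyIntegrable_Lplus_iff h, P.isInvolutive_Lplus_iff,
      P.antisymm_H_of_isAdInvariant ha]
  · rw [P.isWeaklyIntegrable_Lminus_iff h, P.isInvolutive_Lminus_iff,
      P.antisymm_R_of_isAdInvariant ha]
  · exact Set.ext fun u => (P.mem_Lplus_iff_gSub _ u).trans
      (hι.mem_range_mder_translate_iff γ h u).symm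
  · exact Set.ext fun u => (P.mem_Lminus_iff_gSub' _ u).trans
      (hι'.mem_range_mder_translate_iff γ h u).symm
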